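/- Let $d\ge 1$, let $\varrho$ be a nonzero finite positive measure with compact support in $(0,\infty)$, and let $$V(s):=-\log\int\varrho(\mathrm{d}k)\,e^{-\frac12 k s^2},\qquad s\in\mathbb R .$$ Let $\mathbb B$ be the set of positively oriented nearest-neighbor edges $(x,x+\hat e_i)$ of $\mathbb Z^d$. A configuration $\eta=(\eta_b)\in\mathbb R^{\mathbb B}$ obeys the *loop condition* if its signed sum around every cycle of length four of $\mathbb Z^d$ vanishes; then there is a unique $\phi=\phi(\eta)\in\mathbb R^{\mathbb Z^d}$ with $\phi_0=0$ and $\eta_{xy}=\phi_y-\phi_x$ for every $(x,y)\in\mathbb B$. A probability measure $\mu$ on $\mathbb R^{\mathbb B}$ is a *gradient Gibbs measure* for $V$ if $\mu$-a.e. $\eta$ obeys the loop condition and, for each finite $\Lambda\subset\mathbb Z^d$, the conditional law under $\mu$ given $\sigma(\phi_y-\phi_x: x,y\notin\Lambda)$ is, for $\mu$-a.e. $\eta$, the law of the gradients of the field which equals $\phi(\eta)$ outside $\Lambda$ and whose restriction to $\Lambda$ has the law $$\frac1Z\exp\Bigl\{-\sum_{\langle x,y\rangle:\,\{x,y\}\cap\Lambda\ne\emptyset}V(\phi_y-\phi_x)\Bigr\}\prod_{x\in\Lambda}\mathrm{d}\phi_x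 .$$ The measure $\mu$ has *zero tilt* if each $\eta_b$ is $\mu$-integrable with $E_\mu(\eta_b)=0$. The *extension* of $\mu$ is the unique measure $\tilde\mu$ on $\mathbb R^{\mathbb B}\times\mathbb R^{\mathbb B}\ni(\eta,\kappa)$ such that, for each finite $S\subset\mathbb B$ and all Borel sets $A\subset\mathbb R^{\mathbb B}$ and $B\subset\mathbb R^{S}$, $$\tilde\mu\bigl(\eta\in A,\ (\kappa_b)_{b\in S}\in B\bigr)=\int_B\prod_{b\in S}\varrho(\mathrm{d}\kappa_b)\;E_\mu\Bigl(1_A(\eta)\prod_{b\in S}e^{V(\eta_b)-\frac12\kappa_b\eta_b^2}\Bigr).$$ For $\kappa\in(0,\infty)^{\mathbb B}$ let $(\mathcal L_\kappa g)(x):=\sum_{y:|y-x|=1}\kappa_{xy}[g(y)-g(x)]$, where $\kappa_{xy}=\kappa_{yx}$. For $f:\mathbb Z^d\to\mathbb R$ with finite support and $\sum_x f(x)=0$, write $(-\mathcal L_\kappa)^{-1}f$ for a function $g$ which satisfies $-\mathcal L_\kappa g=f$ and which is a limit of finitely supported functions $h_n$ in the Dirichlet energy, that is, $\sum_{(x,y)\in\mathbb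 B}\kappa_{xy}\bigl[(g-h_n)(y)-(g-h_n)(x)\bigr]^2\to0$. **Lemma.** Let $\mu$ be a translation-invariant, ergodic gradient Gibbs measure for $V$ with zero tilt, let $\tilde\mu$ be its extension, and let $\mathscr F:=\sigma(\kappa_b: b\in\mathbb B)$. For $\tilde\mu$-a.e. $\kappa$, the regular conditional law of $\phi=\phi(\eta)$ under $\tilde\mu$ given $\mathscr F$ is carried by $\{\phi:\phi_0=0\}$ and is Gaussian with mean zero, $$E_{\tilde\mu}(\phi_x\,|\,\mathscr F)(\kappa)=0,\qquad x\in\mathbb Z^d,$$ and with covariance $(-\mathcal L_\kappa)^{-1}$: for all $f,f':\mathbb Z^d\to\mathbb R$ with finite support and zero sum, $(-\mathcal L_\kappa)^{-1}f$ exists and, for each such function (they differ by constants), $$\operatorname{Cov}_{\tilde\mu}\Bigl(\sum_x f'(x)\phi_x,\ \sum_x f(x)\phi_x\,\Big|\,\mathscr F\Bigr)(\kappa)=\sum_x f'(x)\,\bigl((-\mathcal L_\kappa)^{-1}f\bigr)(x);$$ in particular $$\operatorname{Var}_{\tilde\mu}\Bigl(\sum_x f(x)\phi_x\,\Big|\,\mathscr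 F\Bigr)(\kappa)=\sum_x f(x)\,\bigl((-\mathcal L_\kappa)^{-1}f\bigr)(x).$$ -/

import Mathlib

namespace GradientGibbs

open MeasureTheory ProbabilityTheory Filter Topology
open scoped ENNReal

/-- The vertices of the hypercubic lattice `ℤ^d`. -/
abbrev Lattice (d : ℕ) : Type := Fin d → ℤ

/-- The positively oriented nearest-neighbour edges of `ℤ^d`: the pair `(x, i)` is the edge
from `x` to `x + e_i`. -/
abbrev Edge (d : ℕ) : Type := Lattice d × Fin d

/-- The coordinate unit vector `e_i`. -/
def unitVec {d : ℕ} (i : Fin d) : Lattice d := Pi.single i 1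

/-- The gradient of a field: `η_{xy} = φ_y - φ_x` on each positively oriented edge. -/
def grad {d : ℕ} (φ : Lattice d → ℝ) : Edge d → ℝ :=
  fun b => φ (b.1 + unitVec b.2) - φ b.1

/-- The loop condition: the signed sum of `η` around every cycle of length four
`x, x + e_i, x + e_i + e_j, x + e_j` vanishes. -/
def LoopCondition {d : ℕ} (η : Edge d → ℝ) : Prop :=
  ∀ (x : Lattice d) (i j : Fin d),
    η (x, i) + η (x + unitVec i, j) - η (x + unitVec j, i) - η (x, j) = 0

open Classical in
/-- The field `φ` with `φ_0 = 0` and gradient `η`. It exists (and is unique) exactly when `η` obeys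
the loop condition; it is set to `0` for all other `η`. -/
noncomputable def field {d : ℕ} (η : Edge d → ℝ) : Lattice d → ℝ :=
  if h : ∃ φ : Lattice d → ℝ, φ 0 = 0 ∧ grad φ = η then h.choose else 0

/-- The potential `V(s) = -log ∫ ϱ(dk) exp(-k s² / 2)`. -/
noncomputable def potential (ϱ : Measure ℝ) (s : ℝ) : ℝ :=
  -Real.log (∫ k, Real.exp (-(1 / 2 * k * s ^ 2)) ∂ϱ)

/-- The edges with at least one endpoint in `Λ`. -/
def touching {d : ℕ} (Λ : Finset (Lattice d)) : Finset (Edge d) :=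
  (Λ ×ˢ Finset.univ) ∪
    (Λ ×ˢ (Finset.univ : Finset (Fin d))).image fun b => (b.1 - unitVec b.2, b.2)

/-- The field that equals `ψ` on `Λ` and the boundary condition `φ` outside `Λ`. -/
def glue {d : ℕ} (Λ : Finset (Lattice d)) (φ : Lattice d → ℝ) (ψ : Λ → ℝ) : Lattice d → ℝ :=
  fun x => if h : x ∈ Λ then ψ ⟨x, h⟩ else φ x

/-- The Boltzmann weight `exp(-∑ V(η_b))`, the sum being over all edges that touch `Λ`. -/
noncomputable def weight {d : ℕ} (ϱ : Measure ℝ) (Λ : Finset (Lattice d)) (η : Edge d → ℝ) :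
    ℝ≥0∞ :=
  ENNReal.ofReal (Real.exp (-∑ b ∈ touching Λ, potential ϱ (η b)))

/-- The specification `γ_Λ(· | η)`: the law of the gradients of the field that equals the field of
`η` outside `Λ` and is distributed on `Λ` according to the normalized Boltzmann weight times
Lebesgue measure. -/
noncomputable def specification {d : ℕ} (ϱ : Measure ℝ) (Λ : Finset (Lattice d))
    (η : Edge d → ℝ) : Measure (Edge d → ℝ) :=
  (∫⁻ ψ : Λ → ℝ, weight ϱ Λ (grad (glue Λ (field η) ψ)))⁻¹ •
    ((volume : Measure (Λ → ℝ)).withDensity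
      fun ψ => weight ϱ Λ (grad (glue Λ (field η) ψ))).map
        fun ψ => grad (glue Λ (field η) ψ)

/-- The `σ`-algebra generated by the differences `φ_y - φ_x` of the field over all vertices
`x, y` outside `Λ`. -/
@[reducible] noncomputable def outside {d : ℕ} (Λ : Finset (Lattice d)) : MeasurableSpace (Edge d → ℝ) :=
  ⨆ (x : Lattice d) (_ : x ∉ Λ) (y : Lattice d) (_ : y ∉ Λ),
    MeasurableSpace.comap (fun η => field η y - field η x) (borel ℝ)

/-- A gradient Gibbs measure for the potential `V`: it is carried by the configurations that obey
the loop condition, and for each finite `Λ` the conditional law given the gradient field outside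
`Λ` is `γ_Λ`. -/
def IsGradientGibbs {d : ℕ} (ϱ : Measure ℝ) (μ : Measure (Edge d → ℝ)) : Prop :=
  (∀ᵐ η ∂μ, LoopCondition η) ∧
  ∀ (Λ : Finset (Lattice d)) (A : Set (Edge d → ℝ)), MeasurableSet A →
    μ[A.indicator (fun _ => (1 : ℝ)) | outside Λ] =ᵐ[μ]
      fun η => (specification ϱ Λ η A).toReal

/-- The translation `(τ_x η)_{yz} = η_{y+x,z+x}`. -/
def translate {d : ℕ} (x : Lattice d) (η : Edge d → ℝ) : Edge d → ℝ :=
  fun b => η (b.1 + x, b.2)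

def IsTranslationInvariant {d : ℕ} (μ : Measure (Edge d → ℝ)) : Prop :=
  ∀ x : Lattice d, μ.map (translate x) = μ

/-- Every translation-invariant event has probability `0` or `1`. -/
def IsErgodic {d : ℕ} (μ : Measure (Edge d → ℝ)) : Prop :=
  ∀ A : Set (Edge d → ℝ), MeasurableSet A → (∀ x : Lattice d, translate x ⁻¹' A = A) →
    μ A = 0 ∨ μ A = 1

def HasZeroTilt {d : ℕ} (μ : Measure (Edge d → ℝ)) : Prop :=
  ∀ b : Edge d, Integrable (fun η => η b) μ ∧ ∫ η, η b ∂μ = 0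

/-- `μt` is the extension of `μ` to pairs `(η, κ)`: its projection to `η` and `(κ_b)_{b ∈ S}` is
`∏_{b ∈ S} ϱ(dκ_b) exp(V(η_b) - κ_b η_b² / 2) μ(dη)` for each finite set `S` of edges. This
determines `μt` uniquely. -/
def IsExtension {d : ℕ} (ϱ : Measure ℝ) (μ : Measure (Edge d → ℝ))
    (μt : Measure ((Edge d → ℝ) × (Edge d → ℝ))) : Prop :=
  ∀ (S : Finset (Edge d)) (A : Set (Edge d → ℝ)) (B : Set (S → ℝ)),
    MeasurableSet A → MeasurableSet B →
    μt (A ×ˢ {κ | (fun b : S => κ b) ∈ B}) =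
      ∫⁻ k in B, (∫⁻ η in A, ∏ b : S,
        ENNReal.ofReal (Real.exp (potential ϱ (η b) - 1 / 2 * k b * η b ^ 2)) ∂μ)
        ∂(Measure.pi fun _ : S => ϱ)

/-- The law of the field `φ` (with `φ_0 = 0`) under the regular conditional distribution of `μt`
given the conductances `κ`. -/
noncomputable def condLaw {d : ℕ} (μt : Measure ((Edge d → ℝ) × (Edge d → ℝ)))
    [IsFiniteMeasure μt] : Kernel (Edge d → ℝ) (Lattice d → ℝ) :=
  condDistrib (fun ω => field ω.1) (fun ω => ω.2) μt

/-- The generator `(L_κ g)(x) = ∑_{y : |y - x| = 1} κ_{xy} (g(y) - g(x))`. -/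
def generator {d : ℕ} (κ : Edge d → ℝ) (g : Lattice d → ℝ) (x : Lattice d) : ℝ :=
  ∑ i : Fin d, (κ (x, i) * (g (x + unitVec i) - g x) +
    κ (x - unitVec i, i) * (g (x - unitVec i) - g x))

/-- The Dirichlet energy `∑_b κ_b (∇g)_b²`. -/
noncomputable def energy {d : ℕ} (κ : Edge d → ℝ) (g : Lattice d → ℝ) : ℝ≥0∞ :=
  ∑' b : Edge d, ENNReal.ofReal (κ b * grad g b ^ 2)

/-- `g = (-L_κ)⁻¹ f`: the function `g` solves `-L_κ g = f` and lies in the closure, in the Dirichlet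
energy, of the finitely supported functions. For uniformly elliptic `κ` and finitely supported `f`
with zero sum there is such a `g`, and it is unique up to an additive constant. -/
def IsInverseImage {d : ℕ} (κ : Edge d → ℝ) (f : Lattice d →₀ ℝ) (g : Lattice d → ℝ) : Prop :=
  (∀ x, -generator κ g x = f x) ∧
  ∃ h : ℕ → Lattice d →₀ ℝ, Tendsto (fun n => energy κ (fun x => g x - h n x)) atTop (𝓝 0)

/-- The pairing `∑_x f(x) φ_x`. -/
def pair {d : ℕ} (f : Lattice d →₀ ℝ) (φ : Lattice d → ℝ) : ℝ :=
  f.sum fun x a => a * φ x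

end GradientGibbs

namespace GradientGibbs
open MeasureTheory ProbabilityTheory Filter Topology
open scoped ENNReal

variable {d : ℕ}

/-! ### Lattice paths, gradients and the field -/

/-! Fix the conductances and a finite volume `Λ`. In the extended measure the factors `exp(-V)` of
the Gibbs weight cancel against the factors `exp(V)` of the extension (`weight_mul_extDensity`), so
given `κ` and the field outside `Λ` the field in `Λ` has a Gaussian weight. Split `η` into a part
that is `κ`-harmonic in `Λ`, determined by the field outside `Λ`, and the gradient of a field
supported in `Λ` (the Dirichlet part). By Pythagoras and translation invariance of Lebesgue measure,
a linear functional `(f, ·)` of the Dirichlet part is centered normal with variance `(f, G_Λ f)`,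
independently of the harmonic part given `κ` (`lintegral_resample`). For `f` of zero sum, the Green
forms converge to `(f, (-L_κ)⁻¹ f)`, because the solution in `Λ` is the best energy approximation of
the infinite-volume one (`energy_sub_dirichletSolve_le`, `tendsto_pair_dirichletSolve`); the latter
exists by projection in `ℓ²` (`exists_isInverseImage`).

The main point is that the harmonic part disappears in the limit. Only first moments of `η` are
assumed, so the argument avoids second moments. An `L¹` mean ergodic theorem, ergodicity and zero
tilt make the field sublinear in mean (`eventually_meanAbs_le`). The Dirichlet part at a point is of
order the square root of the size of the box, hence the harmonic field `u` in a box is sublinear in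
mean as well. Testing the harmonic equation with a cutoff times the truncation of `u` at level `K`
bounds the energy of the truncation by `K` times the `L¹` norm of `∇u`, divided by the size of the
box; the `L¹` norm per edge is bounded uniformly. A level that is a small multiple of the size, but
large compared with the mean of `|u|`, shows that `min 1 |∇u|` is small on average over the box
(`eventually_sum_integral_min_one_harmonicPart_le`). Translation invariance of the extension turns
the average over edges into an average over shifted boxes, one of which must be good
(`eventually_exists_volume`).

Along these volumes the characteristic function of `(f, φ)`, restricted to a cylinder event of `κ`,
converges to the Gaussian one (`setIntegral_cexp_pair_field`). A π-λ argument identifies the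
conditional characteristic function for each `f`, and rational `f` with continuity give one null set
for all `f`. Continuous functionals on `ℝ^(ℤ^d)` have finite support, so the conditional law is
Gaussian, and polarization gives its covariance. -/

theorem unitVec_apply (i j : Fin d) : unitVec i j = if j = i then 1 else 0 := by
  simp [unitVec, Pi.single_apply]

theorem lattice_induction {p : Lattice d → Prop} (zero : p 0)
    (add : ∀ x i, p x → p (x + unitVec i)) (sub : ∀ x i, p x → p (x - unitVec i)) (x : Lattice d) :
    p x := by
  induction hn : ∑ i, (x i).natAbs using Nat.strong_induction_on generalizing x with
  | _ n ih =>
    by_cases hx : x = 0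
    · exact hx ▸ zero
    · obtain ⟨i, hi⟩ := Function.ne_iff.1 hx
      have key : ∀ y : Lattice d, (∀ j, j ≠ i → y j = x j) → (y i).natAbs < (x i).natAbs → p y := by
        intro y hy hyi
        refine ih _ ?_ y rfl
        rw [← hn]
        refine Finset.sum_lt_sum (fun j _ => ?_) ⟨i, Finset.mem_univ _, hyi⟩
        by_cases hj : j = i
        · subst hj; exact hyi.le
        · rw [hy j hj]
      simp only [Pi.zero_apply] at hi
      rcases lt_or_gt_of_ne hi with h | h
      · have := sub (x + unitVec i) i (key _ (fun j hj => by simp [unitVec_apply, hj]) (by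
          simp only [Pi.add_apply, unitVec_apply, if_true]; omega))
        simpa using this
      · have := add (x - unitVec i) i (key _ (fun j hj => by simp [unitVec_apply, hj]) (by
          simp only [Pi.sub_apply, unitVec_apply, if_true]; omega))
        simpa using this

/-- The pairing `∑_b θ_b η_b` of a finitely supported flow with a gradient configuration. -/
def flowPair (θ : Edge d →₀ ℝ) (η : Edge d → ℝ) : ℝ := θ.sum fun b a => a * η b

theorem flowPair_add (θ θ' : Edge d →₀ ℝ) (η : Edge d → ℝ) :
    flowPair (θ + θ') η = flowPair θ η + flowPair θ' η := by
  unfold flowPair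
  exact Finsupp.sum_add_index' (by simp) (by intros; ring)

theorem flowPair_single (b : Edge d) (a : ℝ) (η : Edge d → ℝ) :
    flowPair (Finsupp.single b a) η = a * η b := by
  simp [flowPair]

theorem flowPair_add_right (θ : Edge d →₀ ℝ) (η η' : Edge d → ℝ) :
    flowPair θ (η + η') = flowPair θ η + flowPair θ η' := by
  simp [flowPair, Finsupp.sum, mul_add, Finset.sum_add_distrib]

theorem continuous_flowPair (θ : Edge d →₀ ℝ) : Continuous (flowPair θ) := by
  unfold flowPair Finsupp.sum
  fun_prop

theorem pair_add (f f' : Lattice d →₀ ℝ) (φ : Lattice d → ℝ) :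
    pair (f + f') φ = pair f φ + pair f' φ := by
  unfold pair
  exact Finsupp.sum_add_index' (by simp) (by intros; ring)

theorem pair_smul (c : ℝ) (f : Lattice d →₀ ℝ) (φ : Lattice d → ℝ) :
    pair (c • f) φ = c * pair f φ := by
  unfold pair
  rw [Finsupp.sum_smul_index (by simp), Finsupp.mul_sum]
  simp only [mul_assoc]

theorem pair_single (x : Lattice d) (a : ℝ) (φ : Lattice d → ℝ) :
    pair (Finsupp.single x a) φ = a * φ x := by
  simp [pair]

theorem pair_sub_right (f : Lattice d →₀ ℝ) (φ ψ : Lattice d → ℝ) :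
    pair f (fun x => φ x - ψ x) = pair f φ - pair f ψ := by
  simp [pair, Finsupp.sum, mul_sub, Finset.sum_sub_distrib]

theorem continuous_pair (f : Lattice d →₀ ℝ) : Continuous (pair f) := by
  unfold pair Finsupp.sum
  fun_prop

theorem pair_sub_const {f : Lattice d →₀ ℝ} (hf : (f.sum fun _ a => a) = 0) (φ : Lattice d → ℝ)
    (c : ℝ) : pair f (fun x => φ x - c) = pair f φ := by
  rw [pair_sub_right f φ fun _ => c]
  have : pair f (fun _ => c) = (f.sum fun _ a => a) * c := by
    simp [pair, Finsupp.sum, Finset.sum_mul]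
  rw [this, hf]; ring

theorem grad_sub (φ ψ : Lattice d → ℝ) : grad (fun x => φ x - ψ x) = grad φ - grad ψ := by
  ext b; simp [grad]; ring

theorem exists_flow_zero (x : Lattice d) :
    ∃ θ : Edge d →₀ ℝ, ∀ h : Lattice d → ℝ, flowPair θ (grad h) = h x - h 0 := by
  induction x using lattice_induction with
  | zero => exact ⟨0, fun h => by simp [flowPair]⟩
  | add x i ih =>
    obtain ⟨θ, hθ⟩ := ih
    refine ⟨θ + Finsupp.single (x, i) 1, fun h => ?_⟩
    rw [flowPair_add, hθ, flowPair_single]; simp [grad]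
  | sub x i ih =>
    obtain ⟨θ, hθ⟩ := ih
    refine ⟨θ + Finsupp.single (x - unitVec i, i) (-1), fun h => ?_⟩
    rw [flowPair_add, hθ, flowPair_single]; simp [grad]

/-- A finitely supported flow from `0` to `x`. -/
noncomputable def flowTo (x : Lattice d) : Edge d →₀ ℝ := (exists_flow_zero x).choose

theorem flowPair_flowTo (x : Lattice d) (h : Lattice d → ℝ) :
    flowPair (flowTo x) (grad h) = h x - h 0 := (exists_flow_zero x).choose_spec h

/-- Route the mass `f x` from the origin to `x` along a lattice path; zero total mass removes the
value at the origin. Zero-sum functionals of the field are therefore finite linear functionals of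
its gradient. -/
theorem exists_flow_of_sum_eq_zero (f : Lattice d →₀ ℝ) (hf : (f.sum fun _ a => a) = 0) :
    ∃ θ : Edge d →₀ ℝ, ∀ h : Lattice d → ℝ, flowPair θ (grad h) = pair f h := by
  have key : ∀ f : Lattice d →₀ ℝ, ∃ θ : Edge d →₀ ℝ, ∀ h : Lattice d → ℝ,
      flowPair θ (grad h) = pair f (fun x => h x - h 0) := by
    intro f
    induction f using Finsupp.induction_linear with
    | zero => exact ⟨0, fun h => by simp [flowPair, pair]⟩
    | add f g hf hg =>
      obtain ⟨θ, hθ⟩ := hf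
      obtain ⟨θ', hθ'⟩ := hg
      exact ⟨θ + θ', fun h => by rw [flowPair_add, pair_add, hθ, hθ']⟩
    | single x a =>
      refine ⟨a • flowTo x, fun h => ?_⟩
      rw [pair_single, ← flowPair_flowTo]
      unfold flowPair
      rw [Finsupp.sum_smul_index (by simp), Finsupp.mul_sum]
      simp only [mul_assoc]
  obtain ⟨θ, hθ⟩ := key f
  exact ⟨θ, fun h => by rw [hθ, pair_sub_const hf]⟩

theorem field_eq_of_grad {η : Edge d → ℝ} {φ : Lattice d → ℝ} (h0 : φ 0 = 0) (h : grad φ = η) :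
    field η = φ := by
  have hex : ∃ φ : Lattice d → ℝ, φ 0 = 0 ∧ grad φ = η := ⟨φ, h0, h⟩
  unfold field
  rw [dif_pos hex]
  ext x
  have h1 := flowPair_flowTo x hex.choose
  have h2 := flowPair_flowTo x φ
  rw [hex.choose_spec.2, hex.choose_spec.1] at h1
  rw [h, h0] at h2
  linarith

theorem field_zero (η : Edge d → ℝ) : field η 0 = 0 := by
  unfold field
  split_ifs with h
  · exact h.choose_spec.1
  · rfl

/-- The skew translation of `ℤ^d × ℝ` whose second component accumulates `η` along direction
`i`. -/
def skewShift (η : Edge d → ℝ) (i : Fin d) : Equiv.Perm (Lattice d × ℝ) where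
  toFun p := (p.1 + unitVec i, p.2 + η (p.1, i))
  invFun p := (p.1 - unitVec i, p.2 - η (p.1 - unitVec i, i))
  left_inv p := by simp
  right_inv p := by simp

theorem commute_skewShift {η : Edge d → ℝ} (h : LoopCondition η) (i j : Fin d) :
    Commute (skewShift η i) (skewShift η j) := by
  ext p
  · simp [skewShift, add_right_comm]
  · have := h p.1 i j
    simp only [Equiv.Perm.mul_apply, skewShift, Equiv.coe_fn_mk]
    linarith

/-- The loop condition says exactly that the skew translations in different directions commute, so
they generate an action of `ℤ^d` on `ℤ^d × ℝ`. The real coordinate of the orbit of `(0, 0)`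
integrates `η`, with no need to compare paths. -/
theorem exists_grad_of_loopCondition {η : Edge d → ℝ} (h : LoopCondition η) :
    ∃ φ : Lattice d → ℝ, φ 0 = 0 ∧ grad φ = η := by
  let F : (Fin d → Multiplicative ℤ) →* Equiv.Perm (Lattice d × ℝ) :=
    MonoidHom.noncommPiCoprod (fun i => zpowersHom _ (skewShift η i)) (fun i j _ x y => by
      simpa using ((commute_skewShift h i j).zpow_zpow _ _))
  let Φ : Lattice d → Equiv.Perm (Lattice d × ℝ) := fun x => F fun i => Multiplicative.ofAdd (x i)
  have hstep : ∀ x i, Φ (x + unitVec i) = skewShift η i * Φ x := by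
    intro x i
    have : F (Pi.mulSingle i (Multiplicative.ofAdd 1)) = skewShift η i :=
      (MonoidHom.noncommPiCoprod_mulSingle _ i _).trans (by simp)
    rw [← this, ← map_mul]
    congr 1
    ext j
    by_cases hj : j = i
    · subst hj; simp [unitVec_apply, add_comm]
    · simp [unitVec_apply, hj]
  have hstep' : ∀ x i, Φ x = skewShift η i * Φ (x - unitVec i) := by
    intro x i; rw [← hstep]; simp
  have h0 : Φ 0 = 1 := by simp only [Φ]; exact map_one F
  have h1 : ∀ x, (Φ x (0, 0)).1 = x := by
    intro x
    induction x using lattice_induction with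
    | zero => simp [h0]
    | add x i ih => rw [hstep]; simp [skewShift, ih]
    | sub x i ih => rw [hstep' x i] at ih; simp only [skewShift, Equiv.Perm.mul_apply,
        Equiv.coe_fn_mk] at ih; exact eq_sub_of_add_eq ih
  refine ⟨fun x => (Φ x (0, 0)).2, by simp [h0], ?_⟩
  ext ⟨x, i⟩
  simp only [grad, hstep]
  simp [skewShift, h1]

theorem grad_field {η : Edge d → ℝ} (h : LoopCondition η) : grad (field η) = η := by
  obtain ⟨φ, h0, hφ⟩ := exists_grad_of_loopCondition h
  rw [field_eq_of_grad h0 hφ, hφ]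

theorem loopCondition_grad (φ : Lattice d → ℝ) : LoopCondition (grad φ) := by
  intro x i j
  simp only [grad]
  rw [add_right_comm x (unitVec j) (unitVec i)]
  ring

/-- On loop configurations the field is a finite linear functional of `η`; its measurability,
integrability and mean all come from this. -/
theorem field_apply {η : Edge d → ℝ} (h : LoopCondition η) (x : Lattice d) :
    field η x = flowPair (flowTo x) η := by
  conv_rhs => rw [← grad_field h]
  rw [flowPair_flowTo, field_zero, sub_zero]

theorem field_of_not_loopCondition {η : Edge d → ℝ} (h : ¬ LoopCondition η) : field η = 0 := by
  unfold field
  rw [dif_neg]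
  rintro ⟨φ, -, rfl⟩
  exact h (loopCondition_grad φ)

theorem measurableSet_loopCondition : MeasurableSet {η : Edge d → ℝ | LoopCondition η} := by
  unfold LoopCondition
  simp only [Set.ofPred_forall]
  refine MeasurableSet.iInter fun x => MeasurableSet.iInter fun i => MeasurableSet.iInter fun j => ?_
  exact measurableSet_eq_fun (by fun_prop) measurable_const

theorem measurable_field : Measurable (field : (Edge d → ℝ) → Lattice d → ℝ) := by
  classical
  refine measurable_pi_lambda _ fun x => ?_
  have : (fun η : Edge d → ℝ => field η x) =
      fun η => if LoopCondition η then flowPair (flowTo x) η else 0 := by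
    ext η
    split_ifs with h
    · exact field_apply h x
    · simp [field_of_not_loopCondition h]
  rw [this]
  exact Measurable.ite measurableSet_loopCondition (continuous_flowPair _).measurable
    measurable_const

theorem outside_le (Λ : Finset (Lattice d)) :
    outside Λ ≤ (inferInstance : MeasurableSpace (Edge d → ℝ)) := by
  refine iSup_le fun x => iSup_le fun _ => iSup_le fun y => iSup_le fun _ => ?_
  rw [← BorelSpace.measurable_eq, ← measurable_iff_comap_le]
  exact ((measurable_pi_apply y).comp measurable_field).sub
    ((measurable_pi_apply x).comp measurable_field)

end GradientGibbs

namespace GradientGibbs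
open MeasureTheory ProbabilityTheory Filter Topology
open scoped ENNReal

variable {d : ℕ}

/-! ### The Dirichlet problem in a finite set -/

/-- The divergence `∑_i (w(x, i) - w(x - e_i, i))` of a flow. -/
def diverg (w : Edge d → ℝ) (x : Lattice d) : ℝ :=
  ∑ i : Fin d, (w (x, i) - w (x - unitVec i, i))

theorem generator_eq_diverg (κ : Edge d → ℝ) (g : Lattice d → ℝ) (x : Lattice d) :
    generator κ g x = diverg (fun b => κ b * grad g b) x := by
  unfold generator diverg
  refine Finset.sum_congr rfl fun i _ => ?_
  simp only [grad, sub_add_cancel]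
  ring

theorem diverg_sub (w w' : Edge d → ℝ) (x : Lattice d) :
    diverg (fun b => w b - w' b) x = diverg w x - diverg w' x := by
  simp only [diverg, ← Finset.sum_sub_distrib]
  exact Finset.sum_congr rfl fun i _ => by ring

theorem diverg_congr {Λ : Finset (Lattice d)} {w w' : Edge d → ℝ}
    (h : ∀ b ∈ touching Λ, w b = w' b) {x : Lattice d} (hx : x ∈ Λ) : diverg w x = diverg w' x := by
  unfold diverg
  refine Finset.sum_congr rfl fun i _ => ?_
  rw [h, h]
  · simp only [touching, Finset.mem_union, Finset.mem_image, Finset.mem_product]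
    exact Or.inr ⟨(x, i), by simp [hx], rfl⟩
  · simp [touching, hx]

theorem mem_touching {Λ : Finset (Lattice d)} {b : Edge d} :
    b ∈ touching Λ ↔ b.1 ∈ Λ ∨ b.1 + unitVec b.2 ∈ Λ := by
  obtain ⟨x, i⟩ := b
  simp only [touching, Finset.mem_union, Finset.mem_image, Finset.mem_product, Finset.mem_univ,
    and_true, Prod.mk.injEq, Prod.exists]
  refine or_congr Iff.rfl ⟨?_, fun h => ⟨_, i, h, by simp, rfl⟩⟩
  rintro ⟨y, j, hy, rfl, rfl⟩
  simpa using hy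

theorem grad_eq_zero_of_notMem_touching {Λ : Finset (Lattice d)} {h : Lattice d → ℝ}
    (hh : ∀ x ∉ Λ, h x = 0) {b : Edge d} (hb : b ∉ touching Λ) : grad h b = 0 := by
  rw [mem_touching, not_or] at hb
  simp [grad, hh _ hb.1, hh _ hb.2]

/-- Summation by parts. There are no boundary terms since `h` vanishes outside `Λ` and `touching Λ`
contains every edge on which `∇h` can be nonzero. -/
theorem sum_touching_mul_grad {Λ : Finset (Lattice d)} (w : Edge d → ℝ) {h : Lattice d → ℝ}
    (hh : ∀ x ∉ Λ, h x = 0) :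
    ∑ b ∈ touching Λ, w b * grad h b = -∑ x ∈ Λ, h x * diverg w x := by
  have h1 : ∑ b ∈ touching Λ, w b * h b.1 = ∑ x ∈ Λ, ∑ i, w (x, i) * h x := by
    rw [← Finset.sum_product' Λ Finset.univ (fun x i => w (x, i) * h x)]
    refine (Finset.sum_subset (fun b hb => ?_) fun b _ hb => ?_).symm
    · simp only [Finset.mem_product, Finset.mem_univ, and_true] at hb
      exact mem_touching.2 (Or.inl hb)
    · simp only [Finset.mem_product, Finset.mem_univ, and_true] at hb
      simp [hh _ hb]
  have h2 : ∑ b ∈ touching Λ, w b * h (b.1 + unitVec b.2) =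
      ∑ x ∈ Λ, ∑ i, w (x - unitVec i, i) * h x := by
    rw [← Finset.sum_product' Λ Finset.univ (fun x i => w (x - unitVec i, i) * h x)]
    symm
    refine Finset.sum_of_injOn (fun b => (b.1 - unitVec b.2, b.2)) ?_ ?_ ?_ ?_
    · rintro ⟨x, i⟩ _ ⟨y, j⟩ _ hxy
      simp only [Prod.mk.injEq] at hxy
      obtain ⟨h1, rfl⟩ := hxy
      simpa using h1
    · rintro ⟨x, i⟩ hx
      simp only [Finset.coe_product, Set.mem_prod, Finset.mem_coe] at hx
      exact mem_touching.2 (Or.inr (by simpa using hx.1))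
    · rintro ⟨x, i⟩ _ hx
      rw [hh, mul_zero]
      intro hmem
      exact hx ⟨(x + unitVec i, i), by simpa using hmem, by simp⟩
    · rintro ⟨x, i⟩ _
      simp
  simp only [grad, mul_sub, Finset.sum_sub_distrib]
  rw [h1, h2, ← Finset.sum_sub_distrib, ← Finset.sum_neg_distrib]
  refine Finset.sum_congr rfl fun x _ => ?_
  rw [diverg, Finset.mul_sum, ← Finset.sum_sub_distrib, ← Finset.sum_neg_distrib]
  exact Finset.sum_congr rfl fun i _ => by ring

theorem glue_of_notMem {Λ : Finset (Lattice d)} (φ : Lattice d → ℝ) (ψ : Λ → ℝ) {x : Lattice d}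
    (hx : x ∉ Λ) : glue Λ φ ψ x = φ x := by simp [glue, hx]

theorem glue_coe {Λ : Finset (Lattice d)} (φ : Lattice d → ℝ) (ψ : Λ → ℝ) (x : Λ) :
    glue Λ φ ψ x = ψ x := by simp [glue]

/-- Telescope along the ray in direction `i` until it has left `Λ`, then apply Cauchy–Schwarz. The
linear growth in `N` later makes the Dirichlet part at a point of order the square root of the box
size. -/
theorem sq_le_mul_sum_touching {Λ : Finset (Lattice d)} {h : Lattice d → ℝ}
    (hh : ∀ x ∉ Λ, h x = 0) (x : Lattice d) (i : Fin d) (N : ℕ) (hN : x + N • unitVec i ∉ Λ) :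
    h x ^ 2 ≤ N * ∑ b ∈ touching Λ, grad h b ^ 2 := by
  have htel : ∑ j ∈ Finset.range N, grad h (x + j • unitVec i, i) = - h x := by
    have := Finset.sum_range_sub (fun j => h (x + j • unitVec i)) N
    rw [hh _ hN] at this
    simpa [grad, add_smul, add_assoc] using this
  have hcs := sq_sum_le_card_mul_sum_sq (s := Finset.range N)
    (f := fun j => grad h (x + j • unitVec i, i))
  rw [htel, neg_sq, Finset.card_range] at hcs
  refine hcs.trans (mul_le_mul_of_nonneg_left ?_ (Nat.cast_nonneg _))
  have hinj : Set.InjOn (fun j : ℕ => ((x + j • unitVec i, i) : Edge d)) (Finset.range N) := by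
    intro j _ j' _ hjj
    simp only [Prod.mk.injEq, and_true, add_right_inj] at hjj
    have := congrFun hjj i
    simpa [unitVec_apply] using this
  rw [← Finset.sum_image (f := fun b => grad h b ^ 2) hinj]
  rw [← Finset.sum_filter_of_ne (p := (· ∈ touching Λ)) fun b _ hb => by
    by_contra hbt
    exact hb (by rw [grad_eq_zero_of_notMem_touching hh hbt]; simp)]
  exact Finset.sum_le_sum_of_subset_of_nonneg (fun b hb => (Finset.mem_filter.1 hb).2)
    fun b _ _ => sq_nonneg _

theorem exists_add_smul_notMem (Λ : Finset (Lattice d)) (x : Lattice d) (i : Fin d) :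
    ∃ N : ℕ, x + N • unitVec i ∉ Λ := by
  have hinj : Function.Injective (fun j : ℕ => x + j • unitVec i) := by
    intro j j' hjj
    have := congrFun (add_left_cancel hjj) i
    simpa [unitVec_apply] using this
  obtain ⟨y, ⟨N, rfl⟩, hy⟩ := (Set.infinite_range_of_injective hinj).exists_notMem_finset Λ
  exact ⟨N, hy⟩

open Classical in
/-- The matrix of `-L_k` on `Λ` with zero boundary values. -/
noncomputable def dirichletMatrix (Λ : Finset (Lattice d)) (k : Edge d → ℝ) : Matrix Λ Λ ℝ :=
  Matrix.of fun x y => -diverg (fun b => k b * grad (Pi.single (y : Lattice d) 1) b) x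

theorem dirichletMatrix_mulVec (Λ : Finset (Lattice d)) (k : Edge d → ℝ) (ψ : Λ → ℝ) (x : Λ) :
    (dirichletMatrix Λ k).mulVec ψ x = -diverg (fun b => k b * grad (glue Λ 0 ψ) b) x := by
  classical
  have hg : ∀ z, glue Λ 0 ψ z = ∑ y : Λ, ψ y * (Pi.single (y : Lattice d) (1 : ℝ) : _ → ℝ) z := by
    intro z
    by_cases hz : z ∈ Λ
    · rw [Finset.sum_eq_single ⟨z, hz⟩]
      · simp [glue, hz]
      · intro y _ hy
        rw [Pi.single_eq_of_ne, mul_zero]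
        rintro rfl; exact hy rfl
      · simp
    · rw [glue_of_notMem _ _ hz, Finset.sum_eq_zero]; · rfl
      intro y _
      rw [Pi.single_eq_of_ne, mul_zero]
      rintro rfl; exact hz y.2
  simp only [Matrix.mulVec, dotProduct, dirichletMatrix, Matrix.of_apply, diverg, grad, hg]
  simp only [neg_mul, Finset.sum_neg_distrib, neg_inj, Finset.sum_mul]
  rw [Finset.sum_comm]
  refine Finset.sum_congr rfl fun i _ => ?_
  rw [← Finset.sum_sub_distrib, ← Finset.sum_sub_distrib, Finset.mul_sum, Finset.mul_sum,
    ← Finset.sum_sub_distrib]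
  exact Finset.sum_congr rfl fun y _ => by ring

theorem dotProduct_dirichletMatrix (Λ : Finset (Lattice d)) (k : Edge d → ℝ) (ψ ψ' : Λ → ℝ) :
    dotProduct ψ ((dirichletMatrix Λ k).mulVec ψ') =
      ∑ b ∈ touching Λ, k b * grad (glue Λ 0 ψ') b * grad (glue Λ 0 ψ) b := by
  rw [sum_touching_mul_grad (fun b => k b * grad (glue Λ 0 ψ') b)
    (fun x hx => by rw [glue_of_notMem _ _ hx]; rfl)]
  rw [← Finset.sum_coe_sort Λ, ← Finset.sum_neg_distrib]
  simp only [dotProduct, dirichletMatrix_mulVec, glue_coe]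
  exact Finset.sum_congr rfl fun y _ => by ring

/-- Zero energy makes `h` constant along every ray, and every ray leaves the finite set `Λ`. A
direction has to exist, whence `1 ≤ d`. -/
theorem sum_touching_eq_zero_iff (hd : 1 ≤ d) {Λ : Finset (Lattice d)} {k : Edge d → ℝ}
    (hk : ∀ b ∈ touching Λ, 0 < k b) {h : Lattice d → ℝ} (hh : ∀ x ∉ Λ, h x = 0)
    (h0 : ∑ b ∈ touching Λ, k b * grad h b * grad h b = 0) : h = 0 := by
  have hz : ∀ b ∈ touching Λ, grad h b = 0 := by
    intro b hb
    have := (Finset.sum_eq_zero_iff_of_nonneg (fun b hb => by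
      rw [mul_assoc]; exact mul_nonneg (hk b hb).le (mul_self_nonneg _))).1 h0 b hb
    simpa [(hk b hb).ne'] using this
  ext x
  obtain ⟨N, hN⟩ := exists_add_smul_notMem Λ x ⟨0, hd⟩
  have := sq_le_mul_sum_touching hh x _ N hN
  rw [Finset.sum_eq_zero (fun b hb => by rw [hz b hb]; simp), mul_zero] at this
  simpa using le_antisymm this (sq_nonneg _)

theorem isUnit_dirichletMatrix (hd : 1 ≤ d) {Λ : Finset (Lattice d)} {k : Edge d → ℝ}
    (hk : ∀ b ∈ touching Λ, 0 < k b) : IsUnit (dirichletMatrix Λ k) := by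
  classical
  rw [← Matrix.mulVec_injective_iff_isUnit]
  rw [← Matrix.coe_mulVecLin, injective_iff_map_eq_zero]
  intro ψ hψ
  rw [Matrix.mulVecLin_apply] at hψ
  have h0 := dotProduct_dirichletMatrix Λ k ψ ψ
  rw [hψ, dotProduct_zero] at h0
  have := sum_touching_eq_zero_iff hd hk (fun x hx => by rw [glue_of_notMem _ _ hx]; rfl) h0.symm
  ext x
  rw [← glue_coe 0 ψ x, this]; rfl

/-- The solution of `-L_k h = F` on `Λ` with `h = 0` outside `Λ`. -/
noncomputable def dirichletSolve (Λ : Finset (Lattice d)) (k : Edge d → ℝ) (F : Lattice d → ℝ) :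
    Lattice d → ℝ :=
  glue Λ 0 ((dirichletMatrix Λ k)⁻¹.mulVec fun x => F x)

theorem dirichletSolve_of_notMem {Λ : Finset (Lattice d)} (k : Edge d → ℝ) (F : Lattice d → ℝ)
    (x : Lattice d) (hx : x ∉ Λ) : dirichletSolve Λ k F x = 0 :=
  glue_of_notMem _ _ hx

theorem diverg_dirichletSolve (hd : 1 ≤ d) {Λ : Finset (Lattice d)} {k : Edge d → ℝ}
    (hk : ∀ b ∈ touching Λ, 0 < k b) (F : Lattice d → ℝ) {x : Lattice d} (hx : x ∈ Λ) :
    -diverg (fun b => k b * grad (dirichletSolve Λ k F) b) x = F x := by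
  have h := dirichletMatrix_mulVec Λ k ((dirichletMatrix Λ k)⁻¹.mulVec fun x => F x) ⟨x, hx⟩
  rw [Matrix.mulVec_mulVec, Matrix.mul_nonsing_inv _
    ((Matrix.isUnit_iff_isUnit_det _).1 (isUnit_dirichletMatrix hd hk)), Matrix.one_mulVec] at h
  exact h.symm

theorem dirichletSolve_unique (hd : 1 ≤ d) {Λ : Finset (Lattice d)} {k : Edge d → ℝ}
    (hk : ∀ b ∈ touching Λ, 0 < k b) {F h : Lattice d → ℝ} (hh : ∀ x ∉ Λ, h x = 0)
    (hF : ∀ x ∈ Λ, -diverg (fun b => k b * grad h b) x = F x) : h = dirichletSolve Λ k F := by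
  have hzero : ∀ x ∉ Λ, h x - dirichletSolve Λ k F x = 0 := fun x hx => by
    rw [hh x hx, dirichletSolve_of_notMem k F x hx, sub_zero]
  have := sum_touching_eq_zero_iff hd hk hzero ?_
  · ext x; exact sub_eq_zero.1 (congrFun this x)
  rw [sum_touching_mul_grad _ hzero, neg_eq_zero]
  refine Finset.sum_eq_zero fun x hx => ?_
  simp only [grad_sub, Pi.sub_apply, mul_sub]
  rw [diverg_sub, ← neg_neg (diverg _ x), hF x hx,
    ← neg_neg (diverg (fun b => k b * grad (dirichletSolve Λ k F) b) x),
    diverg_dirichletSolve hd hk F hx]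
  simp

/-- The weak form of the Dirichlet problem: the solution represents `(F, ·)` in the energy inner
product. -/
theorem sum_touching_dirichletSolve (hd : 1 ≤ d) {Λ : Finset (Lattice d)} {k : Edge d → ℝ}
    (hk : ∀ b ∈ touching Λ, 0 < k b) (F : Lattice d → ℝ) {h : Lattice d → ℝ}
    (hh : ∀ x ∉ Λ, h x = 0) :
    ∑ b ∈ touching Λ, k b * grad (dirichletSolve Λ k F) b * grad h b = ∑ x ∈ Λ, F x * h x := by
  rw [sum_touching_mul_grad _ hh, ← Finset.sum_neg_distrib]
  refine Finset.sum_congr rfl fun x hx => ?_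
  rw [← mul_neg, diverg_dirichletSolve hd hk F hx, mul_comm]

/-- The quadratic form `(F, G_Λ F)` of the Green function in `Λ`. -/
noncomputable def greenForm (Λ : Finset (Lattice d)) (k : Edge d → ℝ) (F : Lattice d → ℝ) : ℝ :=
  ∑ x ∈ Λ, F x * dirichletSolve Λ k F x

theorem greenForm_eq (hd : 1 ≤ d) {Λ : Finset (Lattice d)} {k : Edge d → ℝ}
    (hk : ∀ b ∈ touching Λ, 0 < k b) (F : Lattice d → ℝ) :
    greenForm Λ k F = ∑ b ∈ touching Λ, k b * grad (dirichletSolve Λ k F) b ^ 2 := by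
  rw [greenForm, ← sum_touching_dirichletSolve hd hk F (dirichletSolve_of_notMem k F)]
  exact Finset.sum_congr rfl fun b _ => by ring

theorem greenForm_nonneg (hd : 1 ≤ d) {Λ : Finset (Lattice d)} {k : Edge d → ℝ}
    (hk : ∀ b ∈ touching Λ, 0 < k b) (F : Lattice d → ℝ) : 0 ≤ greenForm Λ k F := by
  rw [greenForm_eq hd hk]
  exact Finset.sum_nonneg fun b hb => mul_nonneg (hk b hb).le (sq_nonneg _)

/-- If `(F, h)² ≤ C · E(h)` for all `h` supported in `Λ`, then `(F, G_Λ F) ≤ C`. -/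
theorem greenForm_le (hd : 1 ≤ d) {Λ : Finset (Lattice d)} {k : Edge d → ℝ}
    (hk : ∀ b ∈ touching Λ, 0 < k b) (F : Lattice d → ℝ) {C : ℝ} (hC : 0 ≤ C)
    (h : ∀ h : Lattice d → ℝ, (∀ x ∉ Λ, h x = 0) →
      (∑ x ∈ Λ, F x * h x) ^ 2 ≤ C * ∑ b ∈ touching Λ, k b * grad h b ^ 2) :
    greenForm Λ k F ≤ C := by
  have h1 := h _ (dirichletSolve_of_notMem k F)
  rw [← greenForm_eq hd hk] at h1
  change greenForm Λ k F ^ 2 ≤ _ at h1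
  rcases (greenForm_nonneg hd hk F).eq_or_lt with h0 | h0
  · rw [← h0]; exact hC
  · rw [sq] at h1
    exact le_of_mul_le_mul_right h1 h0

/-- The part of a gradient configuration that is resampled in `Λ`: the field `ζ` supported in `Λ`
for which `η - ∇ζ` is divergence free in `Λ` with respect to the conductances `k`. -/
noncomputable def dirichletPart (Λ : Finset (Lattice d)) (k η : Edge d → ℝ) : Lattice d → ℝ :=
  dirichletSolve Λ k fun x => -diverg (fun b => k b * η b) x

/-- The `k`-harmonic part `η - ∇ζ` in `Λ`. -/
noncomputable def harmonicPart (Λ : Finset (Lattice d)) (k η : Edge d → ℝ) : Edge d → ℝ :=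
  η - grad (dirichletPart Λ k η)

theorem diverg_harmonicPart (hd : 1 ≤ d) {Λ : Finset (Lattice d)} {k : Edge d → ℝ}
    (hk : ∀ b ∈ touching Λ, 0 < k b) (η : Edge d → ℝ) {x : Lattice d} (hx : x ∈ Λ) :
    diverg (fun b => k b * harmonicPart Λ k η b) x = 0 := by
  have := diverg_dirichletSolve hd hk (fun x => -diverg (fun b => k b * η b) x) hx
  simp only [harmonicPart, Pi.sub_apply, mul_sub]
  rw [diverg_sub, ← neg_inj.1 this]
  simp [dirichletPart]

theorem dirichletPart_unique (hd : 1 ≤ d) {Λ : Finset (Lattice d)} {k : Edge d → ℝ}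
    (hk : ∀ b ∈ touching Λ, 0 < k b) {η : Edge d → ℝ} {h : Lattice d → ℝ} (hh : ∀ x ∉ Λ, h x = 0)
    (hF : ∀ x ∈ Λ, diverg (fun b => k b * (η b - grad h b)) x = 0) :
    h = dirichletPart Λ k η := by
  refine dirichletSolve_unique hd hk hh fun x hx => ?_
  have := hF x hx
  simp only [mul_sub] at this
  rw [diverg_sub] at this
  linarith

/-- Changing the field inside `Λ` changes `ζ` by the same amount. -/
theorem dirichletPart_glue (hd : 1 ≤ d) {Λ : Finset (Lattice d)} {k : Edge d → ℝ}
    (hk : ∀ b ∈ touching Λ, 0 < k b) (φ : Lattice d → ℝ) (ψ : Λ → ℝ) :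
    dirichletPart Λ k (grad (glue Λ φ ψ)) =
      fun x => glue Λ 0 ψ x + dirichletPart Λ k (grad (glue Λ φ 0)) x := by
  symm
  refine dirichletPart_unique hd hk (fun x hx => ?_) fun x hx => ?_
  · rw [glue_of_notMem _ _ hx, dirichletPart, dirichletSolve_of_notMem _ _ x hx]; simp
  · rw [← diverg_harmonicPart hd hk (grad (glue Λ φ 0)) hx]
    congr 1
    ext b
    congr 1
    have : ∀ z, glue Λ φ ψ z = glue Λ φ 0 z + glue Λ 0 ψ z := by
      intro z
      by_cases hz : z ∈ Λ <;> simp [glue, hz]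
    simp only [harmonicPart, Pi.sub_apply, grad, this]
    ring

/-- The harmonic part is a function of the conductances and the field outside `Λ` alone. Resampling
in `Λ` leaves it fixed, hence its independence of the Gaussian part given `κ`. -/
theorem harmonicPart_glue (hd : 1 ≤ d) {Λ : Finset (Lattice d)} {k : Edge d → ℝ}
    (hk : ∀ b ∈ touching Λ, 0 < k b) (φ : Lattice d → ℝ) (ψ : Λ → ℝ) :
    harmonicPart Λ k (grad (glue Λ φ ψ)) = harmonicPart Λ k (grad (glue Λ φ 0)) := by
  have : ∀ z, glue Λ φ ψ z = glue Λ φ 0 z + glue Λ 0 ψ z := by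
    intro z
    by_cases hz : z ∈ Λ <;> simp [glue, hz]
  ext b
  simp only [harmonicPart, dirichletPart_glue hd hk φ ψ, Pi.sub_apply, grad, this]
  ring

/-- Pythagoras: the energy in `Λ` splits into the harmonic and the resampled part. -/
theorem sum_touching_pythagoras (hd : 1 ≤ d) {Λ : Finset (Lattice d)} {k : Edge d → ℝ}
    (hk : ∀ b ∈ touching Λ, 0 < k b) (η : Edge d → ℝ) :
    ∑ b ∈ touching Λ, k b * η b ^ 2 = ∑ b ∈ touching Λ, k b * harmonicPart Λ k η b ^ 2 +
      ∑ b ∈ touching Λ, k b * grad (dirichletPart Λ k η) b ^ 2 := by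
  have h0 : ∑ b ∈ touching Λ, k b * harmonicPart Λ k η b * grad (dirichletPart Λ k η) b = 0 := by
    rw [sum_touching_mul_grad (h := dirichletPart Λ k η) _ (dirichletSolve_of_notMem k _),
      neg_eq_zero]
    exact Finset.sum_eq_zero fun x hx => by rw [diverg_harmonicPart hd hk η hx, mul_zero]
  rw [← add_zero (∑ b ∈ touching Λ, k b * harmonicPart Λ k η b ^ 2 + _), ← mul_zero 2, ← h0,
    Finset.mul_sum, ← Finset.sum_add_distrib, ← Finset.sum_add_distrib]
  refine Finset.sum_congr rfl fun b _ => ?_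
  simp only [harmonicPart, Pi.sub_apply]
  ring

/-- The hypothesis on the volumes says `Λ' = Λ + x`; both sides solve the same Dirichlet problem, so
uniqueness applies. -/
theorem dirichletSolve_translate (hd : 1 ≤ d) {Λ Λ' : Finset (Lattice d)} {k : Edge d → ℝ}
    (x : Lattice d) (hΛ : ∀ y, y + x ∈ Λ' ↔ y ∈ Λ) (hk : ∀ b, 0 < k b) (F : Lattice d → ℝ) :
    (fun y => dirichletSolve Λ' k F (y + x)) =
      dirichletSolve Λ (translate x k) fun y => F (y + x) := by
  refine dirichletSolve_unique hd (fun b _ => hk _) (fun y hy => ?_) fun y hy => ?_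
  · exact dirichletSolve_of_notMem _ _ _ (by rwa [hΛ])
  · rw [← diverg_dirichletSolve hd (fun b _ => hk b) F ((hΛ y).2 hy)]
    simp only [diverg, grad, add_right_comm _ x, sub_add_eq_add_sub]

theorem harmonicPart_translate (hd : 1 ≤ d) {Λ Λ' : Finset (Lattice d)} {k : Edge d → ℝ}
    (x : Lattice d) (hΛ : ∀ y, y + x ∈ Λ' ↔ y ∈ Λ) (hk : ∀ b, 0 < k b) (η : Edge d → ℝ) :
    translate x (harmonicPart Λ' k η) = harmonicPart Λ (translate x k) (translate x η) := by
  have h := dirichletSolve_translate hd x hΛ hk fun x => -diverg (fun b => k b * η b) x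
  have h2 : (fun y => -diverg (fun b => k b * η b) (y + x)) =
      fun y => -diverg (fun b => translate x k b * translate x η b) y := by
    ext y
    simp only [diverg, translate, sub_add_eq_add_sub]
  rw [h2] at h
  ext b
  simp only [harmonicPart, translate, Pi.sub_apply, dirichletPart]
  congr 1
  have h' := congrArg (fun g => grad g b) h
  simp only [translate] at h'
  rw [← h']
  simp only [grad, add_right_comm _ x]

/-! ### Energy of truncated harmonic functions -/

theorem sq_clamp_sub_le (K s t : ℝ) (hK : 0 ≤ K) :
    (max (-K) (min K s) - max (-K) (min K t)) ^ 2 ≤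
      (s - t) * (max (-K) (min K s) - max (-K) (min K t)) := by
  -- The clamp is nondecreasing and 1-Lipschitz; the cases record on which side of `±K` each
  -- argument lies.
  rcases max_cases (-K) (min K s) with h1 | h1 <;> rcases min_cases K s with h2 | h2 <;>
  rcases max_cases (-K) (min K t) with h3 | h3 <;> rcases min_cases K t with h4 | h4 <;>
  rw [h1.1, h3.1] <;> (try rw [h2.1]) <;> (try rw [h4.1]) <;> nlinarith

/-- The energy of the truncation of a harmonic function at level `K`, weighted with a cutoff `χ`. -/
theorem sum_cutoff_mul_sq_grad_clamp_le {Λ : Finset (Lattice d)} {k : Edge d → ℝ}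
    {u χ : Lattice d → ℝ} {a c K : ℝ} (ha : 0 ≤ a)
    (hk : ∀ b ∈ touching Λ, a ≤ k b ∧ k b ≤ c) (hK : 0 ≤ K)
    (hu : ∀ x ∈ Λ, diverg (fun b => k b * grad u b) x = 0)
    (hχ : ∀ x, 0 ≤ χ x) (hχΛ : ∀ x ∉ Λ, χ x = 0) (hχ1 : ∀ b, |grad χ b| ≤ 1) :
    a * ∑ b ∈ touching Λ, χ b.1 * grad (fun x => max (-K) (min K (u x))) b ^ 2 ≤
      c * K * ∑ b ∈ touching Λ, |grad u b| := by
  set T : Lattice d → ℝ := fun x => max (-K) (min K (u x)) with hT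
  -- Test the harmonic equation with `χ T`, where `T` is the truncation: it is supported in `Λ` and
  -- bounded by `K χ`, so first moments of `∇u` suffice below.
  have h0 : ∑ b ∈ touching Λ, k b * grad u b * grad (fun x => χ x * T x) b = 0 := by
    rw [sum_touching_mul_grad _ (fun x hx => by rw [hχΛ x hx, zero_mul]), neg_eq_zero]
    exact Finset.sum_eq_zero fun x hx => by rw [hu x hx, mul_zero]
  rw [← zero_add (c * K * _), ← h0, Finset.mul_sum, Finset.mul_sum, ← Finset.sum_add_distrib]
  refine Finset.sum_le_sum fun b hb => ?_
  obtain ⟨hka, hkc⟩ := hk b hb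
  have h1 : grad T b ^ 2 ≤ grad u b * grad T b := sq_clamp_sub_le K _ _ hK
  -- Discrete product rule, with `χ` at the tail of the edge to match the claimed sum and `T` at its
  -- head.
  have h2 : grad (fun x => χ x * T x) b =
      χ b.1 * grad T b + T (b.1 + unitVec b.2) * grad χ b := by simp only [grad]; ring
  have h3 : a * (χ b.1 * grad T b ^ 2) ≤ k b * χ b.1 * (grad u b * grad T b) := by
    rw [← mul_assoc]
    exact mul_le_mul (mul_le_mul_of_nonneg_right hka (hχ _)) h1 (sq_nonneg _)
      (mul_nonneg (ha.trans hka) (hχ _))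
  have h4 : |T (b.1 + unitVec b.2)| ≤ K := by
    rw [abs_le]
    exact ⟨le_max_left _ _, max_le (by linarith) (min_le_left _ _)⟩
  have h5 : |k b * grad u b * (T (b.1 + unitVec b.2) * grad χ b)| ≤ c * K * |grad u b| := by
    rw [abs_mul, abs_mul, abs_mul, abs_of_nonneg (ha.trans hka)]
    calc k b * |grad u b| * (|T (b.1 + unitVec b.2)| * |grad χ b|)
        ≤ c * |grad u b| * (K * 1) := by
          have := hχ1 b
          have := ha.trans hka
          have := this.trans hkc
          gcongr
      _ = c * K * |grad u b| := by ring
  have h6 := neg_abs_le (k b * grad u b * (T (b.1 + unitVec b.2) * grad χ b))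
  rw [h2]
  linarith

end GradientGibbs

namespace GradientGibbs
open MeasureTheory ProbabilityTheory Filter Topology
open scoped ENNReal

variable {d : ℕ}

/-! ### The inverse of the generator in infinite volume -/

theorem pair_eq_sum {Λ : Finset (Lattice d)} {f : Lattice d →₀ ℝ} (hf : f.support ⊆ Λ)
    (φ : Lattice d → ℝ) : pair f φ = ∑ x ∈ Λ, f x * φ x :=
  Finsupp.sum_of_support_subset _ hf _ (by simp)

/-- The error `g - G_Λ f` is energy-orthogonal to all functions supported in `Λ`, so `G_Λ f` is the
best approximation of `g` among them. Edges off `touching Λ` contribute equally to both sides. -/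
theorem energy_sub_dirichletSolve_le (hd : 1 ≤ d) {κ : Edge d → ℝ} (hκ : ∀ b, 0 < κ b)
    {f : Lattice d →₀ ℝ} {g : Lattice d → ℝ} (hg : ∀ x, -generator κ g x = f x)
    {Λ : Finset (Lattice d)} {h : Lattice d → ℝ} (hh : ∀ x ∉ Λ, h x = 0) :
    energy κ (fun x => g x - dirichletSolve Λ κ f x) ≤ energy κ (fun x => g x - h x) := by
  unfold energy
  rw [← ENNReal.sum_add_tsum_compl (touching Λ), ← ENNReal.sum_add_tsum_compl (touching Λ)]
  refine add_le_add ?_ (le_of_eq ?_)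
  · rw [← ENNReal.ofReal_sum_of_nonneg (fun b _ => mul_nonneg (hκ b).le (sq_nonneg _)),
      ← ENNReal.ofReal_sum_of_nonneg (fun b _ => mul_nonneg (hκ b).le (sq_nonneg _))]
    refine ENNReal.ofReal_le_ofReal ?_
    have h0 : ∑ b ∈ touching Λ, κ b * grad (fun x => g x - dirichletSolve Λ κ f x) b *
        grad (fun x => dirichletSolve Λ κ f x - h x) b = 0 := by
      rw [sum_touching_mul_grad _ (fun x hx => by
        rw [dirichletSolve_of_notMem _ _ x hx, hh x hx, sub_zero]), neg_eq_zero]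
      refine Finset.sum_eq_zero fun x hx => ?_
      simp only [grad_sub, Pi.sub_apply, mul_sub]
      rw [diverg_sub, ← generator_eq_diverg]
      have h1 := diverg_dirichletSolve hd (fun b _ => hκ b) f hx
      have h2 := hg x
      rw [show generator κ g x - diverg (fun b => κ b * grad (dirichletSolve Λ κ f) b) x = 0 by
        linarith, mul_zero]
    have h1 : ∑ b ∈ touching Λ, κ b * grad (fun x => g x - h x) b ^ 2 =
        ∑ b ∈ touching Λ, κ b * grad (fun x => g x - dirichletSolve Λ κ f x) b ^ 2 +
        ∑ b ∈ touching Λ, κ b * grad (fun x => dirichletSolve Λ κ f x - h x) b ^ 2 := by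
      rw [← add_zero (_ + ∑ b ∈ touching Λ, κ b * grad (fun x => dirichletSolve Λ κ f x - h x) b ^ 2),
        ← mul_zero 2, ← h0, Finset.mul_sum, ← Finset.sum_add_distrib, ← Finset.sum_add_distrib]
      refine Finset.sum_congr rfl fun b _ => ?_
      simp only [grad]
      ring
    rw [h1]
    exact le_add_of_nonneg_right
      (Finset.sum_nonneg fun b _ => mul_nonneg (hκ b).le (sq_nonneg _))
  · refine tsum_congr fun b => ?_
    have hb : (b : Edge d) ∉ touching Λ := b.2
    have e1 := grad_eq_zero_of_notMem_touching hh hb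
    have e2 := grad_eq_zero_of_notMem_touching (dirichletSolve_of_notMem κ f) hb
    simp only [grad_sub, Pi.sub_apply, e1, e2]

/-- Best approximation sends the energy error to zero, positive conductances turn this into
convergence of the gradient on each edge, and a zero-sum `f'` sees only finitely many gradients. In
particular `pair f' g` is the same for every admissible `g`. -/
theorem tendsto_pair_dirichletSolve (hd : 1 ≤ d) {κ : Edge d → ℝ} (hκ : ∀ b, 0 < κ b)
    {f : Lattice d →₀ ℝ} {g : Lattice d → ℝ} (hg : IsInverseImage κ f g)
    {f' : Lattice d →₀ ℝ} (hf' : (f'.sum fun _ a => a) = 0) :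
    Tendsto (fun Λ => pair f' (dirichletSolve Λ κ f)) atTop (𝓝 (pair f' g)) := by
  obtain ⟨hg, h, hh⟩ := hg
  have henergy : Tendsto (fun Λ => energy κ (fun x => g x - dirichletSolve Λ κ f x)) atTop
      (𝓝 0) := by
    rw [ENNReal.tendsto_nhds_zero]
    intro ε hε
    obtain ⟨n, hn⟩ := ((ENNReal.tendsto_nhds_zero.1 hh) ε hε).exists
    filter_upwards [eventually_ge_atTop (h n).support] with Λ hΛ
    exact (energy_sub_dirichletSolve_le hd hκ hg fun x hx => by
      simpa using fun hx' => hx (hΛ hx')).trans hn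
  have hgrad : ∀ b, Tendsto (fun Λ => grad (fun x => g x - dirichletSolve Λ κ f x) b) atTop
      (𝓝 0) := by
    intro b
    have h1 : Tendsto (fun Λ => κ b * grad (fun x => g x - dirichletSolve Λ κ f x) b ^ 2) atTop
        (𝓝 0) := by
      have h2 : Tendsto (fun Λ => ENNReal.ofReal
          (κ b * grad (fun x => g x - dirichletSolve Λ κ f x) b ^ 2)) atTop (𝓝 0) :=
        tendsto_of_tendsto_of_tendsto_of_le_of_le tendsto_const_nhds henergy
          (fun _ => zero_le) fun Λ => ENNReal.le_tsum b
      have h3 := (ENNReal.tendsto_toReal ENNReal.zero_ne_top).comp h2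
      refine h3.congr fun Λ => ?_
      exact ENNReal.toReal_ofReal (mul_nonneg (hκ b).le (sq_nonneg _))
    have h2 := h1.const_mul (κ b)⁻¹
    simp only [inv_mul_cancel_left₀ (hκ b).ne', mul_zero] at h2
    have h3 := h2.sqrt
    simp only [Real.sqrt_sq_eq_abs, Real.sqrt_zero] at h3
    exact (tendsto_zero_iff_abs_tendsto_zero _).2 h3
  obtain ⟨θ, hθ⟩ := exists_flow_of_sum_eq_zero f' hf'
  have h4 : Tendsto (fun Λ => pair f' (fun x => g x - dirichletSolve Λ κ f x)) atTop (𝓝 0) := by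
    simp only [← hθ, flowPair, Finsupp.sum]
    have := tendsto_finsetSum θ.support fun b _ => (hgrad b).const_mul (θ b)
    simpa using this
  have h5 := (tendsto_const_nhds (x := pair f' g)).sub h4
  simpa [pair_sub_right] using h5

theorem energy_eq_ofReal_norm_sq {κ : Edge d → ℝ} (g : Lattice d → ℝ)
    (v : lp (fun _ : Edge d => ℝ) 2) (hv : ∀ b, κ b * grad g b ^ 2 = v b ^ 2) :
    energy κ g = ENNReal.ofReal (‖v‖ ^ 2) := by
  unfold energy
  simp only [hv]
  have hs := lp.hasSum_inner (𝕜 := ℝ) v v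
  rw [real_inner_self_eq_norm_sq] at hs
  simp only [real_inner_self_eq_norm_sq, Real.norm_eq_abs, sq_abs] at hs
  rw [← hs.tsum_eq, ENNReal.ofReal_tsum_of_nonneg (fun b => sq_nonneg _) hs.summable]

open Classical in
/-- The map `h ↦ (√κ_b (∇h)_b)_b` from finitely supported functions to `ℓ²`. -/
noncomputable def sqrtGrad (κ : Edge d → ℝ) :
    (Lattice d →₀ ℝ) →ₗ[ℝ] lp (fun _ : Edge d => ℝ) 2 :=
  Finsupp.linearCombination ℝ fun x => ∑ i : Fin d,
    (lp.single 2 (x - unitVec i, i) √(κ (x - unitVec i, i)) - lp.single 2 (x, i) √(κ (x, i)))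

/-- The adjoint of `√κ ∇` is minus the divergence of `√κ v`; hence orthogonality relations in `ℓ²`
become equations for the generator. -/
theorem inner_sqrtGrad_single (κ : Edge d → ℝ) (v : lp (fun _ : Edge d => ℝ) 2) (x : Lattice d) :
    inner ℝ v (sqrtGrad κ (Finsupp.single x 1)) = -diverg (fun b => √(κ b) * v b) x := by
  classical
  simp only [sqrtGrad, Finsupp.linearCombination_single, one_smul, inner_sum, inner_sub_right,
    diverg, ← Finset.sum_neg_distrib]
  refine Finset.sum_congr rfl fun i _ => ?_
  rw [lp.inner_single_right, lp.inner_single_right]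
  simp

theorem sqrtGrad_apply (κ : Edge d → ℝ) (h : Lattice d →₀ ℝ) (b : Edge d) :
    sqrtGrad κ h b = √(κ b) * grad h b := by
  classical
  induction h using Finsupp.induction_linear with
  | zero => simp [grad]
  | add h h' ih ih' =>
    rw [map_add, lp.coeFn_add, Pi.add_apply, ih, ih']; simp [grad]; ring
  | single x a =>
    obtain ⟨y, j⟩ := b
    have e : sqrtGrad κ (Finsupp.single x a) = a • sqrtGrad κ (Finsupp.single x 1) := by
      rw [← map_smul]; simp
    rw [e, lp.coeFn_smul, Pi.smul_apply]
    have h1 := inner_sqrtGrad_single κ (lp.single 2 (y, j) 1) x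
    rw [lp.inner_single_left] at h1
    simp only [RCLike.inner_apply, map_one, mul_one] at h1
    rw [h1]
    have h2 : ∀ z i, √(κ (z, i)) * (lp.single (E := fun _ : Edge d => ℝ) 2 (y, j) (1 : ℝ)) (z, i) =
        if i = j then (if z = y then √(κ (y, j)) else 0) else 0 := by
      intro z i
      rw [lp.single_apply, Pi.single_apply]
      split_ifs <;> simp_all
    simp only [diverg, h2, Finset.sum_sub_distrib, Finset.sum_ite_eq',
      Finset.mem_univ, if_true, grad, Finsupp.single_apply, sub_eq_iff_eq_add, smul_eq_mul]
    split_ifs <;> ring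

/-- Riesz representation in the closure of the weighted gradients: represent `(f, ·)` by a finite
vector built from a flow and project it there. The projection is a limit of gradients, thus it obeys
the loop condition after division by `√κ` and integrates to a function `g`. -/
theorem exists_isInverseImage {κ : Edge d → ℝ} (hκ : ∀ b, 0 < κ b) {f : Lattice d →₀ ℝ}
    (hf : (f.sum fun _ a => a) = 0) : ∃ g, IsInverseImage κ f g := by
  classical
  obtain ⟨θ, hθ⟩ := exists_flow_of_sum_eq_zero f hf
  have hs : ∀ b, √(κ b) ≠ 0 := fun b => (Real.sqrt_pos.2 (hκ b)).ne'
  -- Division by `√κ` cancels the weight of the gradient, so `v` pairs with `√κ ∇h` to `∑_b θ_b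
  -- (∇h)_b = (f, h)`.
  let v : lp (fun _ : Edge d => ℝ) 2 := θ.sum fun b a => lp.single 2 b (a / √(κ b))
  have hv : ∀ h : Lattice d →₀ ℝ, inner ℝ v (sqrtGrad κ h) = pair f h := by
    intro h
    rw [← hθ, flowPair]
    simp only [v, Finsupp.sum, sum_inner, lp.inner_single_left, sqrtGrad_apply]
    refine Finset.sum_congr rfl fun b _ => ?_
    simp only [RCLike.inner_apply, conj_trivial]
    field_simp [hs b]
  let W : Submodule ℝ (lp (fun _ : Edge d => ℝ) 2) := (LinearMap.range (sqrtGrad κ)).topologicalClosure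
  have hWc : IsClosed (W : Set (lp (fun _ : Edge d => ℝ) 2)) :=
    Submodule.isClosed_topologicalClosure _
  have : CompleteSpace W := hWc.completeSpace_coe
  let w := W.starProjection v
  have hw : ∀ h : Lattice d →₀ ℝ, inner ℝ w (sqrtGrad κ h) = pair f h := by
    intro h
    have := W.starProjection_inner_eq_zero v (sqrtGrad κ h)
      (Submodule.le_topologicalClosure _ (LinearMap.mem_range_self _ h))
    rw [inner_sub_left, sub_eq_zero] at this
    rw [← hv, this]
  have hwW : w ∈ closure (LinearMap.range (sqrtGrad κ) : Set (lp (fun _ : Edge d => ℝ) 2)) :=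
    W.starProjection_apply_mem v
  obtain ⟨s, hs1, hs2⟩ := mem_closure_iff_seq_limit.1 hwW
  choose h hh using hs1
  have hcoord : ∀ b, Tendsto (fun n => grad (h n) b) atTop (𝓝 (w b / √(κ b))) := by
    intro b
    have h1 : Tendsto (fun n => s n b) atTop (𝓝 (w b)) := by
      rw [tendsto_iff_norm_sub_tendsto_zero] at hs2 ⊢
      refine squeeze_zero (fun _ => norm_nonneg _) (fun n => ?_) hs2
      exact lp.norm_apply_le_norm (by norm_num) (s n - w) b
    refine (h1.div_const √(κ b)).congr fun n => ?_
    rw [← hh, sqrtGrad_apply]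
    field_simp [hs b]
  set η : Edge d → ℝ := fun b => w b / √(κ b) with hη
  have hloop : LoopCondition η := by
    intro x i j
    refine tendsto_nhds_unique (((hcoord _).add (hcoord _)).sub (hcoord _) |>.sub (hcoord _))
      (tendsto_const_nhds.congr fun n => (loopCondition_grad (h n) x i j).symm)
  have hgrad := grad_field hloop
  have hwb : ∀ b, w b = √(κ b) * grad (field η) b := by
    intro b
    rw [hgrad, hη]
    field_simp [hs b]
  refine ⟨field η, fun x => ?_, h, ?_⟩
  · have := hw (Finsupp.single x 1)
    rw [inner_sqrtGrad_single] at this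
    rw [generator_eq_diverg]
    have e : pair f (Finsupp.single x (1 : ℝ)) = f x := by
      simp only [pair, Finsupp.sum, Finsupp.single_apply, mul_ite, mul_one, mul_zero,
        Finset.sum_ite_eq, Finsupp.mem_support_iff]
      split_ifs with h
      · rfl
      · exact (not_not.1 h).symm
    rw [e] at this
    rw [← this]
    congr 2
    ext b
    rw [hwb, ← mul_assoc, Real.mul_self_sqrt (hκ b).le]
  · have h1 : ∀ n, energy κ (fun x => field η x - h n x) = ENNReal.ofReal (‖s n - w‖ ^ 2) := by
      intro n
      rw [norm_sub_rev]
      refine energy_eq_ofReal_norm_sq _ _ fun b => ?_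
      rw [lp.coeFn_sub, Pi.sub_apply, hwb, ← hh, sqrtGrad_apply, ← mul_sub, mul_pow,
        Real.sq_sqrt (hκ b).le, grad_sub]
      rfl
    simp only [h1]
    rw [tendsto_iff_norm_sub_tendsto_zero] at hs2
    have := ENNReal.tendsto_ofReal (hs2.pow 2)
    simpa using this

end GradientGibbs

namespace GradientGibbs
open MeasureTheory ProbabilityTheory Filter Topology
open scoped ENNReal

variable {d : ℕ}

/-! ### Gaussian integrals in a finite set -/

/-- All exponential moments are finite, so the complex moment generating function is entire and is
fixed by its real values; on the imaginary axis it determines the law. Writing the Gaussian as the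
image of the standard one under `√v` includes `v = 0`. -/
theorem map_eq_smul_gaussianReal_of_lintegral_exp {Ω : Type*} [MeasurableSpace Ω] (ν : Measure Ω)
    [IsFiniteMeasure ν] {X : Ω → ℝ} (hX : Measurable X) {v : ℝ} (hv : 0 ≤ v)
    (h : ∀ t : ℝ, ∫⁻ ω, ENNReal.ofReal (Real.exp (t * X ω)) ∂ν =
      ENNReal.ofReal (Real.exp (v * t ^ 2 / 2)) * ν Set.univ) :
    ν.map X = ν Set.univ • (gaussianReal 0 1).map (fun t => √v * t) := by
  have hg : (gaussianReal 0 1).map (fun t => √v * t) = gaussianReal 0 v.toNNReal := by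
    rw [gaussianReal_map_const_mul]
    congr 1
    · simp
    · ext; simp [Real.sq_sqrt hv, hv]
  rw [hg]
  have hfin : IsFiniteMeasure (ν Set.univ • gaussianReal 0 v.toNNReal) :=
    ⟨by simp [measure_lt_top]⟩
  have hm : ∀ t, mgf id (ν.map X) t = Real.exp (v * t ^ 2 / 2) * (ν Set.univ).toReal := by
    intro t
    rw [mgf_id_map hX.aemeasurable, mgf, integral_eq_lintegral_of_nonneg_ae
      (Eventually.of_forall fun _ => (Real.exp_pos _).le) (by fun_prop), h,
      ENNReal.toReal_mul, ENNReal.toReal_ofReal (Real.exp_pos _).le]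
  have hm' : ∀ t, mgf id (ν Set.univ • gaussianReal 0 v.toNNReal) t =
      Real.exp (v * t ^ 2 / 2) * (ν Set.univ).toReal := by
    intro t
    rw [mgf_smul_measure, mgf_id_gaussianReal]
    simp [hv, mul_comm]
  have hset : integrableExpSet id (ν.map X) = Set.univ := by
    ext t
    simp only [integrableExpSet, Set.mem_univ, iff_true, Set.mem_ofPred_eq, id]
    rw [integrable_map_measure (by fun_prop) hX.aemeasurable]
    refine ⟨by fun_prop, ?_⟩
    change HasFiniteIntegral (fun ω => Real.exp (t * X ω)) ν
    rw [hasFiniteIntegral_iff_ofReal (Eventually.of_forall fun _ => (Real.exp_pos _).le), h]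
    exact ENNReal.mul_lt_top ENNReal.ofReal_lt_top (measure_lt_top _ _)
  have heq := eqOn_complexMGF_of_mgf' (X := id) (Y := id) (μ := ν.map X)
    (μ' := ν Set.univ • gaussianReal 0 v.toNNReal) (by ext t; rw [hm, hm']) (by
      rw [Measure.map_eq_zero_iff hX.aemeasurable]
      constructor
      · intro h0; simp [h0]
      · intro h0
        have := congrArg (fun m => m Set.univ) h0
        simpa using this)
  refine Measure.ext_of_complexMGF_id_eq ?_
  ext z
  exact heq (by simp [hset])

/-- The Dirichlet energy `∑ k_b (∇ψ)_b²` of a field in `Λ` with zero boundary values. -/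
noncomputable def dirichletEnergy (Λ : Finset (Lattice d)) (k : Edge d → ℝ) (ψ : Λ → ℝ) : ℝ :=
  ∑ b ∈ touching Λ, k b * grad (glue Λ 0 ψ) b ^ 2

theorem continuous_glue (Λ : Finset (Lattice d)) :
    Continuous fun p : (Lattice d → ℝ) × (Λ → ℝ) => glue Λ p.1 p.2 := by
  refine continuous_pi fun x => ?_
  unfold glue
  split_ifs with h <;> fun_prop

theorem continuous_glue_right (Λ : Finset (Lattice d)) (φ : Lattice d → ℝ) :
    Continuous (glue Λ φ) :=
  (continuous_glue Λ).comp (by fun_prop : Continuous fun ψ : Λ → ℝ => (φ, ψ))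

theorem continuous_grad : Continuous (grad : (Lattice d → ℝ) → Edge d → ℝ) := by
  unfold grad; fun_prop

theorem continuous_dirichletEnergy (Λ : Finset (Lattice d)) (k : Edge d → ℝ) :
    Continuous (dirichletEnergy Λ k) := by
  unfold dirichletEnergy
  have : ∀ b, Continuous fun ψ : Λ → ℝ => grad (glue Λ 0 ψ) b := fun b =>
    (continuous_apply b).comp (continuous_grad.comp (continuous_glue_right Λ 0))
  fun_prop

/-- A Poincaré inequality, obtained by following a ray from each point until it leaves `Λ`; it makes
the Gaussian weight integrable. -/
theorem exists_sum_sq_le_dirichletEnergy (hd : 1 ≤ d) {Λ : Finset (Lattice d)} {k : Edge d → ℝ}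
    (hk : ∀ b ∈ touching Λ, 0 < k b) :
    ∃ c > 0, ∀ ψ : Λ → ℝ, c * ∑ x, ψ x ^ 2 ≤ dirichletEnergy Λ k ψ := by
  choose N hN using fun x => exists_add_smul_notMem Λ x ⟨0, hd⟩
  set C := ∑ b ∈ touching Λ, (k b)⁻¹ with hC
  set D := ∑ x : Λ, (N x : ℝ) with hD
  have hC0 : 0 ≤ C := Finset.sum_nonneg fun b hb => (inv_pos.2 (hk b hb)).le
  have hD0 : 0 ≤ D := Finset.sum_nonneg fun b hb => Nat.cast_nonneg _
  -- `D` counts the steps of the rays and `C` compares the unweighted energy with the weighted one;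
  -- adding `1` keeps the constant positive when `Λ` is empty.
  refine ⟨(D * C + 1)⁻¹, by positivity, fun ψ => ?_⟩
  have hE0 : 0 ≤ dirichletEnergy Λ k ψ :=
    Finset.sum_nonneg fun b hb => mul_nonneg (hk b hb).le (sq_nonneg _)
  have h1 : ∑ b ∈ touching Λ, grad (glue Λ 0 ψ) b ^ 2 ≤ C * dirichletEnergy Λ k ψ := by
    rw [hC, Finset.sum_mul]
    refine Finset.sum_le_sum fun b hb => ?_
    rw [← div_eq_inv_mul, le_div_iff₀ (hk b hb), mul_comm]
    exact Finset.single_le_sum (f := fun b => k b * grad (glue Λ 0 ψ) b ^ 2)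
      (fun b hb => mul_nonneg (hk b hb).le (sq_nonneg _)) hb
  have h2 : ∑ x, ψ x ^ 2 ≤ D * (C * dirichletEnergy Λ k ψ) := by
    rw [hD, Finset.sum_mul]
    refine Finset.sum_le_sum fun x _ => ?_
    have := sq_le_mul_sum_touching (h := glue Λ 0 ψ)
      (fun x hx => by rw [glue_of_notMem _ _ hx]; rfl) x _ _ (hN x)
    rw [glue_coe] at this
    exact this.trans (mul_le_mul_of_nonneg_left h1 (Nat.cast_nonneg _))
  rw [inv_mul_le_iff₀ (by positivity)]
  nlinarith

theorem lintegral_exp_dirichletEnergy_lt_top (hd : 1 ≤ d) {Λ : Finset (Lattice d)}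
    {k : Edge d → ℝ} (hk : ∀ b ∈ touching Λ, 0 < k b) :
    ∫⁻ ψ : Λ → ℝ, ENNReal.ofReal (Real.exp (-(1 / 2) * dirichletEnergy Λ k ψ)) < ∞ := by
  obtain ⟨c, hc, h⟩ := exists_sum_sq_le_dirichletEnergy hd hk
  have hintegrable : Integrable (fun ψ : Λ → ℝ => ∏ x, Real.exp (-(c / 2) * ψ x ^ 2)) :=
    Integrable.fintype_prod (f := fun (_ : Λ) (t : ℝ) => Real.exp (-(c / 2) * t ^ 2))
      fun _ => integrable_exp_neg_mul_sq (by positivity)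
  refine lt_of_le_of_lt (lintegral_mono fun ψ => ENNReal.ofReal_le_ofReal ?_)
    ((hasFiniteIntegral_iff_ofReal (Eventually.of_forall fun ψ =>
      Finset.prod_nonneg fun x _ => (Real.exp_pos _).le)).1 hintegrable.2)
  rw [← Real.exp_sum, ← Finset.mul_sum]
  refine Real.exp_le_exp.2 ?_
  have := h ψ
  linarith

/-- Under the Gaussian weight on `Λ`, a linear functional `(F, ·)` is a centered Gaussian with
variance `(F, G_Λ F)`. -/
theorem lintegral_gaussian_weight (hd : 1 ≤ d) {Λ : Finset (Lattice d)} {k : Edge d → ℝ}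
    (hk : ∀ b ∈ touching Λ, 0 < k b) (F : Lattice d → ℝ) {Ψ : ℝ → ℝ≥0∞} (hΨ : Measurable Ψ) :
    ∫⁻ ψ : Λ → ℝ, Ψ (∑ x : Λ, F x * ψ x) *
        ENNReal.ofReal (Real.exp (-(1 / 2) * dirichletEnergy Λ k ψ)) =
      (∫⁻ t, Ψ (√(greenForm Λ k F) * t) ∂(gaussianReal 0 1)) *
        ∫⁻ ψ : Λ → ℝ, ENNReal.ofReal (Real.exp (-(1 / 2) * dirichletEnergy Λ k ψ)) := by
  set w : (Λ → ℝ) → ℝ≥0∞ := fun ψ =>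
    ENNReal.ofReal (Real.exp (-(1 / 2) * dirichletEnergy Λ k ψ)) with hw
  have hwm : Measurable w := by
    have := (continuous_dirichletEnergy Λ k).measurable
    fun_prop
  set ν : Measure (Λ → ℝ) := volume.withDensity w with hν
  have hνu : ν Set.univ = ∫⁻ ψ, w ψ := by rw [hν, withDensity_apply _ .univ, setLIntegral_univ]
  have : IsFiniteMeasure ν := ⟨by rw [hνu]; exact lintegral_exp_dirichletEnergy_lt_top hd hk⟩
  have hX : Measurable fun ψ : Λ → ℝ => ∑ x : Λ, F x * ψ x := by fun_prop
  have key : ν.map (fun ψ : Λ → ℝ => ∑ x : Λ, F x * ψ x) =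
      ν Set.univ • (gaussianReal 0 1).map (fun t => √(greenForm Λ k F) * t) := by
    refine map_eq_smul_gaussianReal_of_lintegral_exp ν hX (greenForm_nonneg hd hk F) fun t => ?_
    rw [hν, lintegral_withDensity_eq_lintegral_mul _ hwm (by fun_prop), ← hν, hνu]
    set s : Λ → ℝ := fun x => dirichletSolve Λ k F x with hs
    have hglue : glue Λ 0 s = dirichletSolve Λ k F := by
      ext x
      by_cases hx : x ∈ Λ
      · simp [glue, hx, hs]
      · rw [glue_of_notMem _ _ hx, dirichletSolve_of_notMem _ _ x hx]; rfl
    -- Completing the square: shifting by `t` times the Dirichlet solution of `F` cancels the linear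
    -- term in the exponent and leaves `t² (F, G_Λ F) / 2`.
    rw [← lintegral_add_right_eq_self _ (t • s), ← lintegral_const_mul _ hwm]
    refine lintegral_congr fun ψ => ?_
    simp only [Pi.mul_apply, hw]
    rw [← ENNReal.ofReal_mul (Real.exp_pos _).le, ← ENNReal.ofReal_mul (Real.exp_pos _).le,
      ← Real.exp_add, ← Real.exp_add]
    congr 2
    have hgrad : ∀ b, grad (glue Λ 0 (ψ + t • s)) b =
        grad (glue Λ 0 ψ) b + t * grad (dirichletSolve Λ k F) b := by
      intro b
      rw [← hglue]
      have : ∀ z, glue Λ 0 (ψ + t • s) z = glue Λ 0 ψ z + t * glue Λ 0 s z := by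
        intro z
        by_cases hz : z ∈ Λ <;> simp [glue, hz]
      simp only [grad, this]; ring
    have hcross := sum_touching_dirichletSolve hd hk F (h := glue Λ 0 ψ)
      (fun x hx => by rw [glue_of_notMem _ _ hx]; rfl)
    rw [← Finset.sum_coe_sort Λ] at hcross
    simp only [glue_coe] at hcross
    have hself := greenForm_eq hd hk F
    have hE : dirichletEnergy Λ k (ψ + t • s) = dirichletEnergy Λ k ψ +
        2 * t * ∑ x : Λ, F x * ψ x + t ^ 2 * greenForm Λ k F := by
      rw [← hcross, hself]
      simp only [dirichletEnergy, hgrad, Finset.mul_sum, ← Finset.sum_add_distrib]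
      exact Finset.sum_congr rfl fun b _ => by ring
    have hL : ∑ x : Λ, F x * (ψ + t • s) x = ∑ x : Λ, F x * ψ x + t * greenForm Λ k F := by
      simp only [greenForm, ← Finset.sum_coe_sort Λ, Finset.mul_sum, ← Finset.sum_add_distrib,
        Pi.add_apply, Pi.smul_apply, smul_eq_mul, hs]
      exact Finset.sum_congr rfl fun b _ => by ring
    rw [hE, hL]
    ring
  calc ∫⁻ ψ : Λ → ℝ, Ψ (∑ x : Λ, F x * ψ x) * w ψ
      = ∫⁻ ψ, Ψ (∑ x : Λ, F x * ψ x) ∂ν := by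
        rw [hν, lintegral_withDensity_eq_lintegral_mul _ hwm (by fun_prop)]
        exact lintegral_congr fun ψ => mul_comm _ _
    _ = ∫⁻ y, Ψ y ∂(ν.map fun ψ : Λ → ℝ => ∑ x : Λ, F x * ψ x) := (lintegral_map hΨ hX).symm
    _ = _ := by
        rw [key, lintegral_smul_measure, lintegral_map hΨ (by fun_prop), hνu, smul_eq_mul, mul_comm]

end GradientGibbs

namespace GradientGibbs
open MeasureTheory ProbabilityTheory Filter Topology
open scoped ENNReal

variable {d : ℕ}

/-! ### The specification and the extension as integral identities -/

theorem measurable_potential (ϱ : Measure ℝ) [IsFiniteMeasure ϱ] : Measurable (potential ϱ) := by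
  have h : StronglyMeasurable fun s : ℝ => ∫ k, Real.exp (-(1 / 2 * k * s ^ 2)) ∂ϱ :=
    StronglyMeasurable.integral_prod_right
      (f := fun s k : ℝ => Real.exp (-(1 / 2 * k * s ^ 2)))
      (by apply Continuous.stronglyMeasurable; fun_prop)
  exact (Real.measurable_log.comp h.measurable).neg

theorem measurable_weight (ϱ : Measure ℝ) [IsFiniteMeasure ϱ] (Λ : Finset (Lattice d)) :
    Measurable (weight ϱ Λ : (Edge d → ℝ) → ℝ≥0∞) := by
  have := measurable_potential ϱ
  unfold weight
  fun_prop

theorem measurable_grad_glue (Λ : Finset (Lattice d)) :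
    Measurable fun p : (Edge d → ℝ) × (Λ → ℝ) => grad (glue Λ (field p.1) p.2) :=
  (continuous_grad.comp (continuous_glue Λ)).measurable.comp
    ((measurable_field.comp measurable_fst).prodMk measurable_snd)

theorem lintegral_specification_eq (ϱ : Measure ℝ) [IsFiniteMeasure ϱ] (Λ : Finset (Lattice d))
    (η : Edge d → ℝ) {Φ : (Edge d → ℝ) → ℝ≥0∞} (hΦ : Measurable Φ) :
    ∫⁻ ξ, Φ ξ ∂(specification ϱ Λ η) =
      (∫⁻ ψ : Λ → ℝ, weight ϱ Λ (grad (glue Λ (field η) ψ)))⁻¹ *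
        ∫⁻ ψ : Λ → ℝ, weight ϱ Λ (grad (glue Λ (field η) ψ)) *
          Φ (grad (glue Λ (field η) ψ)) := by
  have hg : Measurable fun ψ : Λ → ℝ => grad (glue Λ (field η) ψ) :=
    (continuous_grad.comp (continuous_glue_right Λ _)).measurable
  have hw : Measurable fun ψ : Λ → ℝ => weight ϱ Λ (grad (glue Λ (field η) ψ)) :=
    (measurable_weight ϱ Λ).comp hg
  rw [specification, lintegral_smul_measure, lintegral_map hΦ hg,
    lintegral_withDensity_eq_lintegral_mul _ hw (by exact hΦ.comp hg)]
  rfl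

theorem measurable_lintegral_specification (ϱ : Measure ℝ) [IsFiniteMeasure ϱ]
    (Λ : Finset (Lattice d)) {Φ : (Edge d → ℝ) → ℝ≥0∞} (hΦ : Measurable Φ) :
    Measurable fun η => ∫⁻ ξ, Φ ξ ∂(specification ϱ Λ η) := by
  simp only [lintegral_specification_eq ϱ Λ _ hΦ]
  have hw := (measurable_weight ϱ Λ).comp (measurable_grad_glue Λ)
  have h1 := hw.lintegral_prod_right' (ν := (volume : Measure (Λ → ℝ)))
  have h2 := (hw.mul (hΦ.comp (measurable_grad_glue Λ))).lintegral_prod_right'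
    (ν := (volume : Measure (Λ → ℝ)))
  exact h1.inv.mul h2

theorem measurable_specification (ϱ : Measure ℝ) [IsFiniteMeasure ϱ] (Λ : Finset (Lattice d)) :
    Measurable (specification ϱ Λ : (Edge d → ℝ) → Measure (Edge d → ℝ)) := by
  refine Measure.measurable_of_measurable_coe _ fun A hA => ?_
  have := measurable_lintegral_specification ϱ Λ (measurable_one.indicator hA)
  simpa [lintegral_indicator_one hA] using this

theorem specification_apply_le_one (ϱ : Measure ℝ) [IsFiniteMeasure ϱ] (Λ : Finset (Lattice d))
    (η : Edge d → ℝ) (A : Set (Edge d → ℝ)) : specification ϱ Λ η A ≤ 1 := by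
  refine (measure_mono (Set.subset_univ A)).trans ?_
  have := lintegral_specification_eq ϱ Λ η (measurable_const (a := 1))
  simp only [lintegral_one, mul_one] at this
  rw [this]
  exact ENNReal.inv_mul_le_one _

/-- The unconditional DLR equation, from taking expectations of the conditional one. It suffices
here, since test functions may themselves depend on the field outside `Λ`. -/
theorem bind_specification {ϱ : Measure ℝ} [IsFiniteMeasure ϱ] {μ : Measure (Edge d → ℝ)}
    [IsProbabilityMeasure μ] (hG : IsGradientGibbs ϱ μ) (Λ : Finset (Lattice d)) :
    μ.bind (specification ϱ Λ) = μ := by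
  ext A hA
  have hm := measurable_specification ϱ Λ
  rw [Measure.bind_apply hA hm.aemeasurable]
  have h1 := integral_condExp (μ := μ) (f := A.indicator fun _ => (1 : ℝ)) (outside_le Λ)
  rw [integral_congr_ae (hG.2 Λ A hA), integral_toReal (f := fun η => specification ϱ Λ η A)
    ((Measure.measurable_coe hA).comp hm).aemeasurable (Eventually.of_forall fun η =>
      (specification_apply_le_one ϱ Λ η A).trans_lt ENNReal.one_lt_top),
    integral_indicator_const _ hA, smul_eq_mul, mul_one, Measure.real] at h1
  have hlt : ∫⁻ η, specification ϱ Λ η A ∂μ ≠ ∞ := by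
    refine ne_top_of_le_ne_top ENNReal.one_ne_top
      ((lintegral_mono fun η => specification_apply_le_one ϱ Λ η A).trans ?_)
    simp
  exact (ENNReal.toReal_eq_toReal_iff' hlt (measure_ne_top _ _)).1 h1

/-- The DLR equation. -/
theorem lintegral_eq_lintegral_glue {ϱ : Measure ℝ} [IsFiniteMeasure ϱ] {μ : Measure (Edge d → ℝ)}
    [IsProbabilityMeasure μ] (hG : IsGradientGibbs ϱ μ) (Λ : Finset (Lattice d))
    {Φ : (Edge d → ℝ) → ℝ≥0∞} (hΦ : Measurable Φ) :
    ∫⁻ η, Φ η ∂μ = ∫⁻ η, ((∫⁻ ψ : Λ → ℝ, weight ϱ Λ (grad (glue Λ (field η) ψ)))⁻¹ *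
        ∫⁻ ψ : Λ → ℝ, weight ϱ Λ (grad (glue Λ (field η) ψ)) *
          Φ (grad (glue Λ (field η) ψ))) ∂μ := by
  conv_lhs => rw [← bind_specification hG Λ]
  rw [Measure.lintegral_bind (measurable_specification ϱ Λ).aemeasurable hΦ.aemeasurable]
  simp only [lintegral_specification_eq ϱ Λ _ hΦ]

/-- The density `∏_b exp(V(η_b) - k_b η_b² / 2)` of the conductances on a finite set of edges. -/
noncomputable def extDensity (ϱ : Measure ℝ) (S : Finset (Edge d)) (η : Edge d → ℝ) (k : S → ℝ) :
    ℝ≥0∞ :=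
  ∏ b : S, ENNReal.ofReal (Real.exp (potential ϱ (η b) - 1 / 2 * k b * η b ^ 2))

theorem measurable_extDensity (ϱ : Measure ℝ) [IsFiniteMeasure ϱ] (S : Finset (Edge d))
    {α : Type*} [MeasurableSpace α] {η : α → Edge d → ℝ} {k : α → S → ℝ} (hη : Measurable η)
    (hk : Measurable k) : Measurable fun p => extDensity ϱ S (η p) (k p) := by
  have := measurable_potential ϱ
  unfold extDensity
  fun_prop

theorem map_restrict_extension {ϱ : Measure ℝ} [IsFiniteMeasure ϱ] {μ : Measure (Edge d → ℝ)}
    [IsProbabilityMeasure μ] {μt : Measure ((Edge d → ℝ) × (Edge d → ℝ))} [IsFiniteMeasure μt]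
    (hext : IsExtension ϱ μ μt) (S : Finset (Edge d)) :
    μt.map (fun ω => (ω.1, fun b : S => ω.2 b)) =
      (μ.prod (Measure.pi fun _ : S => ϱ)).withDensity fun p => extDensity ϱ S p.1 p.2 := by
  refine Measure.ext_prod fun {A B} hA hB => ?_
  have hm := measurable_extDensity ϱ S measurable_fst (measurable_snd (α := Edge d → ℝ))
  rw [Measure.map_apply (by fun_prop) (hA.prod hB), withDensity_apply _ (hA.prod hB),
    setLIntegral_prod_symm _ hm.aemeasurable]
  exact hext S A B hA hB

theorem lintegral_extension {ϱ : Measure ℝ} [IsFiniteMeasure ϱ] {μ : Measure (Edge d → ℝ)}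
    [IsProbabilityMeasure μ] {μt : Measure ((Edge d → ℝ) × (Edge d → ℝ))} [IsFiniteMeasure μt]
    (hext : IsExtension ϱ μ μt) (S : Finset (Edge d)) {Φ : (Edge d → ℝ) × (S → ℝ) → ℝ≥0∞}
    (hΦ : Measurable Φ) :
    ∫⁻ ω, Φ (ω.1, fun b : S => ω.2 b) ∂μt =
      ∫⁻ k, ∫⁻ η, extDensity ϱ S η k * Φ (η, k) ∂μ ∂(Measure.pi fun _ : S => ϱ) := by
  have hm := measurable_extDensity ϱ S measurable_fst (measurable_snd (α := Edge d → ℝ))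
  rw [← lintegral_map (f := Φ) hΦ (g := fun ω : (Edge d → ℝ) × (Edge d → ℝ) =>
    (ω.1, fun b : S => ω.2 b)) (by fun_prop), map_restrict_extension hext S,
    lintegral_withDensity_eq_lintegral_mul _ hm hΦ, lintegral_prod_symm _ (hm.mul hΦ).aemeasurable]
  rfl

/-- Use the one-edge marginals, which are absolutely continuous with respect to `ϱ`, and the
countability of the edges. -/
theorem ae_mem_of_extension {ϱ : Measure ℝ} [IsFiniteMeasure ϱ] {μ : Measure (Edge d → ℝ)}
    [IsProbabilityMeasure μ] {μt : Measure ((Edge d → ℝ) × (Edge d → ℝ))} [IsFiniteMeasure μt]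
    (hext : IsExtension ϱ μ μt) {I : Set ℝ} (hI : MeasurableSet I) (h : ϱ Iᶜ = 0) :
    ∀ᵐ ω ∂μt, ∀ b, ω.2 b ∈ I := by
  rw [ae_all_iff]
  intro b
  have h1 := hext {b} Set.univ {k | k ⟨b, by simp⟩ ∈ Iᶜ} .univ
    (by exact (measurable_pi_apply (⟨b, by simp⟩ : ({b} : Finset (Edge d)))) hI.compl)
  rw [ae_iff]
  have h2 : (Measure.pi fun _ : ({b} : Finset (Edge d)) => ϱ) {k | k ⟨b, by simp⟩ ∈ Iᶜ} = 0 := by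
    have : ∀ᵐ k ∂(Measure.pi fun _ : ({b} : Finset (Edge d)) => ϱ), k ⟨b, by simp⟩ ∈ I :=
      Measure.tendsto_eval_ae_ae (i := (⟨b, by simp⟩ : ({b} : Finset (Edge d))))
        (by rwa [mem_ae_iff] : I ∈ ae ϱ)
    rwa [ae_iff] at this
  rw [setLIntegral_measure_zero _ _ h2] at h1
  rw [← h1]
  congr 1
  ext ω
  simp

theorem map_fst_extension {ϱ : Measure ℝ} {μ : Measure (Edge d → ℝ)}
    {μt : Measure ((Edge d → ℝ) × (Edge d → ℝ))} (hext : IsExtension ϱ μ μt) :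
    μt.map Prod.fst = μ := by
  ext A hA
  have := hext ∅ A Set.univ hA .univ
  rw [Measure.map_apply measurable_fst hA]
  simp only [Set.mem_univ, Set.ofPred_true, Set.prod_univ, Finset.univ_eq_empty,
    Finset.prod_empty, lintegral_one, Measure.restrict_apply_univ, lintegral_const] at this
  rw [this]
  simp

/-- For fixed `A`, the measure `B ↦ μt (A × B)` is determined by its finite-dimensional projections;
rectangles then determine `μt`. -/
theorem IsExtension.unique {ϱ : Measure ℝ} {μ : Measure (Edge d → ℝ)}
    {μt μt' : Measure ((Edge d → ℝ) × (Edge d → ℝ))} [IsFiniteMeasure μt] [IsFiniteMeasure μt']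
    (h : IsExtension ϱ μ μt) (h' : IsExtension ϱ μ μt') : μt = μt' := by
  refine Measure.ext_prod fun {A B} hA hB => ?_
  have key : (μt.restrict (A ×ˢ Set.univ)).map Prod.snd =
      (μt'.restrict (A ×ˢ Set.univ)).map Prod.snd := by
    refine IsProjectiveLimit.unique
      (P := fun S => ((μt'.restrict (A ×ˢ Set.univ)).map Prod.snd).map S.restrict)
      (fun S => ?_) (fun S => rfl)
    ext C hC
    have hC' : MeasurableSet (S.restrict (π := fun _ : Edge d => ℝ) ⁻¹' C) :=
      Finset.measurable_restrict S hC
    have e : ∀ m : Measure ((Edge d → ℝ) × (Edge d → ℝ)),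
        ((m.restrict (A ×ˢ Set.univ)).map Prod.snd).map S.restrict C =
          m (A ×ˢ {κ | (fun b : S => κ b) ∈ C}) := by
      intro m
      rw [Measure.map_apply (Finset.measurable_restrict S) hC, Measure.map_apply measurable_snd hC',
        Measure.restrict_apply (measurable_snd hC')]
      congr 1
      ext ω
      simp only [Set.mem_inter_iff, Set.mem_preimage, Set.mem_prod, Set.mem_univ, and_true,
        Set.mem_ofPred_eq]
      exact and_comm
    rw [e, e, h S A C hA hC, h' S A C hA hC]
  have e : ∀ m : Measure ((Edge d → ℝ) × (Edge d → ℝ)),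
      (m.restrict (A ×ˢ Set.univ)).map Prod.snd B = m (A ×ˢ B) := by
    intro m
    rw [Measure.map_apply measurable_snd hB, Measure.restrict_apply (measurable_snd hB)]
    congr 1
    ext ω
    simp [and_comm]
  rw [← e, ← e, key]

/-! ### Translation invariance of the extension -/

theorem measurable_translate (x : Lattice d) : Measurable (translate x : (Edge d → ℝ) → _) := by
  unfold translate; fun_prop

theorem setLIntegral_extDensity_translate (ϱ : Measure ℝ) [IsFiniteMeasure ϱ]
    {μ : Measure (Edge d → ℝ)} (hinv : IsTranslationInvariant μ) (x : Lattice d)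
    {S S' : Finset (Edge d)} (e : S ≃ S') (he : ∀ b : S, (e b : Edge d) = (b.1.1 + x, b.1.2))
    {A : Set (Edge d → ℝ)} (hA : MeasurableSet A) {k : S → ℝ} {k' : S' → ℝ}
    (hk : ∀ b, k' (e b) = k b) :
    ∫⁻ η in translate x ⁻¹' A, extDensity ϱ S' η k' ∂μ = ∫⁻ η in A, extDensity ϱ S η k ∂μ := by
  have hmk : Measurable fun η : Edge d → ℝ => extDensity ϱ S η k :=
    measurable_extDensity ϱ S measurable_id measurable_const
  have hA' : ∫⁻ η in A, extDensity ϱ S η k ∂μ =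
      ∫⁻ η in translate x ⁻¹' A, extDensity ϱ S (translate x η) k ∂μ := by
    rw [← setLIntegral_map hA hmk (measurable_translate x), hinv x]
  rw [hA']
  refine lintegral_congr fun η => ?_
  simp only [extDensity]
  rw [← e.prod_comp]
  refine Finset.prod_congr rfl fun b _ => ?_
  rw [hk, he]
  rfl

/-- The translated measure is again an extension of `μ`, because the density is a product over edges
with the same single-edge factor; uniqueness concludes. -/
theorem map_translate_extension {ϱ : Measure ℝ} [IsFiniteMeasure ϱ] {μ : Measure (Edge d → ℝ)}
    [IsProbabilityMeasure μ] (hinv : IsTranslationInvariant μ)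
    {μt : Measure ((Edge d → ℝ) × (Edge d → ℝ))} [IsFiniteMeasure μt]
    (hext : IsExtension ϱ μ μt) (x : Lattice d) :
    μt.map (Prod.map (translate x) (translate x)) = μt := by
  have hτ := measurable_translate (d := d) x
  refine IsExtension.unique ?_ hext
  intro S A B hA hB
  set s : Edge d ≃ Edge d := (Equiv.addRight x).prodCongr (Equiv.refl (Fin d)) with hs
  set S' := S.map s.toEmbedding with hS'
  obtain ⟨e, he⟩ : ∃ e : S ≃ S', ∀ b : S, ((e b : S') : Edge d) = (b.1.1 + x, b.1.2) :=
    ⟨s.subtypeEquiv fun b => by simp [hS'], fun b => rfl⟩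
  have hcm : Measurable fun k : S' → ℝ => fun b : S => k (e b) := by fun_prop
  have h1 := hext S' (translate x ⁻¹' A) ((fun k : S' → ℝ => fun b : S => k (e b)) ⁻¹' B)
    (hτ hA) (hcm hB)
  have hcyl : MeasurableSet {κ : Edge d → ℝ | (fun b : S => κ b) ∈ B} :=
    (by fun_prop : Measurable fun κ : Edge d → ℝ => fun b : S => κ b) hB
  rw [Measure.map_apply (hτ.prodMap hτ) (hA.prod hcyl)]
  have hpre : Prod.map (translate x) (translate x) ⁻¹' A ×ˢ {κ : Edge d → ℝ | (fun b : S => κ b) ∈ B} =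
      (translate x ⁻¹' A) ×ˢ {κ | (fun b : S' => κ b) ∈
        ((fun k : S' → ℝ => fun b : S => k (e b)) ⁻¹' B)} := by
    ext ω
    simp only [Set.mem_preimage, Set.mem_prod, Set.mem_ofPred_eq, he]
    rfl
  rw [hpre, h1]
  have hpi := measurePreserving_piCongrLeft (α := fun _ : S' => ℝ) (fun _ : S' => ϱ) e
  have hm := measurable_extDensity ϱ S measurable_fst (measurable_snd (α := Edge d → ℝ))
  have hm' := measurable_extDensity ϱ S' measurable_fst (measurable_snd (α := Edge d → ℝ))
  have hcongr : ∀ k : S → ℝ, ∀ b : S, MeasurableEquiv.piCongrLeft (fun _ : S' => ℝ) e k (e b) = k b :=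
    fun k b => Equiv.piCongrLeft_apply_apply (P := fun _ : S' => ℝ) (e := e) k b
  change ∫⁻ k in _, (∫⁻ η in _, extDensity ϱ S' η k ∂μ) ∂_ =
    ∫⁻ k in B, (∫⁻ η in A, extDensity ϱ S η k ∂μ) ∂_
  rw [← hpi.setLIntegral_comp_preimage (hcm hB) (by
    exact Measurable.lintegral_prod_left' (μ := μ.restrict (translate x ⁻¹' A)) hm')]
  have hset : MeasurableEquiv.piCongrLeft (fun _ : S' => ℝ) e ⁻¹'
      ((fun k : S' → ℝ => fun b : S => k (e b)) ⁻¹' B) = B := by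
    ext k
    simp only [Set.mem_preimage, hcongr]
  rw [hset]
  refine lintegral_congr fun k => ?_
  exact setLIntegral_extDensity_translate ϱ hinv x e he hA (hcongr k)

end GradientGibbs

namespace GradientGibbs
open MeasureTheory ProbabilityTheory Filter Topology
open scoped ENNReal

variable {d : ℕ}

/-! ### Resampling the field in a finite set given the conductances -/

/-- Locality in the conductances: everything solved in `Λ` depends on `κ` only through the edges
touching `Λ`. This lets the finite-dimensional formula for the extension be applied. -/
theorem dirichletMatrix_congr {Λ : Finset (Lattice d)} {k k' : Edge d → ℝ}
    (h : ∀ b ∈ touching Λ, k b = k' b) : dirichletMatrix Λ k = dirichletMatrix Λ k' := by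
  ext x y
  simp only [dirichletMatrix, Matrix.of_apply]
  rw [diverg_congr (fun b hb => by rw [h b hb]) x.2]

theorem dirichletSolve_congr {Λ : Finset (Lattice d)} {k k' : Edge d → ℝ}
    (h : ∀ b ∈ touching Λ, k b = k' b) {F F' : Lattice d → ℝ} (hF : ∀ x ∈ Λ, F x = F' x) :
    dirichletSolve Λ k F = dirichletSolve Λ k' F' := by
  unfold dirichletSolve
  rw [dirichletMatrix_congr h]
  congr 2
  ext x
  exact hF x x.2

theorem dirichletPart_congr {Λ : Finset (Lattice d)} {k k' : Edge d → ℝ}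
    (h : ∀ b ∈ touching Λ, k b = k' b) (η : Edge d → ℝ) :
    dirichletPart Λ k η = dirichletPart Λ k' η :=
  dirichletSolve_congr h fun x hx => by rw [diverg_congr (fun b hb => by rw [h b hb]) hx]

theorem harmonicPart_congr {Λ : Finset (Lattice d)} {k k' : Edge d → ℝ}
    (h : ∀ b ∈ touching Λ, k b = k' b) (η : Edge d → ℝ) :
    harmonicPart Λ k η = harmonicPart Λ k' η := by
  rw [harmonicPart, harmonicPart, dirichletPart_congr h]

theorem greenForm_congr {Λ : Finset (Lattice d)} {k k' : Edge d → ℝ}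
    (h : ∀ b ∈ touching Λ, k b = k' b) (F : Lattice d → ℝ) :
    greenForm Λ k F = greenForm Λ k' F := by
  rw [greenForm, greenForm, dirichletSolve_congr h fun _ _ => rfl]

section Measurability

variable {α : Type*} [MeasurableSpace α]

/-- By Cramer's rule the entries of the inverse are polynomials divided by the determinant, with the
value zero for singular matrices, so measurability holds for all `k`. -/
theorem measurable_dirichletMatrix_inv_apply (Λ : Finset (Lattice d)) (x y : Λ) :
    Measurable fun k : Edge d → ℝ => (dirichletMatrix Λ k)⁻¹ x y := by
  classical
  have hA : Continuous fun k : Edge d → ℝ => dirichletMatrix Λ k := by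
    refine continuous_matrix fun x y => ?_
    simp only [dirichletMatrix, Matrix.of_apply, diverg]
    fun_prop
  simp only [Matrix.inv_def, Matrix.smul_apply, Ring.inverse_eq_inv', smul_eq_mul]
  exact (hA.matrix_det.measurable.inv).mul (hA.matrix_adjugate.matrix_elem x y).measurable

theorem measurable_dirichletSolve (Λ : Finset (Lattice d)) {k : α → Edge d → ℝ}
    {F : α → Lattice d → ℝ} (hk : Measurable k) (hF : Measurable F) (x : Lattice d) :
    Measurable fun a => dirichletSolve Λ (k a) (F a) x := by
  unfold dirichletSolve glue
  by_cases hx : x ∈ Λ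
  · simp only [hx, dif_pos, Matrix.mulVec, dotProduct]
    refine Finset.measurable_sum _ fun y _ => Measurable.mul ?_ ?_
    · exact (measurable_dirichletMatrix_inv_apply Λ _ _).comp hk
    · exact (measurable_pi_apply _).comp hF
  · simp only [hx, dif_neg, not_false_eq_true]
    exact measurable_const

theorem measurable_dirichletPart (Λ : Finset (Lattice d)) {k η : α → Edge d → ℝ}
    (hk : Measurable k) (hη : Measurable η) (x : Lattice d) :
    Measurable fun a => dirichletPart Λ (k a) (η a) x := by
  refine measurable_dirichletSolve Λ hk (measurable_pi_lambda _ fun x => ?_) x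
  unfold diverg
  fun_prop

theorem measurable_harmonicPart (Λ : Finset (Lattice d)) {k η : α → Edge d → ℝ}
    (hk : Measurable k) (hη : Measurable η) (b : Edge d) :
    Measurable fun a => harmonicPart Λ (k a) (η a) b := by
  have := measurable_dirichletPart Λ hk hη
  unfold harmonicPart grad
  simp only [Pi.sub_apply]
  fun_prop

theorem measurable_greenForm (Λ : Finset (Lattice d)) (F : Lattice d → ℝ) {k : α → Edge d → ℝ}
    (hk : Measurable k) : Measurable fun a => greenForm Λ (k a) F := by
  have := measurable_dirichletSolve Λ hk (measurable_const (a := F))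
  unfold greenForm
  fun_prop

end Measurability

/-- For fixed conductances `k`, the weight of the extension on the fields in `Λ` is, up to a factor
that does not depend on the field in `Λ`, the Gaussian weight of the Dirichlet part. -/
theorem weight_mul_extDensity (hd : 1 ≤ d) (ϱ : Measure ℝ) {Λ : Finset (Lattice d)}
    {T : Finset (Edge d)} (hT : touching Λ ⊆ T) {κ : Edge d → ℝ}
    (hκ : ∀ b ∈ touching Λ, 0 < κ b) (φ : Lattice d → ℝ) :
    ∃ C : ℝ≥0∞, ∀ ψ : Λ → ℝ, weight ϱ Λ (grad (glue Λ φ ψ)) *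
      extDensity ϱ T (grad (glue Λ φ ψ)) (fun b => κ b) =
        C * ENNReal.ofReal (Real.exp (-(1 / 2) * dirichletEnergy Λ κ
          (ψ + fun x : Λ => dirichletPart Λ κ (grad (glue Λ φ 0)) x))) := by
  classical
  set g := grad (glue Λ φ 0) with hg
  -- The constant collects the energy of the harmonic part in `Λ` and the density on edges of `T`
  -- off `touching Λ`; neither changes when the field is changed in `Λ`.
  refine ⟨ENNReal.ofReal (Real.exp (-(1 / 2) * ∑ b ∈ touching Λ, κ b * harmonicPart Λ κ g b ^ 2)) *
    ∏ b ∈ T \ touching Λ, ENNReal.ofReal (Real.exp (potential ϱ (g b) - 1 / 2 * κ b * g b ^ 2)),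
    fun ψ => ?_⟩
  set gψ := grad (glue Λ φ ψ) with hgψ
  have hout : ∀ b ∉ touching Λ, gψ b = g b := by
    intro b hb
    rw [mem_touching, not_or] at hb
    simp [hgψ, hg, grad, glue_of_notMem _ _ hb.1, glue_of_notMem _ _ hb.2]
  have hprod : extDensity ϱ T gψ (fun b => κ b) =
      (∏ b ∈ T \ touching Λ, ENNReal.ofReal (Real.exp (potential ϱ (g b) - 1 / 2 * κ b * g b ^ 2))) *
      ENNReal.ofReal (Real.exp (∑ b ∈ touching Λ,
        (potential ϱ (gψ b) - 1 / 2 * κ b * gψ b ^ 2))) := by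
    rw [extDensity, Finset.prod_coe_sort T
      (fun b => ENNReal.ofReal (Real.exp (potential ϱ (gψ b) - 1 / 2 * κ b * gψ b ^ 2))),
      ← Finset.prod_sdiff hT, Real.exp_sum,
      ENNReal.ofReal_prod_of_nonneg fun b _ => (Real.exp_pos _).le]
    congr 1
    refine Finset.prod_congr rfl fun b hb => ?_
    rw [hout b (Finset.mem_sdiff.1 hb).2]
  have hE : ∑ b ∈ touching Λ, κ b * gψ b ^ 2 = ∑ b ∈ touching Λ, κ b * harmonicPart Λ κ g b ^ 2 +
      dirichletEnergy Λ κ (ψ + fun x : Λ => dirichletPart Λ κ g x) := by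
    rw [sum_touching_pythagoras hd hκ, harmonicPart_glue hd hκ, dirichletEnergy]
    congr 1
    refine Finset.sum_congr rfl fun b _ => ?_
    congr 2
    rw [dirichletPart_glue hd hκ]
    congr 1
    ext x
    by_cases hx : x ∈ Λ
    · simp [glue, hx, hg]
    · rw [glue_of_notMem _ _ hx, glue_of_notMem _ _ hx, dirichletPart,
        dirichletSolve_of_notMem _ _ x hx]
      simp
  -- The sums of `V` over `touching Λ` cancel here, leaving a pure quadratic exponent.
  rw [hprod, weight, mul_left_comm, ← ENNReal.ofReal_mul (Real.exp_pos _).le, ← Real.exp_add,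
    mul_right_comm, ← ENNReal.ofReal_mul (Real.exp_pos _).le, ← Real.exp_add, ← mul_add, ← hE,
    Finset.sum_sub_distrib, mul_comm]
  congr 3
  rw [Finset.mul_sum, neg_add_eq_sub, sub_sub_cancel_left, ← Finset.sum_neg_distrib]
  exact Finset.sum_congr rfl fun b _ => by ring

/-- Given the conductances and the field outside `Λ`, a linear functional of the Dirichlet part is
a centered Gaussian whose variance is given by the Green function in `Λ`. -/
theorem lintegral_resample (hd : 1 ≤ d) {ϱ : Measure ℝ} [IsFiniteMeasure ϱ]
    (hϱ : ϱ (Set.Ioi 0)ᶜ = 0) {μ : Measure (Edge d → ℝ)} [IsProbabilityMeasure μ]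
    (hG : IsGradientGibbs ϱ μ) {μt : Measure ((Edge d → ℝ) × (Edge d → ℝ))} [IsFiniteMeasure μt]
    (hext : IsExtension ϱ μ μt) (Λ : Finset (Lattice d)) (T : Finset (Edge d))
    (hT : touching Λ ⊆ T) (F : Lattice d → ℝ)
    {Φ : ((Edge d → ℝ) × (Edge d → ℝ)) × ℝ → ℝ≥0∞} (hΦ : Measurable Φ)
    (hκ : ∀ η κ κ' s, (∀ b ∈ T, κ b = κ' b) → Φ ((η, κ), s) = Φ ((η, κ'), s))
    (hη : ∀ φ ψ κ s, (∀ b ∈ touching Λ, 0 < κ b) →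
      Φ ((grad (glue Λ φ ψ), κ), s) = Φ ((grad (glue Λ φ 0), κ), s)) :
    ∫⁻ ω, Φ (ω, ∑ x : Λ, F x * dirichletPart Λ ω.2 ω.1 x) ∂μt =
      ∫⁻ ω, ∫⁻ t, Φ (ω, √(greenForm Λ ω.2 F) * t) ∂(gaussianReal 0 1) ∂μt := by
  classical
  -- Extension by zero of conductances given on `T`. By `hκ` and locality, both integrands may be
  -- evaluated at it, so they become functions of `η` and finitely many conductances.
  let E : (T → ℝ) → Edge d → ℝ := fun k b => if h : b ∈ T then k ⟨b, h⟩ else 0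
  have hE : ∀ (κ : Edge d → ℝ), ∀ b ∈ T, κ b = E (fun b : T => κ b) b := by
    intro κ b hb; simp [E, hb]
  have hEm : Measurable E := by
    refine measurable_pi_lambda _ fun b => ?_
    by_cases hb : b ∈ T <;> simp only [E, hb, dif_pos, dif_neg, not_false_eq_true] <;> fun_prop
  have hE2 : Measurable fun p : (Edge d → ℝ) × (T → ℝ) => E p.2 := hEm.comp measurable_snd
  have hS : Measurable fun p : (Edge d → ℝ) × (T → ℝ) =>
      ∑ x : Λ, F x * dirichletPart Λ (E p.2) p.1 x := by
    have := measurable_dirichletPart Λ hE2 measurable_fst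
    fun_prop
  have hm1 : Measurable fun p : (Edge d → ℝ) × (T → ℝ) =>
      Φ ((p.1, E p.2), ∑ x : Λ, F x * dirichletPart Λ (E p.2) p.1 x) :=
    hΦ.comp ((measurable_fst.prodMk hE2).prodMk hS)
  have hV : Measurable fun p : (Edge d → ℝ) × (T → ℝ) => √(greenForm Λ (E p.2) F) :=
    (measurable_greenForm Λ F hE2).sqrt
  have hm2 : Measurable fun p : (Edge d → ℝ) × (T → ℝ) =>
      ∫⁻ t, Φ ((p.1, E p.2), √(greenForm Λ (E p.2) F) * t) ∂(gaussianReal 0 1) := by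
    refine Measurable.lintegral_prod_right' (f := fun p : ((Edge d → ℝ) × (T → ℝ)) × ℝ =>
      Φ ((p.1.1, E p.1.2), √(greenForm Λ (E p.1.2) F) * p.2)) ?_
    exact hΦ.comp (((measurable_fst.prodMk hE2).comp measurable_fst).prodMk
      ((hV.comp measurable_fst).mul measurable_snd))
  have e1 : ∀ ω : (Edge d → ℝ) × (Edge d → ℝ),
      Φ (ω, ∑ x : Λ, F x * dirichletPart Λ ω.2 ω.1 x) = Φ ((ω.1, E fun b => ω.2 b),
        ∑ x : Λ, F x * dirichletPart Λ (E fun b => ω.2 b) ω.1 x) := by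
    rintro ⟨η, κ⟩
    rw [hκ η κ (E fun b => κ b) _ (hE κ)]
    simp only [dirichletPart_congr (fun b hb => hE κ b (hT hb))]
  have e2 : ∀ ω : (Edge d → ℝ) × (Edge d → ℝ),
      ∫⁻ t, Φ (ω, √(greenForm Λ ω.2 F) * t) ∂(gaussianReal 0 1) =
        ∫⁻ t, Φ ((ω.1, E fun b => ω.2 b), √(greenForm Λ (E fun b => ω.2 b) F) * t)
          ∂(gaussianReal 0 1) := by
    rintro ⟨η, κ⟩
    refine lintegral_congr fun t => ?_
    rw [hκ η κ (E fun b => κ b) _ (hE κ)]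
    simp only [greenForm_congr (fun b hb => hE κ b (hT hb))]
  rw [lintegral_congr e1, lintegral_congr e2]
  rw [lintegral_extension hext T hm1, lintegral_extension hext T hm2]
  have hpos : ∀ᵐ k ∂(Measure.pi fun _ : T => ϱ), ∀ b : T, 0 < k b := by
    rw [ae_all_iff]
    intro b
    exact Measure.tendsto_eval_ae_ae (i := b) (by rwa [mem_ae_iff] : Set.Ioi 0 ∈ ae ϱ)
  refine lintegral_congr_ae ?_
  filter_upwards [hpos] with k hk
  have hkE : ∀ b ∈ touching Λ, 0 < E k b := by
    intro b hb
    simpa [E, hT hb] using hk ⟨b, hT hb⟩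
  have hkE' : (fun b : T => E k b) = k := by ext b; simp [E]
  have hpair : Measurable fun η : Edge d → ℝ => (η, k) := by fun_prop
  have hdens : Measurable fun η : Edge d → ℝ => extDensity ϱ T η k :=
    measurable_extDensity ϱ T measurable_id measurable_const
  have hm1k : Measurable fun η : Edge d → ℝ =>
      Φ ((η, E k), ∑ x : Λ, F x * dirichletPart Λ (E k) η x) := hm1.comp hpair
  have hm2k : Measurable fun η : Edge d → ℝ =>
      ∫⁻ t, Φ ((η, E k), √(greenForm Λ (E k) F) * t) ∂(gaussianReal 0 1) := hm2.comp hpair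
  -- With `k` frozen, the field in `Λ` is resampled on both sides; the density of the conductances
  -- is part of the test function.
  rw [lintegral_eq_lintegral_glue hG Λ (Φ := fun η => extDensity ϱ T η k *
      Φ ((η, E k), ∑ x : Λ, F x * dirichletPart Λ (E k) η x))
      (hdens.mul hm1k),
    lintegral_eq_lintegral_glue hG Λ (Φ := fun η => extDensity ϱ T η k *
      ∫⁻ t, Φ ((η, E k), √(greenForm Λ (E k) F) * t) ∂(gaussianReal 0 1))
      (hdens.mul hm2k)]
  refine lintegral_congr fun η => ?_
  congr 1
  obtain ⟨C, hC⟩ := weight_mul_extDensity hd ϱ hT hkE (field η)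
  rw [hkE'] at hC
  simp only [← mul_assoc, hC]
  -- The Dirichlet part of the glued field is `ψ + z`, with `z` fixed by the boundary values. A
  -- shift of Lebesgue measure removes `z` from the functional and the weight at once.
  set z : Λ → ℝ := fun x => dirichletPart Λ (E k) (grad (glue Λ (field η) 0)) x with hz
  have hsum : ∀ ψ : Λ → ℝ,
      ∑ x : Λ, F x * dirichletPart Λ (E k) (grad (glue Λ (field η) ψ)) x =
        ∑ x : Λ, F x * (ψ + z) x := by
    intro ψ
    refine Finset.sum_congr rfl fun x _ => ?_
    rw [congrFun (dirichletPart_glue hd hkE (field η) ψ) x, glue_coe]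
    rfl
  simp only [hsum, hη (field η) _ (E k) _ hkE]
  set w : (Λ → ℝ) → ℝ≥0∞ := fun ψ =>
    ENNReal.ofReal (Real.exp (-(1 / 2) * dirichletEnergy Λ (E k) ψ)) with hw
  have hwm : Measurable w := by
    have := (continuous_dirichletEnergy Λ (E k)).measurable
    fun_prop
  have hΨ : Measurable fun s : ℝ => Φ ((grad (glue Λ (field η) 0), E k), s) := by fun_prop
  have hX : Measurable fun ψ : Λ → ℝ => ∑ x : Λ, F x * ψ x := by fun_prop
  calc ∫⁻ ψ : Λ → ℝ, C * w (ψ + z) * Φ ((grad (glue Λ (field η) 0), E k), ∑ x : Λ, F x * (ψ + z) x)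
      = ∫⁻ ψ : Λ → ℝ, C * w ψ * Φ ((grad (glue Λ (field η) 0), E k), ∑ x : Λ, F x * ψ x) :=
        lintegral_add_right_eq_self (fun ψ : Λ → ℝ =>
          C * w ψ * Φ ((grad (glue Λ (field η) 0), E k), ∑ x : Λ, F x * ψ x)) z
    _ = C * ∫⁻ ψ : Λ → ℝ, Φ ((grad (glue Λ (field η) 0), E k), ∑ x : Λ, F x * ψ x) * w ψ := by
        have hΨX : Measurable fun ψ : Λ → ℝ =>
            Φ ((grad (glue Λ (field η) 0), E k), ∑ x : Λ, F x * ψ x) * w ψ :=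
          (hΨ.comp hX).mul hwm
        rw [← lintegral_const_mul _ hΨX]
        exact lintegral_congr fun ψ => by rw [mul_assoc, mul_comm (w ψ)]
    _ = C * ((∫⁻ t, Φ ((grad (glue Λ (field η) 0), E k), √(greenForm Λ (E k) F) * t)
          ∂(gaussianReal 0 1)) * ∫⁻ ψ : Λ → ℝ, w ψ) := by
        rw [lintegral_gaussian_weight hd hkE F hΨ]
    _ = ∫⁻ ψ : Λ → ℝ, C * w ψ * ∫⁻ t, Φ ((grad (glue Λ (field η) 0), E k),
          √(greenForm Λ (E k) F) * t) ∂(gaussianReal 0 1) := by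
        rw [lintegral_mul_const _ (hwm.const_mul C), lintegral_const_mul _ hwm]
        ring
    _ = _ := (lintegral_add_right_eq_self (fun ψ : Λ → ℝ =>
          C * w ψ * ∫⁻ t, Φ ((grad (glue Λ (field η) 0), E k),
            √(greenForm Λ (E k) F) * t) ∂(gaussianReal 0 1)) z).symm

end GradientGibbs

namespace GradientGibbs
open MeasureTheory ProbabilityTheory Filter Topology
open scoped ENNReal

variable {d : ℕ}

/-! ### The mean ergodic theorem in `L¹` -/

section MeanErgodic

variable {Ω : Type*} [MeasurableSpace Ω] {μ : Measure Ω}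

/-- Composition with a measure preserving map, as an operator on `Lᵖ`. -/
noncomputable def koopman (p : ℝ≥0∞) [Fact (1 ≤ p)] {T : Ω → Ω} (hT : MeasurePreserving T μ μ) :
    Lp ℝ p μ →L[ℝ] Lp ℝ p μ :=
  (Lp.compMeasurePreservingₗᵢ ℝ T hT).toContinuousLinearMap

theorem koopman_toLp (p : ℝ≥0∞) [Fact (1 ≤ p)] {T : Ω → Ω} (hT : MeasurePreserving T μ μ)
    {f : Ω → ℝ} (hf : MemLp f p μ) :
    koopman p hT (hf.toLp f) = (hf.comp_measurePreserving hT).toLp (f ∘ T) := rfl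

theorem norm_koopman_apply (p : ℝ≥0∞) [Fact (1 ≤ p)] {T : Ω → Ω} (hT : MeasurePreserving T μ μ)
    (f : Lp ℝ p μ) : ‖koopman p hT f‖ = ‖f‖ :=
  (Lp.compMeasurePreservingₗᵢ ℝ T hT).norm_map f

theorem koopman_iterate_toLp (p : ℝ≥0∞) [Fact (1 ≤ p)] {T : Ω → Ω} (hT : MeasurePreserving T μ μ)
    {f : Ω → ℝ} (hf : MemLp f p μ) (n : ℕ) :
    (koopman p hT)^[n] (hf.toLp f) =
      (hf.comp_measurePreserving (hT.iterate n)).toLp (f ∘ T^[n]) := by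
  induction n with
  | zero => rfl
  | succ n ih => rw [Function.iterate_succ_apply', ih, koopman_toLp]; rfl

theorem memLp_birkhoffSum {p : ℝ≥0∞} {T : Ω → Ω} (hT : MeasurePreserving T μ μ)
    {f : Ω → ℝ} (hf : MemLp f p μ) (n : ℕ) : MemLp (birkhoffSum T f n) p μ :=
  memLp_finsetSum _ fun j _ => hf.comp_measurePreserving (hT.iterate j)

theorem memLp_birkhoffAverage {p : ℝ≥0∞} {T : Ω → Ω} (hT : MeasurePreserving T μ μ)
    {f : Ω → ℝ} (hf : MemLp f p μ) (n : ℕ) : MemLp (birkhoffAverage ℝ T f n) p μ :=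
  (memLp_birkhoffSum hT hf n).const_smul ((n : ℝ)⁻¹)

theorem birkhoffAverage_koopman_toLp (p : ℝ≥0∞) [Fact (1 ≤ p)] {T : Ω → Ω}
    (hT : MeasurePreserving T μ μ) {f : Ω → ℝ} (hf : MemLp f p μ) (n : ℕ) :
    birkhoffAverage ℝ (koopman p hT) id n (hf.toLp f) =
      (memLp_birkhoffAverage hT hf n).toLp (birkhoffAverage ℝ T f n) := by
  have hsum : ∀ n, birkhoffSum (koopman p hT) id n (hf.toLp f) =
      (memLp_birkhoffSum hT hf n).toLp (birkhoffSum T f n) := by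
    intro n
    induction n with
    | zero =>
      simp only [birkhoffSum_zero]
      exact (MemLp.toLp_zero _).symm
    | succ n ih =>
      rw [birkhoffSum_succ, ih, id, koopman_iterate_toLp, ← MemLp.toLp_add]
      congr 1
      ext ω
      simp [birkhoffSum_succ]
  rw [birkhoffAverage, hsum, ← MemLp.toLp_const_smul]
  rfl

theorem norm_birkhoffAverage_koopman_sub_le (p : ℝ≥0∞) [Fact (1 ≤ p)] {T : Ω → Ω}
    (hT : MeasurePreserving T μ μ) (f g : Lp ℝ p μ) (n : ℕ) :
    ‖birkhoffAverage ℝ (koopman p hT) id n f - birkhoffAverage ℝ (koopman p hT) id n g‖ ≤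
      ‖f - g‖ := by
  have hiter : ∀ j, ‖(koopman p hT)^[j] f - (koopman p hT)^[j] g‖ = ‖f - g‖ := by
    intro j
    induction j with
    | zero => rfl
    | succ j ih =>
      rw [Function.iterate_succ_apply', Function.iterate_succ_apply', ← map_sub,
        norm_koopman_apply, ih]
  rcases Nat.eq_zero_or_pos n with rfl | hn
  · simp
  simp only [birkhoffAverage, birkhoffSum, id]
  rw [← smul_sub, ← Finset.sum_sub_distrib, norm_smul, norm_inv, Real.norm_natCast]
  have hn' : (0 : ℝ) < n := by exact_mod_cast hn
  rw [inv_mul_le_iff₀ hn']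
  refine (norm_sum_le _ _).trans ?_
  simp [hiter]

/-- Approximate by a simple function, use von Neumann's theorem in `L²` for it, and pass to `L¹`
since the averages are contractions and the `L²` norm dominates the `L¹` norm on a probability
space. -/
theorem exists_tendsto_birkhoffAverage_koopman_one [IsProbabilityMeasure μ] {T : Ω → Ω}
    (hT : MeasurePreserving T μ μ) (F : Lp ℝ 1 μ) :
    ∃ Z, Tendsto (fun n => birkhoffAverage ℝ (koopman 1 hT) id n F) atTop (𝓝 Z) := by
  refine cauchySeq_tendsto_of_complete (Metric.cauchySeq_iff.2 fun ε hε => ?_)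
  obtain ⟨g, hg, hg1⟩ := (Lp.memLp F).exists_simpleFunc_eLpNorm_sub_lt ENNReal.one_ne_top
    (ENNReal.ofReal_pos.2 (by positivity : 0 < ε / 3)).ne'
  have hg2 : MemLp g 2 μ := SimpleFunc.memLp_of_isFiniteMeasure g 2 μ
  have hFg : ‖F - hg1.toLp g‖ < ε / 3 := by
    have : F - hg1.toLp g = ((Lp.memLp F).sub hg1).toLp (⇑F - ⇑g) := by
      rw [MemLp.toLp_sub (Lp.memLp F) hg1, Lp.toLp_coeFn]
    rw [this, Lp.norm_toLp]
    exact (ENNReal.lt_ofReal_iff_toReal_lt hg.ne_top).1 hg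
  have hconv := (koopman 2 hT).tendsto_birkhoffAverage_orthogonalProjection
    ((koopman 2 hT).opNorm_le_bound zero_le_one fun x => by
      rw [norm_koopman_apply, one_mul]) (hg2.toLp g)
  have hcau : CauchySeq fun n => (memLp_birkhoffAverage hT hg2 n).toLp (birkhoffAverage ℝ T g n) := by
    simpa only [birkhoffAverage_koopman_toLp] using hconv.cauchySeq
  obtain ⟨N, hN⟩ := Metric.cauchySeq_iff.1 hcau (ε / 3) (by positivity)
  refine ⟨N, fun m hm n hn => ?_⟩
  have h12 : ‖birkhoffAverage ℝ (koopman 1 hT) id m (hg1.toLp g) -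
      birkhoffAverage ℝ (koopman 1 hT) id n (hg1.toLp g)‖ < ε / 3 := by
    refine lt_of_le_of_lt ?_ (hN m hm n hn)
    rw [birkhoffAverage_koopman_toLp, birkhoffAverage_koopman_toLp, dist_eq_norm,
      ← MemLp.toLp_sub, ← MemLp.toLp_sub, Lp.norm_toLp, Lp.norm_toLp]
    refine ENNReal.toReal_mono
      ((memLp_birkhoffAverage hT hg2 m).sub (memLp_birkhoffAverage hT hg2 n)).2.ne ?_
    exact eLpNorm_le_eLpNorm_of_exponent_le (by norm_num)
      ((memLp_birkhoffAverage hT hg2 m).sub (memLp_birkhoffAverage hT hg2 n)).1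
  have hm' := (norm_birkhoffAverage_koopman_sub_le 1 hT F (hg1.toLp g) m).trans_lt hFg
  have hn' := (norm_birkhoffAverage_koopman_sub_le 1 hT F (hg1.toLp g) n).trans_lt hFg
  rw [norm_sub_rev] at hn'
  rw [dist_eq_norm]
  calc _ = ‖(birkhoffAverage ℝ (koopman 1 hT) id m F -
          birkhoffAverage ℝ (koopman 1 hT) id m (hg1.toLp g)) +
        (birkhoffAverage ℝ (koopman 1 hT) id m (hg1.toLp g) -
          birkhoffAverage ℝ (koopman 1 hT) id n (hg1.toLp g)) +
        (birkhoffAverage ℝ (koopman 1 hT) id n (hg1.toLp g) -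
          birkhoffAverage ℝ (koopman 1 hT) id n F)‖ := by congr 1; abel
    _ ≤ _ := norm_add₃_le
    _ < ε := by linarith

/-- Birkhoff averages of integrable functions converge in `L¹`. -/
theorem exists_tendsto_integral_abs_birkhoffAverage_sub [IsProbabilityMeasure μ] {T : Ω → Ω}
    (hT : MeasurePreserving T μ μ) {f : Ω → ℝ} (hf : Integrable f μ) :
    ∃ Z : Ω → ℝ, Measurable Z ∧ Integrable Z μ ∧
      Tendsto (fun n => ∫ ω, |birkhoffAverage ℝ T f n ω - Z ω| ∂μ) atTop (𝓝 0) := by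
  have hf1 := memLp_one_iff_integrable.2 hf
  obtain ⟨Z, hZ⟩ := exists_tendsto_birkhoffAverage_koopman_one hT (hf1.toLp f)
  have hZi : Integrable Z μ := memLp_one_iff_integrable.1 (Lp.memLp Z)
  refine ⟨hZi.1.mk Z, hZi.1.stronglyMeasurable_mk.measurable, hZi.congr hZi.1.ae_eq_mk, ?_⟩
  rw [tendsto_iff_norm_sub_tendsto_zero] at hZ
  refine hZ.congr fun n => ?_
  rw [birkhoffAverage_koopman_toLp, L1.norm_eq_integral_norm]
  refine integral_congr_ae ?_
  filter_upwards [Lp.coeFn_sub ((memLp_birkhoffAverage hT hf1 n).toLp _) Z,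
    (memLp_birkhoffAverage hT hf1 n).coeFn_toLp, hZi.1.ae_eq_mk] with ω h1 h2 h3
  rw [h1, Pi.sub_apply, h2, ← h3, Real.norm_eq_abs]

end MeanErgodic

/-! ### Sublinearity of the field -/

theorem translate_add (x y : Lattice d) (η : Edge d → ℝ) :
    translate x (translate y η) = translate (x + y) η := by
  ext b; simp [translate, add_assoc]

/-- The field is a cocycle over the translations. This gives stationary increments, subadditivity of
`meanAbs`, and field values along an axis as Birkhoff sums. -/
theorem field_translate {η : Edge d → ℝ} (h : LoopCondition η) (x y : Lattice d) :
    field (translate x η) y = field η (y + x) - field η x := by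
  have : field (translate x η) = fun y => field η (y + x) - field η x := by
    refine field_eq_of_grad (by simp) ?_
    ext b
    have := congrFun (grad_field h) (b.1 + x, b.2)
    rw [translate, ← this]
    simp [grad, add_right_comm]
  rw [this]

variable {μ : Measure (Edge d → ℝ)}

theorem measurePreserving_translate (hinv : IsTranslationInvariant μ) (x : Lattice d) :
    MeasurePreserving (translate x) μ μ := ⟨measurable_translate x, hinv x⟩

theorem integrable_field (hloop : ∀ᵐ η ∂μ, LoopCondition η) (htilt : HasZeroTilt μ)
    (x : Lattice d) : Integrable (fun η => field η x) μ := by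
  have h : Integrable (fun η => flowPair (flowTo x) η) μ := by
    unfold flowPair Finsupp.sum
    exact integrable_finsetSum _ fun b _ => (htilt b).1.const_mul _
  refine h.congr ?_
  filter_upwards [hloop] with η hη
  exact (field_apply hη x).symm

/-- The mean modulus of the field at `x`. -/
noncomputable def meanAbs (μ : Measure (Edge d → ℝ)) (x : Lattice d) : ℝ :=
  ∫ η, |field η x| ∂μ

theorem meanAbs_nonneg (x : Lattice d) : 0 ≤ meanAbs μ x :=
  integral_nonneg fun _ => abs_nonneg _

theorem meanAbs_eq_translate (hloop : ∀ᵐ η ∂μ, LoopCondition η) (hinv : IsTranslationInvariant μ)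
    (x y : Lattice d) : ∫ η, |field η (y + x) - field η x| ∂μ = meanAbs μ y := by
  rw [meanAbs]
  have hm : Measurable fun η : Edge d → ℝ => |field η y| :=
    ((measurable_pi_apply y).comp measurable_field).abs
  conv_rhs => rw [← hinv x]
  rw [integral_map (measurable_translate x).aemeasurable hm.aestronglyMeasurable]
  refine integral_congr_ae ?_
  filter_upwards [hloop] with η hη
  rw [field_translate hη]

theorem meanAbs_add_le (hloop : ∀ᵐ η ∂μ, LoopCondition η) (hinv : IsTranslationInvariant μ)
    (htilt : HasZeroTilt μ) (x y : Lattice d) :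
    meanAbs μ (x + y) ≤ meanAbs μ x + meanAbs μ y := by
  rw [← meanAbs_eq_translate hloop hinv y x]
  have hi := integrable_field hloop htilt
  have hi' : Integrable (fun η => |field η (x + y) - field η y|) μ := ((hi _).sub (hi _)).abs
  rw [meanAbs, meanAbs, ← integral_add hi' (hi y).abs]
  refine integral_mono (hi _).abs (hi'.add (hi y).abs) fun η => ?_
  calc |field η (x + y)| = |(field η (x + y) - field η y) + field η y| := by ring_nf
    _ ≤ _ := abs_add_le _ _

theorem meanAbs_neg (hloop : ∀ᵐ η ∂μ, LoopCondition η) (hinv : IsTranslationInvariant μ)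
    (x : Lattice d) : meanAbs μ (-x) = meanAbs μ x := by
  rw [← meanAbs_eq_translate hloop hinv x (-x)]
  simp [meanAbs, field_zero]

theorem meanAbs_zero : meanAbs μ 0 = 0 := by simp [meanAbs, field_zero]

theorem meanAbs_nsmul_le (hloop : ∀ᵐ η ∂μ, LoopCondition η) (hinv : IsTranslationInvariant μ)
    (htilt : HasZeroTilt μ) (n : ℕ) (x : Lattice d) : meanAbs μ (n • x) ≤ n * meanAbs μ x := by
  induction n with
  | zero => simp [meanAbs_zero]
  | succ n ih =>
    rw [succ_nsmul]
    refine (meanAbs_add_le hloop hinv htilt _ _).trans ?_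
    push_cast
    linarith

theorem meanAbs_sum_le (hloop : ∀ᵐ η ∂μ, LoopCondition η) (hinv : IsTranslationInvariant μ)
    (htilt : HasZeroTilt μ) {ι : Type*} (s : Finset ι) (f : ι → Lattice d) :
    meanAbs μ (∑ i ∈ s, f i) ≤ ∑ i ∈ s, meanAbs μ (f i) := by
  classical
  induction s using Finset.induction_on with
  | empty => simp [meanAbs_zero]
  | insert a s ha ih =>
    rw [Finset.sum_insert ha, Finset.sum_insert ha]
    exact (meanAbs_add_le hloop hinv htilt _ _).trans (by linarith)

/-- An a.e. translation-invariant function is a.e. constant. -/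
theorem ae_eq_const_of_invariant [IsProbabilityMeasure μ]
    (herg : IsErgodic μ) {Z : (Edge d → ℝ) → ℝ} (hZ : Measurable Z)
    (h : ∀ x, ∀ᵐ η ∂μ, Z (translate x η) = Z η) : ∃ c : ℝ, Z =ᵐ[μ] fun _ => c := by
  refine exists_eventuallyEq_const_of_forall_separating MeasurableSet fun U hU => ?_
  -- Requiring the condition along the whole orbit makes the event strictly invariant, as the
  -- definition of ergodicity demands, and changes it only by a null set.
  set A : Set (Edge d → ℝ) := {η | ∀ x, Z (translate x η) ∈ U} with hA
  have hAm : MeasurableSet A := by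
    have : A = ⋂ x : Lattice d, (fun η => Z (translate x η)) ⁻¹' U := by ext η; simp [hA]
    rw [this]
    exact MeasurableSet.iInter fun x => (hZ.comp (measurable_translate x)) hU
  have hAinv : ∀ x, translate x ⁻¹' A = A := by
    intro x
    ext η
    simp only [hA, Set.mem_preimage, Set.mem_ofPred_eq, translate_add]
    exact ⟨fun hη y => by simpa using hη (y - x), fun hη y => hη _⟩
  have hae : ∀ᵐ η ∂μ, (η ∈ A ↔ Z η ∈ U) := by
    filter_upwards [ae_all_iff.2 h] with η hη
    simp [hA, hη]
  rcases herg A hAm hAinv with h0 | h1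
  · right
    have : ∀ᵐ η ∂μ, η ∉ A := by rw [ae_iff]; simpa using h0
    filter_upwards [this, hae] with η h2 h3 using fun h4 => h2 (h3.2 h4)
  · left
    have : ∀ᵐ η ∂μ, η ∈ A := (mem_ae_iff_prob_eq_one hAm).2 h1
    filter_upwards [this, hae] with η h2 h3 using h3.1 h2

theorem translate_iterate (x : Lattice d) (n : ℕ) :
    (translate x : (Edge d → ℝ) → _)^[n] = translate (n • x) := by
  induction n with
  | zero => ext η b; simp [translate]
  | succ n ih =>
    rw [Function.iterate_succ', ih]
    ext η : 1
    rw [Function.comp_apply, translate_add, succ_nsmul']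

theorem birkhoffSum_translate_field {η : Edge d → ℝ} (h : LoopCondition η) (x : Lattice d)
    (n : ℕ) : birkhoffSum (translate x) (fun η => field η x) n η = field η (n • x) := by
  induction n with
  | zero => simp [field_zero]
  | succ n ih =>
    rw [birkhoffSum_succ, ih, translate_iterate, field_translate h, succ_nsmul, add_comm (n • x)]
    ring

/-- `φ(n e_i) / n` is a Birkhoff average and converges in `L¹`. A single translation need not be
ergodic, so the limit is shown to be invariant under all translations; it is then constant, and zero
tilt makes the constant zero. -/
theorem tendsto_meanAbs_nsmul [IsProbabilityMeasure μ] (hloop : ∀ᵐ η ∂μ, LoopCondition η)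
    (hinv : IsTranslationInvariant μ) (herg : IsErgodic μ) (htilt : HasZeroTilt μ) (i : Fin d) :
    Tendsto (fun n : ℕ => meanAbs μ (n • unitVec i) / n) atTop (𝓝 0) := by
  have hT := measurePreserving_translate hinv (unitVec i)
  have hi := integrable_field hloop htilt
  obtain ⟨Z, hZm, hZi, hZ⟩ := exists_tendsto_integral_abs_birkhoffAverage_sub hT (hi (unitVec i))
  set A : ℕ → (Edge d → ℝ) → ℝ := fun n => birkhoffAverage ℝ (translate (unitVec i))
    (fun η => field η (unitVec i)) n with hA
  have hAi : ∀ n, Integrable (A n) μ := fun n =>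
    memLp_one_iff_integrable.1 (memLp_birkhoffAverage hT (memLp_one_iff_integrable.2 (hi _)) n)
  have hAeq : ∀ n, ∀ᵐ η ∂μ, A n η = (n : ℝ)⁻¹ * field η (n • unitVec i) := by
    intro n
    filter_upwards [hloop] with η hη
    simp only [hA, birkhoffAverage, birkhoffSum_translate_field hη, smul_eq_mul]
  have hZinv : ∀ x, ∀ᵐ η ∂μ, Z (translate x η) = Z η := by
    intro x
    have hTx := measurePreserving_translate hinv x
    have hZxi : Integrable (fun η => Z (translate x η)) μ := hTx.integrable_comp_of_integrable hZi
    -- By the cocycle identity, translating the average by `x` changes it by `1/n` times a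
    -- difference of two field increments, each of mean modulus `meanAbs μ x`.
    have hbound : ∀ n : ℕ, ∫ η, |Z (translate x η) - Z η| ∂μ ≤
        2 * ∫ η, |A n η - Z η| ∂μ + (n : ℝ)⁻¹ * (2 * meanAbs μ x) := by
      intro n
      have hi1 : Integrable (fun η => |A n η - Z η|) μ := ((hAi n).sub hZi).abs
      have hi2 : Integrable (fun η => |A n (translate x η) - Z (translate x η)|) μ :=
        hTx.integrable_comp_of_integrable hi1
      have e2 : ∫ η, |A n (translate x η) - Z (translate x η)| ∂μ = ∫ η, |A n η - Z η| ∂μ := by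
        conv_rhs => rw [← hinv x]
        rw [integral_map hTx.measurable.aemeasurable]
        rw [hinv x]; exact hi1.1
      have hi3 : Integrable (fun η => |field η (x + n • unitVec i) - field η (n • unitVec i)|) μ :=
        ((hi _).sub (hi _)).abs
      have hi4 : Integrable (fun η => |field η x|) μ := (hi x).abs
      calc ∫ η, |Z (translate x η) - Z η| ∂μ
          ≤ ∫ η, ((|A n (translate x η) - Z (translate x η)| + |A n η - Z η|) + (n : ℝ)⁻¹ *
              (|field η (x + n • unitVec i) - field η (n • unitVec i)| + |field η x|)) ∂μ := by
            refine integral_mono_ae (hZxi.sub hZi).abs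
              ((hi2.add hi1).add ((hi3.add hi4).const_mul _)) ?_
            filter_upwards [hTx.quasiMeasurePreserving.ae (hAeq n), hAeq n, hloop] with η h1 h2 h3
            have h5 : A n (translate x η) - A n η = (n : ℝ)⁻¹ *
                ((field η (x + n • unitVec i) - field η (n • unitVec i)) - field η x) := by
              rw [h1, h2, field_translate h3, add_comm x]; ring
            have h6 : |A n (translate x η) - A n η| ≤ (n : ℝ)⁻¹ *
                (|field η (x + n • unitVec i) - field η (n • unitVec i)| + |field η x|) := by
              rw [h5, abs_mul, abs_of_nonneg (by positivity : (0 : ℝ) ≤ (n : ℝ)⁻¹)]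
              exact mul_le_mul_of_nonneg_left (abs_sub _ _) (by positivity)
            have h7 : Z (translate x η) - Z η = -(A n (translate x η) - Z (translate x η)) +
              (A n η - Z η) + (A n (translate x η) - A n η) := by ring
            change |Z (translate x η) - Z η| ≤ _
            rw [h7]
            refine (abs_add_three _ _ _).trans ?_
            rw [abs_neg]
            linarith
        _ = _ := by
            have hi12 : Integrable (fun η => |A n (translate x η) - Z (translate x η)| +
              |A n η - Z η|) μ := hi2.add hi1
            have hi34 : Integrable (fun η => (n : ℝ)⁻¹ *
              (|field η (x + n • unitVec i) - field η (n • unitVec i)| + |field η x|)) μ :=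
              (hi3.add hi4).const_mul _
            rw [integral_add hi12 hi34, integral_add hi2 hi1,
              integral_const_mul, integral_add hi3 hi4, e2,
              meanAbs_eq_translate hloop hinv (n • unitVec i) x, meanAbs]
            ring
    have hle : ∫ η, |Z (translate x η) - Z η| ∂μ ≤ 0 := by
      refine ge_of_tendsto' (x := atTop) ?_ hbound
      have h1 := (hZ.const_mul 2).add
        ((tendsto_inv_atTop_nhds_zero_nat (𝕜 := ℝ)).mul_const (2 * meanAbs μ x))
      simpa using h1
    have h0 := le_antisymm hle (integral_nonneg fun _ => abs_nonneg _)
    have := (integral_eq_zero_iff_of_nonneg (fun _ => abs_nonneg _) (hZxi.sub hZi).abs).1 h0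
    filter_upwards [this] with η hη
    exact sub_eq_zero.1 (abs_eq_zero.1 hη)
  obtain ⟨c, hc⟩ := ae_eq_const_of_invariant herg hZm hZinv
  have hint0 : ∀ x, ∫ η, field η x ∂μ = 0 := by
    intro x
    have : ∀ᵐ η ∂μ, field η x = flowPair (flowTo x) η := by
      filter_upwards [hloop] with η hη using field_apply hη x
    rw [integral_congr_ae this]
    unfold flowPair Finsupp.sum
    rw [integral_finsetSum _ fun b _ => (htilt b).1.const_mul _]
    exact Finset.sum_eq_zero fun b _ => by rw [integral_const_mul, (htilt b).2, mul_zero]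
  have hc0 : c = 0 := by
    have h1 : ∀ n, |c| ≤ ∫ η, |A n η - Z η| ∂μ := by
      intro n
      have h2 : ∫ η, (A n η - Z η) ∂μ = -c := by
        rw [integral_sub (hAi n) hZi, integral_congr_ae (hAeq n), integral_const_mul, hint0,
          integral_congr_ae hc]
        simp
      rw [← abs_neg c, ← h2]
      exact abs_integral_le_integral_abs
    have := ge_of_tendsto' hZ h1
    exact abs_eq_zero.1 (le_antisymm this (abs_nonneg _))
  refine hZ.congr fun n => ?_
  rw [meanAbs, div_eq_inv_mul, ← integral_const_mul]
  refine integral_congr_ae ?_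
  filter_upwards [hAeq n, hc] with η h1 h2
  change |A n η - Z η| = _
  rw [h1, h2, hc0, sub_zero, abs_mul, abs_of_nonneg (by positivity : (0 : ℝ) ≤ (n : ℝ)⁻¹)]

/-- The field grows sublinearly in mean. -/
theorem eventually_meanAbs_le [IsProbabilityMeasure μ] (hloop : ∀ᵐ η ∂μ, LoopCondition η)
    (hinv : IsTranslationInvariant μ) (herg : IsErgodic μ) (htilt : HasZeroTilt μ) {ε : ℝ}
    (hε : 0 < ε) :
    ∀ᶠ n : ℕ in atTop, ∀ x : Lattice d, (∀ i, (x i).natAbs ≤ n) → meanAbs μ x ≤ ε * n := by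
  -- Uniformity in `k ≤ n`: for `k` beyond a fixed `m` use the limit along the axis, for smaller `k`
  -- the linear bound, which is negligible for large `n`.
  have haxis : ∀ i : Fin d, ∀ δ > 0, ∀ᶠ n : ℕ in atTop, ∀ k ≤ n,
      meanAbs μ (k • unitVec i) ≤ δ * n := by
    intro i δ hδ
    have h1 := (tendsto_meanAbs_nsmul hloop hinv herg htilt i).eventually (gt_mem_nhds hδ)
    obtain ⟨m, hm⟩ := eventually_atTop.1 h1
    obtain ⟨m', hm'⟩ := exists_nat_ge (m * meanAbs μ (unitVec i) / δ)
    filter_upwards [eventually_ge_atTop m'] with n hn k hk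
    have hkn : (k : ℝ) ≤ n := by exact_mod_cast hk
    have hmn : (m' : ℝ) ≤ n := by exact_mod_cast hn
    rcases lt_or_ge k m with hkm | hkm
    · have h2 := meanAbs_nsmul_le hloop hinv htilt k (unitVec i)
      have h3 : (k : ℝ) ≤ m := by exact_mod_cast hkm.le
      have h4 := mul_le_mul_of_nonneg_right h3 (meanAbs_nonneg (μ := μ) (unitVec i))
      rw [div_le_iff₀ hδ] at hm'
      nlinarith
    · rcases Nat.eq_zero_or_pos k with rfl | hk0
      · simp only [zero_smul, meanAbs_zero]; positivity
      · have h2 := (hm k hkm).le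
        rw [div_le_iff₀ (by exact_mod_cast hk0)] at h2
        exact h2.trans (mul_le_mul_of_nonneg_left hkn hδ.le)
  -- Dividing `ε` by `d + 1` rather than `d` leaves dimension zero unexceptional.
  have hd1 : (0 : ℝ) < d + 1 := by positivity
  have hall := eventually_all.2 fun i => haxis i (ε / (d + 1)) (by positivity)
  filter_upwards [hall] with n hn x hx
  have hdecomp : x = ∑ i, (x i) • unitVec i := by
    ext j
    simp [Finset.sum_apply, unitVec_apply]
  rw [hdecomp]
  refine (meanAbs_sum_le hloop hinv htilt _ _).trans ?_
  have hterm : ∀ i, meanAbs μ (x i • unitVec i) ≤ ε / (d + 1) * n := by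
    intro i
    have h1 := hn i (x i).natAbs (hx i)
    rcases Int.natAbs_eq (x i) with h | h
    · rw [h, natCast_zsmul]; simpa using h1
    · rw [h, neg_smul, natCast_zsmul, meanAbs_neg hloop hinv]; simpa using h1
  refine (Finset.sum_le_sum fun i _ => hterm i).trans ?_
  rw [Finset.sum_const, Finset.card_univ, Fintype.card_fin, nsmul_eq_mul]
  have : (d : ℝ) * (ε / (d + 1) * n) = (d / (d + 1)) * (ε * n) := by ring
  rw [this]
  have h2 : (d : ℝ) / (d + 1) ≤ 1 := by rw [div_le_one hd1]; linarith
  calc _ ≤ 1 * (ε * n) := mul_le_mul_of_nonneg_right h2 (by positivity)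
    _ = ε * n := one_mul _

end GradientGibbs

namespace GradientGibbs
open MeasureTheory ProbabilityTheory Filter Topology
open scoped ENNReal

variable {d : ℕ}

/-! ### Moment bounds in a finite set -/

section Moments

variable {ϱ : Measure ℝ} {a c : ℝ} {μ : Measure (Edge d → ℝ)}
  {μt : Measure ((Edge d → ℝ) × (Edge d → ℝ))}

theorem measure_compl_Ioi_eq_zero (ha : 0 < a) (hϱ : ϱ (Set.Icc a c)ᶜ = 0) :
    ϱ (Set.Ioi 0)ᶜ = 0 :=
  measure_mono_null (Set.compl_subset_compl.2 fun _ hx => ha.trans_le hx.1) hϱ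

/-- The first absolute moment of the standard normal distribution. -/
noncomputable def normalAbs : ℝ := ∫ t, |t| ∂(gaussianReal 0 1)

theorem integrable_abs_gaussianReal : Integrable (fun t : ℝ => |t|) (gaussianReal 0 1) :=
  ((memLp_id_gaussianReal 1).integrable (by norm_num)).abs

theorem normalAbs_nonneg : 0 ≤ normalAbs := integral_nonneg fun _ => abs_nonneg _

theorem integrable_comp_fst (hext : IsExtension ϱ μ μt) {f : (Edge d → ℝ) → ℝ}
    (hf : Integrable f μ) : Integrable (fun ω : (Edge d → ℝ) × (Edge d → ℝ) => f ω.1) μt := by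
  rw [← map_fst_extension hext] at hf
  exact hf.comp_measurable measurable_fst

theorem integral_comp_fst (hext : IsExtension ϱ μ μt) {f : (Edge d → ℝ) → ℝ}
    (hf : AEStronglyMeasurable f μ) : ∫ ω, f ω.1 ∂μt = ∫ η, f η ∂μ := by
  rw [← map_fst_extension hext] at hf
  conv_rhs => rw [← map_fst_extension hext]
  exact (integral_map measurable_fst.aemeasurable hf).symm

theorem ae_fst (hext : IsExtension ϱ μ μt) {p : (Edge d → ℝ) → Prop}
    (hp : ∀ᵐ η ∂μ, p η) : ∀ᵐ ω ∂μt, p ω.1 := by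
  rw [← map_fst_extension hext] at hp
  exact ae_of_ae_map measurable_fst.aemeasurable hp

theorem integral_abs_edge (hloop : ∀ᵐ η ∂μ, LoopCondition η) (hinv : IsTranslationInvariant μ)
    (b : Edge d) : ∫ η, |η b| ∂μ = meanAbs μ (unitVec b.2) := by
  rw [← meanAbs_eq_translate hloop hinv b.1 (unitVec b.2)]
  refine integral_congr_ae ?_
  filter_upwards [hloop] with η hη
  conv_lhs => rw [← grad_field hη]
  rw [grad, add_comm]

/-- A uniform bound on the mean modulus of the harmonic part at an edge. -/
noncomputable def edgeBound (μ : Measure (Edge d → ℝ)) (a : ℝ) : ℝ :=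
  ∑ i, meanAbs μ (unitVec i) + √(a⁻¹) * normalAbs

theorem edgeBound_nonneg : 0 ≤ edgeBound μ a :=
  add_nonneg (Finset.sum_nonneg fun _ _ => meanAbs_nonneg _)
    (mul_nonneg (Real.sqrt_nonneg _) normalAbs_nonneg)

variable [IsFiniteMeasure ϱ] [IsProbabilityMeasure μ] [IsProbabilityMeasure μt]

/-- Given `κ` the functional is centered normal with variance at most `C`, so its mean modulus is at
most `√C` times that of a standard normal. The computation with `∫⁻` yields integrability too. -/
theorem integrable_and_integral_abs_le (hd : 1 ≤ d) (ha : 0 < a) (hϱ : ϱ (Set.Icc a c)ᶜ = 0)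
    (hG : IsGradientGibbs ϱ μ) (hext : IsExtension ϱ μ μt) (Λ : Finset (Lattice d))
    (F : Lattice d → ℝ) {C : ℝ}
    (hC : ∀ κ : Edge d → ℝ, (∀ b, κ b ∈ Set.Icc a c) → greenForm Λ κ F ≤ C) :
    Integrable (fun ω => ∑ x : Λ, F x * dirichletPart Λ ω.2 ω.1 x) μt ∧
      ∫ ω, |∑ x : Λ, F x * dirichletPart Λ ω.2 ω.1 x| ∂μt ≤ √C * normalAbs := by
  have hm : Measurable fun ω : (Edge d → ℝ) × (Edge d → ℝ) =>
      ∑ x : Λ, F x * dirichletPart Λ ω.2 ω.1 x := by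
    have := measurable_dirichletPart Λ (α := (Edge d → ℝ) × (Edge d → ℝ)) measurable_snd
      measurable_fst
    fun_prop
  have hres := lintegral_resample hd (measure_compl_Ioi_eq_zero ha hϱ) hG hext Λ (touching Λ)
    subset_rfl F (Φ := fun p => ENNReal.ofReal |p.2|) (by fun_prop) (fun _ _ _ _ _ => rfl)
    (fun _ _ _ _ _ => rfl)
  have hle : ∫⁻ ω, ENNReal.ofReal |∑ x : Λ, F x * dirichletPart Λ ω.2 ω.1 x| ∂μt ≤
      ENNReal.ofReal (√C * normalAbs) := by
    refine hres.le.trans ?_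
    have hκ := ae_mem_of_extension hext measurableSet_Icc hϱ
    refine (lintegral_mono_ae (g := fun _ => ENNReal.ofReal (√C * normalAbs)) ?_).trans (by simp)
    filter_upwards [hκ] with ω hω
    rw [normalAbs, ← integral_const_mul, ofReal_integral_eq_lintegral_ofReal
      (integrable_abs_gaussianReal.const_mul _) (Eventually.of_forall fun t => by positivity)]
    refine lintegral_mono fun t => ENNReal.ofReal_le_ofReal ?_
    change |√(greenForm Λ ω.2 F) * t| ≤ √C * |t|
    rw [abs_mul, abs_of_nonneg (Real.sqrt_nonneg _)]
    exact mul_le_mul_of_nonneg_right (Real.sqrt_le_sqrt (hC _ hω)) (abs_nonneg _)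
  have hintegrable : Integrable (fun ω => ∑ x : Λ, F x * dirichletPart Λ ω.2 ω.1 x) μt := by
    refine ⟨hm.aestronglyMeasurable, ?_⟩
    rw [hasFiniteIntegral_iff_norm]
    exact hle.trans_lt ENNReal.ofReal_lt_top
  refine ⟨hintegrable, ?_⟩
  rw [integral_eq_lintegral_of_nonneg_ae (Eventually.of_forall fun _ => abs_nonneg _)
    hintegrable.abs.1]
  exact ENNReal.toReal_le_of_le_ofReal (mul_nonneg (Real.sqrt_nonneg _) normalAbs_nonneg) hle

theorem inv_le_of_mem {κ : Edge d → ℝ} (ha : 0 < a) (hκ : ∀ b, κ b ∈ Set.Icc a c)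
    (Λ : Finset (Lattice d)) (h : Lattice d → ℝ) :
    ∑ b ∈ touching Λ, grad h b ^ 2 ≤ a⁻¹ * ∑ b ∈ touching Λ, κ b * grad h b ^ 2 := by
  rw [Finset.mul_sum]
  refine Finset.sum_le_sum fun b _ => ?_
  rw [← mul_assoc]
  have : 1 ≤ a⁻¹ * κ b := by
    rw [← div_eq_inv_mul, one_le_div ha]; exact (hκ b).1
  nlinarith [sq_nonneg (grad h b)]

theorem integrable_and_integral_abs_grad_dirichletPart_le (hd : 1 ≤ d) (ha : 0 < a)
    (hϱ : ϱ (Set.Icc a c)ᶜ = 0) (hG : IsGradientGibbs ϱ μ) (hext : IsExtension ϱ μ μt)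
    (Λ : Finset (Lattice d)) (b : Edge d) :
    Integrable (fun ω => grad (dirichletPart Λ ω.2 ω.1) b) μt ∧
      ∫ ω, |grad (dirichletPart Λ ω.2 ω.1) b| ∂μt ≤ √(a⁻¹) * normalAbs := by
  classical
  -- `F` is a dipole on the edge `b`, so `(F, h)² = (∇h)_b²` is at most `a⁻¹` times the energy: a
  -- variance bound independent of volume and edge.
  set F : Lattice d → ℝ := fun x => (if x = b.1 + unitVec b.2 then 1 else 0) -
    (if x = b.1 then 1 else 0) with hF
  have hFh : ∀ h : Lattice d → ℝ, (∀ x ∉ Λ, h x = 0) → ∑ x ∈ Λ, F x * h x = grad h b := by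
    intro h hh
    simp only [hF, sub_mul, ite_mul, one_mul, zero_mul, Finset.sum_sub_distrib, Finset.sum_ite_eq',
      grad]
    congr 1
    · split_ifs with h1
      · rfl
      · exact (hh _ h1).symm
    · split_ifs with h1
      · rfl
      · exact (hh _ h1).symm
  have := integrable_and_integral_abs_le hd ha hϱ hG hext Λ F (C := a⁻¹) fun κ hκ => by
    refine greenForm_le hd (fun b _ => ha.trans_le (hκ b).1) F (inv_pos.2 ha).le fun h hh => ?_
    rw [hFh h hh]
    refine le_trans ?_ (inv_le_of_mem ha hκ Λ h)
    by_cases hb : b ∈ touching Λ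
    · exact Finset.single_le_sum (f := fun b => grad h b ^ 2) (fun _ _ => sq_nonneg _) hb
    · rw [grad_eq_zero_of_notMem_touching hh hb]
      simpa using Finset.sum_nonneg fun b _ => sq_nonneg (grad h b)
  have hsum : ∀ ω : (Edge d → ℝ) × (Edge d → ℝ),
      ∑ x : Λ, F x * dirichletPart Λ ω.2 ω.1 x = grad (dirichletPart Λ ω.2 ω.1) b := by
    intro ω
    rw [Finset.sum_coe_sort Λ (fun x => F x * dirichletPart Λ ω.2 ω.1 x)]
    exact hFh _ (dirichletSolve_of_notMem _ _)
  simpa only [hsum] using this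

theorem integrable_and_integral_abs_dirichletPart_le (hd : 1 ≤ d) (ha : 0 < a)
    (hϱ : ϱ (Set.Icc a c)ᶜ = 0) (hG : IsGradientGibbs ϱ μ) (hext : IsExtension ϱ μ μt)
    (Λ : Finset (Lattice d)) (x : Lattice d) (i : Fin d) (N : ℕ) (hN : x + N • unitVec i ∉ Λ) :
    Integrable (fun ω => dirichletPart Λ ω.2 ω.1 x) μt ∧
      ∫ ω, |dirichletPart Λ ω.2 ω.1 x| ∂μt ≤ √(N * a⁻¹) * normalAbs := by
  classical
  set F : Lattice d → ℝ := fun y => if y = x then 1 else 0 with hF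
  have hFh : ∀ h : Lattice d → ℝ, (∀ x ∉ Λ, h x = 0) → ∑ x ∈ Λ, F x * h x = h x := by
    intro h hh
    simp only [hF, ite_mul, one_mul, zero_mul, Finset.sum_ite_eq']
    split_ifs with h1
    · rfl
    · exact (hh _ h1).symm
  -- For a point mass the variance bound grows with the number `N` of steps out of `Λ`, by the ray
  -- estimate.
  have := integrable_and_integral_abs_le hd ha hϱ hG hext Λ F (C := N * a⁻¹) fun κ hκ => by
    refine greenForm_le hd (fun b _ => ha.trans_le (hκ b).1) F (by positivity) fun h hh => ?_
    rw [hFh h hh, mul_assoc]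
    exact (sq_le_mul_sum_touching hh x i N hN).trans
      (mul_le_mul_of_nonneg_left (inv_le_of_mem ha hκ Λ h) (Nat.cast_nonneg _))
  have hsum : ∀ ω : (Edge d → ℝ) × (Edge d → ℝ),
      ∑ x : Λ, F x * dirichletPart Λ ω.2 ω.1 x = dirichletPart Λ ω.2 ω.1 x := by
    intro ω
    rw [Finset.sum_coe_sort Λ (fun x => F x * dirichletPart Λ ω.2 ω.1 x)]
    exact hFh _ (dirichletSolve_of_notMem _ _)
  simpa only [hsum] using this

theorem integrable_harmonicPart (hd : 1 ≤ d) (ha : 0 < a)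
    (hϱ : ϱ (Set.Icc a c)ᶜ = 0) (hG : IsGradientGibbs ϱ μ) (htilt : HasZeroTilt μ)
    (hext : IsExtension ϱ μ μt) (Λ : Finset (Lattice d)) (b : Edge d) :
    Integrable (fun ω => harmonicPart Λ ω.2 ω.1 b) μt :=
  (integrable_comp_fst hext (htilt b).1).sub
    (integrable_and_integral_abs_grad_dirichletPart_le hd ha hϱ hG hext Λ b).1

theorem integral_abs_harmonicPart_le (hd : 1 ≤ d) (ha : 0 < a)
    (hϱ : ϱ (Set.Icc a c)ᶜ = 0) (hG : IsGradientGibbs ϱ μ) (hinv : IsTranslationInvariant μ)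
    (htilt : HasZeroTilt μ) (hext : IsExtension ϱ μ μt) (Λ : Finset (Lattice d)) (b : Edge d) :
    ∫ ω, |harmonicPart Λ ω.2 ω.1 b| ∂μt ≤ edgeBound μ a := by
  obtain ⟨hi, hb⟩ := integrable_and_integral_abs_grad_dirichletPart_le hd ha hϱ hG hext Λ b
  have hi1 : Integrable (fun ω : (Edge d → ℝ) × (Edge d → ℝ) => |ω.1 b|) μt :=
    (integrable_comp_fst hext (htilt b).1).abs
  calc ∫ ω, |harmonicPart Λ ω.2 ω.1 b| ∂μt
      ≤ ∫ ω, (|ω.1 b| + |grad (dirichletPart Λ ω.2 ω.1) b|) ∂μt :=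
        integral_mono (integrable_harmonicPart hd ha hϱ hG htilt hext Λ b).abs (hi1.add hi.abs)
          fun ω => abs_sub _ _
    _ = ∫ η, |η b| ∂μ + ∫ ω, |grad (dirichletPart Λ ω.2 ω.1) b| ∂μt := by
        rw [integral_add hi1 hi.abs, integral_comp_fst hext (f := fun η => |η b|) (htilt b).1.abs.1]
    _ ≤ edgeBound μ a := by
        rw [integral_abs_edge hG.1 hinv]
        refine add_le_add ?_ hb
        exact Finset.single_le_sum (f := fun i => meanAbs μ (unitVec i))
          (fun _ _ => meanAbs_nonneg _) (Finset.mem_univ b.2)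

/-- The field of the harmonic part. -/
noncomputable def harmonicField (Λ : Finset (Lattice d)) (ω : (Edge d → ℝ) × (Edge d → ℝ))
    (x : Lattice d) : ℝ := field ω.1 x - dirichletPart Λ ω.2 ω.1 x

theorem grad_harmonicField {Λ : Finset (Lattice d)} {ω : (Edge d → ℝ) × (Edge d → ℝ)}
    (h : LoopCondition ω.1) : grad (harmonicField Λ ω) = harmonicPart Λ ω.2 ω.1 := by
  unfold harmonicField
  rw [grad_sub, grad_field h]; rfl

theorem integrable_and_integral_abs_harmonicField_le (hd : 1 ≤ d) (ha : 0 < a)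
    (hϱ : ϱ (Set.Icc a c)ᶜ = 0) (hG : IsGradientGibbs ϱ μ)
    (htilt : HasZeroTilt μ) (hext : IsExtension ϱ μ μt) (Λ : Finset (Lattice d)) (x : Lattice d)
    (i : Fin d) (N : ℕ) (hN : x + N • unitVec i ∉ Λ) :
    Integrable (fun ω => harmonicField Λ ω x) μt ∧
      ∫ ω, |harmonicField Λ ω x| ∂μt ≤ meanAbs μ x + √(N * a⁻¹) * normalAbs := by
  obtain ⟨hi, hb⟩ := integrable_and_integral_abs_dirichletPart_le hd ha hϱ hG hext Λ x i N hN
  have hf := integrable_field hG.1 htilt x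
  have hi1 : Integrable (fun ω : (Edge d → ℝ) × (Edge d → ℝ) => field ω.1 x) μt :=
    integrable_comp_fst hext hf
  have hi2 : Integrable (fun ω => harmonicField Λ ω x) μt := hi1.sub hi
  refine ⟨hi2, ?_⟩
  calc ∫ ω, |harmonicField Λ ω x| ∂μt
      ≤ ∫ ω, (|field ω.1 x| + |dirichletPart Λ ω.2 ω.1 x|) ∂μt :=
        integral_mono hi2.abs (hi1.abs.add hi.abs) fun ω => abs_sub _ _
    _ = meanAbs μ x + ∫ ω, |dirichletPart Λ ω.2 ω.1 x| ∂μt := by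
        rw [integral_add hi1.abs hi.abs, integral_comp_fst hext (f := fun η => |field η x|) hf.abs.1,
          meanAbs]
    _ ≤ _ := by linarith

end Moments

end GradientGibbs

namespace GradientGibbs
open MeasureTheory ProbabilityTheory Filter Topology
open scoped ENNReal

variable {d : ℕ}

/-! ### The harmonic part in a large box vanishes on average -/

/-- The sup norm on the lattice. -/
def supNorm (x : Lattice d) : ℕ := Finset.univ.sup fun i => (x i).natAbs

/-- The box `{-n, …, n}^d`. -/
noncomputable def box (d n : ℕ) : Finset (Lattice d) :=
  Fintype.piFinset fun _ => Finset.Icc (-(n : ℤ)) n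

theorem supNorm_le {x : Lattice d} {n : ℕ} : supNorm x ≤ n ↔ ∀ i, (x i).natAbs ≤ n := by
  simp [supNorm]

theorem mem_box {n : ℕ} {x : Lattice d} : x ∈ box d n ↔ supNorm x ≤ n := by
  rw [supNorm_le]
  simp only [box, Fintype.mem_piFinset, Finset.mem_Icc]
  exact forall_congr' fun i => by omega

theorem card_box (n : ℕ) : (box d n).card = (2 * n + 1) ^ d := by
  simp only [box, Fintype.card_piFinset, Int.card_Icc, Finset.prod_const, Finset.card_univ,
    Fintype.card_fin]
  congr 1
  omega

theorem supNorm_add_le (x y : Lattice d) : supNorm (x + y) ≤ supNorm x + supNorm y := by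
  rw [supNorm_le]
  intro i
  have h1 := supNorm_le.1 (le_refl (supNorm x)) i
  have h2 := supNorm_le.1 (le_refl (supNorm y)) i
  simp only [Pi.add_apply]
  omega

theorem supNorm_neg (x : Lattice d) : supNorm (-x) = supNorm x := by simp [supNorm]

theorem supNorm_unitVec_le (i : Fin d) : supNorm (unitVec i) ≤ 1 := by
  rw [supNorm_le]
  intro j
  rw [unitVec_apply]
  split_ifs <;> simp

theorem add_smul_unitVec_notMem_box {n : ℕ} {x : Lattice d} {m : ℕ} (hx : supNorm x ≤ m)
    (i : Fin d) : x + (n + m + 1) • unitVec i ∉ box d n := by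
  rw [mem_box, supNorm_le]
  intro h
  have h1 := h i
  have h2 := supNorm_le.1 hx i
  simp only [Pi.add_apply, Pi.smul_apply, unitVec_apply, if_true] at h1
  simp only [nsmul_eq_mul, mul_one] at h1
  omega

theorem card_touching_le (Λ : Finset (Lattice d)) : (touching Λ).card ≤ 2 * d * Λ.card := by
  unfold touching
  refine (Finset.card_union_le _ _).trans ?_
  have h1 := Finset.card_image_le (s := Λ ×ˢ (Finset.univ : Finset (Fin d)))
    (f := fun b => ((b.1 - unitVec b.2, b.2) : Edge d))
  rw [Finset.card_product, Finset.card_univ, Fintype.card_fin] at *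
  nlinarith

/-- The cutoff function `(n + 1 - |x|)₊`. -/
def cutoff (n : ℕ) (x : Lattice d) : ℝ := ((n + 1 - supNorm x : ℕ) : ℝ)

theorem abs_grad_cutoff_le (n : ℕ) (b : Edge d) : |grad (cutoff n) b| ≤ 1 := by
  have h1 := supNorm_add_le b.1 (unitVec b.2)
  have h2 := supNorm_add_le (b.1 + unitVec b.2) (-unitVec b.2)
  rw [supNorm_neg, add_neg_cancel_right] at h2
  have h3 := supNorm_unitVec_le b.2
  have h4 : n + 1 - supNorm (b.1 + unitVec b.2) ≤ (n + 1 - supNorm b.1) + 1 := by omega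
  have h5 : n + 1 - supNorm b.1 ≤ (n + 1 - supNorm (b.1 + unitVec b.2)) + 1 := by omega
  have h6 : ((n + 1 - supNorm (b.1 + unitVec b.2) : ℕ) : ℝ) ≤ (n + 1 - supNorm b.1 : ℕ) + 1 := by
    exact_mod_cast h4
  have h7 : ((n + 1 - supNorm b.1 : ℕ) : ℝ) ≤ (n + 1 - supNorm (b.1 + unitVec b.2) : ℕ) + 1 := by
    exact_mod_cast h5
  simp only [grad, cutoff]
  rw [abs_le]
  constructor <;> linarith

/-- The cutoff of the box of size `2m` has slope at most one and is at least `m + 1` on the box of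
size `m`; this gains the factor `1 / (m + 1)`. -/
theorem sum_sq_grad_clamp_le {κ : Edge d → ℝ} {a c K : ℝ} (ha : 0 < a) (hK : 0 ≤ K) (m : ℕ)
    (hκ : ∀ b, κ b ∈ Set.Icc a c) {u : Lattice d → ℝ}
    (hu : ∀ x ∈ box d (2 * m), diverg (fun b => κ b * grad u b) x = 0) :
    ∑ b ∈ box d m ×ˢ Finset.univ, grad (fun x => max (-K) (min K (u x))) b ^ 2 ≤
      c * K / (a * (m + 1)) * ∑ b ∈ touching (box d (2 * m)), |grad u b| := by
  have h := sum_cutoff_mul_sq_grad_clamp_le (Λ := box d (2 * m)) (χ := cutoff (2 * m)) ha.le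
    (fun b _ => hκ b) hK hu (fun x => Nat.cast_nonneg _) (fun x hx => by
      rw [mem_box] at hx
      simp only [cutoff, Nat.cast_eq_zero]
      omega) (abs_grad_cutoff_le _)
  have hsub : box d m ×ˢ Finset.univ ⊆ touching (box d (2 * m)) := by
    intro b hb
    rw [Finset.mem_product, mem_box] at hb
    exact mem_touching.2 (Or.inl (mem_box.2 (by omega)))
  have hlow : (m + 1 : ℝ) * ∑ b ∈ box d m ×ˢ Finset.univ,
      grad (fun x => max (-K) (min K (u x))) b ^ 2 ≤
      ∑ b ∈ touching (box d (2 * m)), cutoff (2 * m) b.1 *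
        grad (fun x => max (-K) (min K (u x))) b ^ 2 := by
    rw [Finset.mul_sum]
    refine (Finset.sum_le_sum fun b hb => mul_le_mul_of_nonneg_right ?_ (sq_nonneg _)).trans
      (Finset.sum_le_sum_of_subset_of_nonneg hsub fun b _ _ =>
        mul_nonneg (Nat.cast_nonneg _) (sq_nonneg _))
    rw [Finset.mem_product, mem_box] at hb
    have : m + 1 ≤ 2 * m + 1 - supNorm b.1 := by omega
    simp only [cutoff]
    exact_mod_cast this
  have hpos : (0 : ℝ) < a * (m + 1) := by positivity
  rw [div_mul_eq_mul_div, le_div_iff₀ hpos]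
  nlinarith [mul_le_mul_of_nonneg_left hlow ha.le]

/-- If both values are below `K` the truncation is inactive and the arithmetic-geometric mean
inequality with parameter `s` applies; otherwise the last term already exceeds one, by Markov. -/
theorem min_one_abs_le {s K x y : ℝ} (hs : 0 < s) (hK : 0 < K) :
    min 1 |y - x| ≤ s + (4 * s)⁻¹ * (max (-K) (min K y) - max (-K) (min K x)) ^ 2 +
      K⁻¹ * (|x| + |y|) := by
  have hsq : ∀ r : ℝ, |r| ≤ s + (4 * s)⁻¹ * r ^ 2 := by
    intro r
    have h1 : s + (4 * s)⁻¹ * r ^ 2 - |r| = (4 * s)⁻¹ * (2 * s - |r|) ^ 2 := by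
      field_simp
      rw [← sq_abs r]
      ring
    have h2 : 0 ≤ (4 * s)⁻¹ * (2 * s - |r|) ^ 2 := by positivity
    linarith
  by_cases hx : |x| ≤ K
  · by_cases hy : |y| ≤ K
    · rw [abs_le] at hx hy
      rw [min_eq_right hy.2, max_eq_right hy.1, min_eq_right hx.2, max_eq_right hx.1]
      have h3 : 0 ≤ K⁻¹ * (|x| + |y|) := by positivity
      exact (min_le_right _ _).trans ((hsq _).trans (by linarith))
    · push Not at hy
      have h1 : 1 ≤ K⁻¹ * (|x| + |y|) := by
        rw [← div_eq_inv_mul, one_le_div hK]; linarith [abs_nonneg x]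
      have h2 : 0 ≤ (4 * s)⁻¹ * (max (-K) (min K y) - max (-K) (min K x)) ^ 2 := by positivity
      exact (min_le_left _ _).trans (by linarith)
  · push Not at hx
    have h1 : 1 ≤ K⁻¹ * (|x| + |y|) := by
      rw [← div_eq_inv_mul, one_le_div hK]; linarith [abs_nonneg y]
    have h2 : 0 ≤ (4 * s)⁻¹ * (max (-K) (min K y) - max (-K) (min K x)) ^ 2 := by positivity
    exact (min_le_left _ _).trans (by linarith)

section Averaging

variable {ϱ : Measure ℝ} [IsFiniteMeasure ϱ] {a c : ℝ} {μ : Measure (Edge d → ℝ)}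
  [IsProbabilityMeasure μ] {μt : Measure ((Edge d → ℝ) × (Edge d → ℝ))} [IsProbabilityMeasure μt]

theorem integrable_min_one_abs {f : ((Edge d → ℝ) × (Edge d → ℝ)) → ℝ} (hf : Measurable f) :
    Integrable (fun ω => min 1 |f ω|) μt := by
  refine Integrable.of_bound (C := 1) (by fun_prop) (Eventually.of_forall fun ω => ?_)
  rw [Real.norm_eq_abs, abs_of_nonneg (le_min zero_le_one (abs_nonneg _))]
  exact min_le_left _ _

theorem measurable_harmonicPart_pair (Λ : Finset (Lattice d)) (b : Edge d) :
    Measurable fun ω : (Edge d → ℝ) × (Edge d → ℝ) => harmonicPart Λ ω.2 ω.1 b :=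
  measurable_harmonicPart Λ measurable_snd measurable_fst b

/-- Expectation of `min_one_abs_le` summed over the inner box. `D` controls the untruncated part,
while the truncated energy is controlled by the edge moments in the outer box. -/
theorem sum_integral_min_one_harmonicPart_le (hd : 1 ≤ d) (ha : 0 < a) (hac : a ≤ c)
    (hϱ : ϱ (Set.Icc a c)ᶜ = 0) (hG : IsGradientGibbs ϱ μ) (hinv : IsTranslationInvariant μ)
    (htilt : HasZeroTilt μ) (hext : IsExtension ϱ μ μt) (m : ℕ) {s K D : ℝ} (hs : 0 < s)
    (hK : 0 < K) (hD : ∀ x : Lattice d, supNorm x ≤ m + 1 →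
      ∫ ω, |harmonicField (box d (2 * m)) ω x| ∂μt ≤ D) :
    ∑ b ∈ box d m ×ˢ Finset.univ, ∫ ω, min 1 |harmonicPart (box d (2 * m)) ω.2 ω.1 b| ∂μt ≤
      (d * (2 * m + 1) ^ d : ℕ) * (s + K⁻¹ * (2 * D)) +
        (4 * s)⁻¹ * (c * K / (a * (m + 1)) * ((2 * d * (4 * m + 1) ^ d : ℕ) * edgeBound μ a)) := by
  set Λ := box d (2 * m) with hΛ
  set I : Finset (Edge d) := box d m ×ˢ Finset.univ with hI
  have hmH := measurable_harmonicPart_pair (d := d) Λ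
  have hHi := integrable_harmonicPart hd ha hϱ hG htilt hext Λ
  have hui : ∀ x, Integrable (fun ω => harmonicField Λ ω x) μt := by
    intro x
    obtain ⟨N, hN⟩ := exists_add_smul_notMem Λ x ⟨0, hd⟩
    exact (integrable_and_integral_abs_harmonicField_le hd ha hϱ hG htilt hext Λ x _ N hN).1
  have hIi : Integrable (fun ω => ∑ b ∈ I, min 1 |harmonicPart Λ ω.2 ω.1 b|) μt :=
    integrable_finsetSum _ fun b _ => integrable_min_one_abs (hmH b)
  have hTi : Integrable (fun ω => ∑ b ∈ touching Λ, |harmonicPart Λ ω.2 ω.1 b|) μt :=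
    integrable_finsetSum _ fun b _ => (hHi b).abs
  have hUi : Integrable (fun ω => ∑ b ∈ I,
      (|harmonicField Λ ω b.1| + |harmonicField Λ ω (b.1 + unitVec b.2)|)) μt :=
    integrable_finsetSum _ fun b _ => (hui _).abs.add (hui _).abs
  have hcardI : I.card = d * (2 * m + 1) ^ d := by
    rw [hI, Finset.card_product, card_box, Finset.card_univ, Fintype.card_fin, mul_comm]
  rw [← integral_finsetSum _ fun b _ => integrable_min_one_abs (hmH b)]
  set B := c * K / (a * (m + 1)) with hB
  have hB0 : 0 ≤ B := by
    have := ha.trans_le hac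
    positivity
  have hpt : ∀ᵐ ω ∂μt, ∑ b ∈ I, min 1 |harmonicPart Λ ω.2 ω.1 b| ≤
      (I.card * s + (4 * s)⁻¹ * (B * ∑ b ∈ touching Λ, |harmonicPart Λ ω.2 ω.1 b|)) +
        K⁻¹ * ∑ b ∈ I, (|harmonicField Λ ω b.1| + |harmonicField Λ ω (b.1 + unitVec b.2)|) := by
    filter_upwards [ae_fst hext hG.1, ae_mem_of_extension hext measurableSet_Icc hϱ] with ω h1 h2
    have hg := grad_harmonicField (Λ := Λ) h1
    have hE := sum_sq_grad_clamp_le (u := harmonicField Λ ω) ha hK.le m h2 (fun x hx => by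
      rw [hg]
      exact diverg_harmonicPart hd (fun b _ => ha.trans_le (h2 b).1) ω.1 hx)
    rw [hg] at hE
    calc ∑ b ∈ I, min 1 |harmonicPart Λ ω.2 ω.1 b|
        ≤ ∑ b ∈ I, (s + (4 * s)⁻¹ *
            grad (fun x => max (-K) (min K (harmonicField Λ ω x))) b ^ 2 +
            K⁻¹ * (|harmonicField Λ ω b.1| + |harmonicField Λ ω (b.1 + unitVec b.2)|)) := by
          refine Finset.sum_le_sum fun b _ => ?_
          rw [← hg]
          exact min_one_abs_le hs hK
      _ = (I.card * s + (4 * s)⁻¹ * ∑ b ∈ I,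
            grad (fun x => max (-K) (min K (harmonicField Λ ω x))) b ^ 2) +
            K⁻¹ * ∑ b ∈ I, (|harmonicField Λ ω b.1| + |harmonicField Λ ω (b.1 + unitVec b.2)|) := by
          rw [Finset.sum_add_distrib, Finset.sum_add_distrib, Finset.sum_const, nsmul_eq_mul,
            Finset.mul_sum, Finset.mul_sum]
      _ ≤ _ := by
          have := mul_le_mul_of_nonneg_left hE (by positivity : 0 ≤ (4 * s)⁻¹)
          linarith
  have hr1 : Integrable (fun ω => (I.card : ℝ) * s + (4 * s)⁻¹ *
      (B * ∑ b ∈ touching Λ, |harmonicPart Λ ω.2 ω.1 b|)) μt :=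
    (integrable_const _).add ((hTi.const_mul _).const_mul _)
  have hr2 : Integrable (fun ω => (4 * s)⁻¹ *
      (B * ∑ b ∈ touching Λ, |harmonicPart Λ ω.2 ω.1 b|)) μt := (hTi.const_mul _).const_mul _
  have hr3 : Integrable (fun ω => K⁻¹ * ∑ b ∈ I,
      (|harmonicField Λ ω b.1| + |harmonicField Λ ω (b.1 + unitVec b.2)|)) μt := hUi.const_mul _
  have hr4 : ∀ b ∈ I, Integrable (fun ω =>
      |harmonicField Λ ω b.1| + |harmonicField Λ ω (b.1 + unitVec b.2)|) μt :=
    fun b _ => (hui _).abs.add (hui _).abs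
  refine (integral_mono_ae hIi (by exact hr1.add hr3) hpt).trans ?_
  rw [integral_add hr1 hr3, integral_add (integrable_const _) hr2, integral_const,
    integral_const_mul, integral_const_mul, integral_const_mul,
    integral_finsetSum _ (fun b _ => (hHi b).abs), integral_finsetSum _ hr4]
  have hsum1 : ∑ b ∈ touching Λ, ∫ ω, |harmonicPart Λ ω.2 ω.1 b| ∂μt ≤
      (2 * d * (4 * m + 1) ^ d : ℕ) * edgeBound μ a := by
    refine (Finset.sum_le_card_nsmul _ _ (edgeBound μ a) fun b _ =>
      integral_abs_harmonicPart_le hd ha hϱ hG hinv htilt hext Λ b).trans ?_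
    rw [nsmul_eq_mul]
    refine mul_le_mul_of_nonneg_right ?_ edgeBound_nonneg
    have := card_touching_le Λ
    rw [hΛ, card_box, show 2 * (2 * m) + 1 = 4 * m + 1 by ring] at this
    exact_mod_cast this
  have hsum2 : ∑ b ∈ I, ∫ ω,
      (|harmonicField Λ ω b.1| + |harmonicField Λ ω (b.1 + unitVec b.2)|) ∂μt ≤
      I.card * (2 * D) := by
    rw [← nsmul_eq_mul]
    refine Finset.sum_le_card_nsmul _ _ _ fun b hb => ?_
    rw [hI, Finset.mem_product, mem_box] at hb
    rw [integral_add (hui _).abs (hui _).abs]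
    have h1 := hD b.1 (by omega)
    have h2 := hD (b.1 + unitVec b.2) (by
      have := supNorm_add_le b.1 (unitVec b.2)
      have := supNorm_unitVec_le b.2
      omega)
    linarith
  have e1 := mul_le_mul_of_nonneg_left (mul_le_mul_of_nonneg_left hsum1 hB0)
    (by positivity : 0 ≤ (4 * s)⁻¹)
  have e2 := mul_le_mul_of_nonneg_left hsum2 (inv_pos.2 hK).le
  rw [hcardI] at e2 ⊢
  simp only [probReal_univ, one_smul]
  rw [mul_add]
  linarith

end Averaging

end GradientGibbs

namespace GradientGibbs
open MeasureTheory ProbabilityTheory Filter Topology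
open scoped ENNReal

variable {d : ℕ}

/-! ### Choice of volumes in which the harmonic part is small -/

theorem box_mono {m n : ℕ} (h : m ≤ n) : box d m ⊆ box d n := fun x hx => by
  rw [mem_box] at hx ⊢
  exact hx.trans h

theorem exists_subset_box (s : Finset (Lattice d)) : ∃ n, s ⊆ box d n :=
  ⟨s.sup supNorm, fun _ hx => mem_box.2 (Finset.le_sup (f := supNorm) hx)⟩

theorem min_one_abs_sum_le {ι : Type*} (s : Finset ι) (t h : ι → ℝ) :
    min 1 |∑ b ∈ s, t b * h b| ≤ ∑ b ∈ s, (1 + |t b|) * min 1 |h b| := by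
  classical
  have hnn : ∀ x : ℝ, 0 ≤ min 1 |x| := fun x => le_min zero_le_one (abs_nonneg _)
  by_cases H : ∀ b ∈ s, |h b| ≤ 1
  · refine (min_le_right _ _).trans ((Finset.abs_sum_le_sum_abs _ _).trans
      (Finset.sum_le_sum fun b hb => ?_))
    rw [min_eq_right (H b hb), abs_mul]
    nlinarith [abs_nonneg (h b), abs_nonneg (t b)]
  · push Not at H
    obtain ⟨b, hb, hb1⟩ := H
    refine (min_le_left _ _).trans (le_trans ?_ (Finset.single_le_sum
      (f := fun b => (1 + |t b|) * min 1 |h b|)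
      (fun i _ => mul_nonneg (by positivity) (hnn _)) hb))
    rw [min_eq_left hb1.le]
    linarith [abs_nonneg (t b)]

section Averaging

variable {ϱ : Measure ℝ} [IsFiniteMeasure ϱ] {a c : ℝ} {μ : Measure (Edge d → ℝ)}
  [IsProbabilityMeasure μ] {μt : Measure ((Edge d → ℝ) × (Edge d → ℝ))} [IsProbabilityMeasure μt]

theorem eventually_integral_abs_harmonicField_le (hd : 1 ≤ d) (ha : 0 < a)
    (hϱ : ϱ (Set.Icc a c)ᶜ = 0) (hG : IsGradientGibbs ϱ μ) (hinv : IsTranslationInvariant μ)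
    (herg : IsErgodic μ) (htilt : HasZeroTilt μ) (hext : IsExtension ϱ μ μt) {ε : ℝ}
    (hε : 0 < ε) :
    ∀ᶠ m : ℕ in atTop, ∀ x : Lattice d, supNorm x ≤ m + 1 →
      ∫ ω, |harmonicField (box d (2 * m)) ω x| ∂μt ≤ 2 * ε * (m + 1) := by
  have h1 := (tendsto_add_atTop_nat 1).eventually (eventually_meanAbs_le hG.1 hinv herg htilt hε)
  have h2 : ∀ᶠ m : ℕ in atTop, 3 * a⁻¹ * normalAbs ^ 2 / ε ^ 2 ≤ m :=
    (tendsto_natCast_atTop_atTop (R := ℝ)).eventually_ge_atTop _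
  filter_upwards [h1, h2] with m hm1 hm2 x hx
  refine (integrable_and_integral_abs_harmonicField_le hd ha hϱ hG htilt hext _ x ⟨0, hd⟩ _
    (add_smul_unitVec_notMem_box hx _)).2.trans ?_
  have e1 := hm1 x (supNorm_le.1 hx)
  have hq : (0 : ℝ) < m + 1 := by positivity
  -- The Dirichlet part contributes only order `√m`: a point of norm at most `m + 1` leaves the box
  -- of size `2m` within `3m + 2` steps.
  have e2 : √((2 * m + (m + 1) + 1 : ℕ) * a⁻¹) * normalAbs ≤ ε * (m + 1) := by
    refine abs_le_of_sq_le_sq' ?_ (by positivity) |>.2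
    rw [mul_pow, Real.sq_sqrt (by positivity)]
    rw [div_le_iff₀ (by positivity)] at hm2
    push_cast
    calc (2 * (m : ℝ) + (m + 1) + 1) * a⁻¹ * normalAbs ^ 2
        ≤ (3 * (m + 1)) * a⁻¹ * normalAbs ^ 2 := by gcongr; linarith
      _ = (3 * a⁻¹ * normalAbs ^ 2) * (m + 1) := by ring
      _ ≤ (m * ε ^ 2) * (m + 1) := by gcongr
      _ ≤ (ε * (m + 1)) ^ 2 := by nlinarith [sq_nonneg ε, mul_pos (pow_pos hε 2) hq]
  push_cast at e1 e2 ⊢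
  linarith

theorem eventually_sum_integral_min_one_harmonicPart_le (hd : 1 ≤ d) (ha : 0 < a) (hac : a ≤ c)
    (hϱ : ϱ (Set.Icc a c)ᶜ = 0) (hG : IsGradientGibbs ϱ μ) (hinv : IsTranslationInvariant μ)
    (herg : IsErgodic μ) (htilt : HasZeroTilt μ) (hext : IsExtension ϱ μ μt) {ε : ℝ}
    (hε : 0 < ε) :
    ∀ᶠ m : ℕ in atTop, ∑ b ∈ box d m ×ˢ Finset.univ,
      ∫ ω, min 1 |harmonicPart (box d (2 * m)) ω.2 ω.1 b| ∂μt ≤ ε * (m + 1) ^ d := by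
  have hc := ha.trans_le hac
  set C₁ : ℝ := d * 2 ^ d with hC₁
  set C₂ : ℝ := c / a * (2 * d * 4 ^ d * edgeBound μ a) / 4 with hC₂
  have hd' : (0 : ℝ) < d := by exact_mod_cast hd
  have hC₁0 : 0 < C₁ := by positivity
  have hC₂0 : 0 ≤ C₂ := by
    have := edgeBound_nonneg (μ := μ) (a := a)
    positivity
  -- The three errors, `C₁ s`, `4 C₁ ε' / δ` and `C₂ δ / s`, are each at most `ε / 3`. They force
  -- the order of choice `s`, `δ`, `ε'`; the truncation level is `δ (m + 1)` and the mean bound is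
  -- `2 ε' (m + 1)`.
  set s := ε / (3 * C₁) with hs
  have hs0 : 0 < s := by positivity
  set δ := s * ε / (3 * (C₂ + 1)) with hδ
  have hδ0 : 0 < δ := by positivity
  set ε' := δ * ε / (12 * C₁) with hε'
  have hε'0 : 0 < ε' := by positivity
  filter_upwards [eventually_integral_abs_harmonicField_le hd ha hϱ hG hinv herg htilt hext hε'0]
    with m hm
  have hq : (0 : ℝ) < m + 1 := by positivity
  refine (sum_integral_min_one_harmonicPart_le hd ha hac hϱ hG hinv htilt hext m hs0
    (mul_pos hδ0 hq) hm).trans ?_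
  have k1 : ((d * (2 * m + 1) ^ d : ℕ) : ℝ) ≤ C₁ * (m + 1) ^ d := by
    push_cast
    rw [hC₁, mul_assoc, ← mul_pow]
    gcongr
    linarith
  have k2 : ((2 * d * (4 * m + 1) ^ d : ℕ) : ℝ) ≤ 2 * d * 4 ^ d * (m + 1) ^ d := by
    push_cast
    rw [mul_assoc (2 * (d : ℝ)), ← mul_pow]
    gcongr
    linarith
  have f1 : s + (δ * (m + 1))⁻¹ * (2 * (2 * ε' * (m + 1))) = s + 4 * ε' / δ := by
    field_simp; ring
  have f2 : c * (δ * (m + 1)) / (a * (m + 1)) = c / a * δ := by field_simp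
  rw [f1, f2]
  calc _ ≤ C₁ * (m + 1) ^ d * (s + 4 * ε' / δ) + (4 * s)⁻¹ *
        (c / a * δ * (2 * d * 4 ^ d * (m + 1) ^ d * edgeBound μ a)) := by
        have := edgeBound_nonneg (μ := μ) (a := a)
        gcongr
    _ = (C₁ * s + 4 * C₁ * ε' / δ + C₂ * (δ / s)) * (m + 1) ^ d := by
        rw [hC₂]; field_simp
    _ ≤ ε * (m + 1) ^ d := by
        gcongr
        have g1 : C₁ * s = ε / 3 := by rw [hs]; field_simp
        have g2 : 4 * C₁ * ε' / δ = ε / 3 := by rw [hε']; field_simp; norm_num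
        have g3 : C₂ * (δ / s) ≤ ε / 3 := by
          have : δ / s = ε / (3 * (C₂ + 1)) := by rw [hδ]; field_simp
          rw [this, mul_div_assoc', div_le_div_iff₀ (by positivity) (by positivity)]
          nlinarith
        linarith

/-- Translation invariance moves the harmonic part to a shifted volume. -/
theorem integral_min_one_flowPair_translate (hd : 1 ≤ d) (ha : 0 < a)
    (hϱ : ϱ (Set.Icc a c)ᶜ = 0) (hinv : IsTranslationInvariant μ) (hext : IsExtension ϱ μ μt)
    (θ : Edge d →₀ ℝ) {Λ Λ' : Finset (Lattice d)} (y : Lattice d)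
    (hΛ : ∀ z, z + y ∈ Λ' ↔ z ∈ Λ) :
    ∫ ω, min 1 |flowPair θ (harmonicPart Λ ω.2 ω.1)| ∂μt ≤
      ∑ b ∈ θ.support, (1 + |θ b|) *
        ∫ ω, min 1 |harmonicPart Λ' ω.2 ω.1 (b.1 + y, b.2)| ∂μt := by
  have hmτ : Measurable (Prod.map (translate y) (translate y) :
      (Edge d → ℝ) × (Edge d → ℝ) → _) := (measurable_translate y).prodMap (measurable_translate y)
  have hmf : Measurable fun ω : (Edge d → ℝ) × (Edge d → ℝ) =>
      min 1 |flowPair θ (harmonicPart Λ ω.2 ω.1)| := by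
    have h := measurable_harmonicPart_pair (d := d) Λ
    unfold flowPair Finsupp.sum
    fun_prop
  conv_lhs => rw [← map_translate_extension hinv hext y]
  rw [integral_map hmτ.aemeasurable hmf.aestronglyMeasurable]
  simp only [Prod.map_fst, Prod.map_snd]
  have hi : ∀ b ∈ θ.support, Integrable (fun ω => (1 + |θ b|) *
      min 1 |harmonicPart Λ' ω.2 ω.1 (b.1 + y, b.2)|) μt := fun b _ =>
    (integrable_min_one_abs (measurable_harmonicPart_pair Λ' _)).const_mul _
  simp_rw [← integral_const_mul]
  rw [← integral_finsetSum _ hi]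
  refine integral_mono_ae ?_ (integrable_finsetSum _ hi) ?_
  · refine Integrable.of_bound (C := 1) (hmf.comp hmτ).aestronglyMeasurable
      (Eventually.of_forall fun ω => ?_)
    rw [Real.norm_eq_abs, abs_of_nonneg (le_min zero_le_one (abs_nonneg _))]
    exact min_le_left _ _
  · filter_upwards [ae_mem_of_extension hext measurableSet_Icc hϱ] with ω hω
    rw [← harmonicPart_translate hd y hΛ (fun b => ha.trans_le (hω b).1)]
    exact min_one_abs_sum_le _ _ _

/-- Smallness is known only on average over edges of a box. Averaging over shifts `y` instead moves
the fixed flow `θ` through that box, so some shift does no worse than the average; moving back by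
`y` shifts the volume. -/
theorem eventually_exists_volume (hd : 1 ≤ d) (ha : 0 < a) (hac : a ≤ c)
    (hϱ : ϱ (Set.Icc a c)ᶜ = 0) (hG : IsGradientGibbs ϱ μ) (hinv : IsTranslationInvariant μ)
    (herg : IsErgodic μ) (htilt : HasZeroTilt μ) (hext : IsExtension ϱ μ μt)
    (θ : Edge d →₀ ℝ) {ε : ℝ} (hε : 0 < ε) :
    ∀ᶠ m : ℕ in atTop, ∃ Λ : Finset (Lattice d), box d m ⊆ Λ ∧
      ∫ ω, min 1 |flowPair θ (harmonicPart Λ ω.2 ω.1)| ∂μt ≤ ε := by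
  classical
  obtain ⟨R, hR⟩ := exists_subset_box (θ.support.image Prod.fst)
  set C : ℝ := ∑ b ∈ θ.support, (1 + |θ b|) with hC
  have hC0 : 0 ≤ C := Finset.sum_nonneg fun b _ => by positivity
  filter_upwards [eventually_sum_integral_min_one_harmonicPart_le hd ha hac hϱ hG hinv herg htilt
    hext (ε := ε / (C + 1)) (by positivity), eventually_ge_atTop (2 * R)] with m hm hmR
  set J := fun b : Edge d => ∫ ω, min 1 |harmonicPart (box d (2 * m)) ω.2 ω.1 b| ∂μt with hJ
  have hJ0 : ∀ b, 0 ≤ J b := fun b => integral_nonneg fun ω => le_min zero_le_one (abs_nonneg _)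
  -- Shifts of size at most `m - R` keep the support of `θ` in the box of size `m`; the number of
  -- shifts is comparable to `(m + 1)^d` because `m ≥ 2R`.
  have hsum : ∑ y ∈ box d (m - R), ∑ b ∈ θ.support, (1 + |θ b|) * J (b.1 + y, b.2) ≤
      ∑ _y ∈ box d (m - R), ε := by
    rw [Finset.sum_comm, Finset.sum_const, card_box, nsmul_eq_mul]
    have h1 : ∀ b ∈ θ.support, ∑ y ∈ box d (m - R), J (b.1 + y, b.2) ≤
        ε / (C + 1) * (m + 1) ^ d := by
      intro b hb
      refine le_trans ?_ hm
      rw [← Finset.sum_image (f := J) (s := box d (m - R)) (g := fun y => (b.1 + y, b.2))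
        (fun y _ z _ h => by simpa using h)]
      refine Finset.sum_le_sum_of_subset_of_nonneg ?_ fun b _ _ => hJ0 b
      intro e he
      obtain ⟨y, hy, rfl⟩ := Finset.mem_image.1 he
      have h2 := mem_box.1 (hR (Finset.mem_image_of_mem Prod.fst hb))
      have h3 := mem_box.1 hy
      have h4 := supNorm_add_le b.1 y
      simp only [Finset.mem_product, Finset.mem_univ, and_true, mem_box]
      omega
    calc ∑ b ∈ θ.support, ∑ y ∈ box d (m - R), (1 + |θ b|) * J (b.1 + y, b.2)
        ≤ ∑ b ∈ θ.support, (1 + |θ b|) * (ε / (C + 1) * (m + 1) ^ d) := by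
          refine Finset.sum_le_sum fun b hb => ?_
          rw [← Finset.mul_sum]
          exact mul_le_mul_of_nonneg_left (h1 b hb) (by positivity)
      _ = C / (C + 1) * (ε * (m + 1) ^ d) := by rw [← Finset.sum_mul]; ring
      _ ≤ 1 * (ε * (m + 1) ^ d) := by
          gcongr
          rw [div_le_one (by positivity)]
          linarith
      _ ≤ _ := by
          rw [one_mul, mul_comm]
          gcongr
          push_cast
          gcongr
          have : m ≤ 2 * (m - R) := by omega
          exact_mod_cast this
  obtain ⟨y, hy, hy'⟩ := Finset.exists_le_of_sum_le
    ⟨0, mem_box.2 (by simp [supNorm])⟩ hsum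
  have hmem : ∀ z, z + y ∈ box d (2 * m) ↔ z ∈ (box d (2 * m)).image fun w => w - y := by
    intro z
    rw [Finset.mem_image]
    exact ⟨fun h => ⟨_, h, by simp⟩, fun ⟨w, hw, h⟩ => by rw [← h]; simpa using hw⟩
  -- Since `y` has norm at most `m`, the shifted box of size `2m` still contains the box of size
  -- `m`, so these volumes exhaust the lattice.
  refine ⟨(box d (2 * m)).image fun w => w - y, fun z hz => ?_,
    (integral_min_one_flowPair_translate hd ha hϱ hinv hext θ y hmem).trans hy'⟩
  rw [← hmem, mem_box]
  rw [mem_box] at hz hy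
  have := supNorm_add_le z y
  omega

/-- Along suitable volumes exhausting the lattice the harmonic part tends to zero in
probability, when tested against a fixed flow. -/
theorem exists_tendsto_integral_min_one_flowPair (hd : 1 ≤ d) (ha : 0 < a) (hac : a ≤ c)
    (hϱ : ϱ (Set.Icc a c)ᶜ = 0) (hG : IsGradientGibbs ϱ μ) (hinv : IsTranslationInvariant μ)
    (herg : IsErgodic μ) (htilt : HasZeroTilt μ) (hext : IsExtension ϱ μ μt)
    (θ : Edge d →₀ ℝ) :
    ∃ Λ : ℕ → Finset (Lattice d), Tendsto Λ atTop atTop ∧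
      Tendsto (fun n => ∫ ω, min 1 |flowPair θ (harmonicPart (Λ n) ω.2 ω.1)| ∂μt) atTop (𝓝 0) := by
  have h : ∀ n : ℕ, ∃ Λ : Finset (Lattice d), box d n ⊆ Λ ∧
      ∫ ω, min 1 |flowPair θ (harmonicPart Λ ω.2 ω.1)| ∂μt ≤ 1 / ((n : ℝ) + 1) := by
    intro n
    obtain ⟨m, ⟨Λ, h1, h2⟩, h3⟩ := ((eventually_exists_volume hd ha hac hϱ hG hinv herg htilt hext θ
      (Nat.one_div_pos_of_nat (n := n) (α := ℝ))).and (eventually_ge_atTop n)).exists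
    exact ⟨Λ, (box_mono h3).trans h1, h2⟩
  choose Λ hΛ hΛ' using h
  refine ⟨Λ, tendsto_atTop.2 fun s => ?_, squeeze_zero
    (fun n => integral_nonneg fun ω => le_min zero_le_one (abs_nonneg _)) hΛ'
    tendsto_one_div_add_atTop_nhds_zero_nat⟩
  obtain ⟨N, hN⟩ := exists_subset_box s
  filter_upwards [eventually_ge_atTop N] with n hn
  exact hN.trans ((box_mono hn).trans (hΛ n))

end Averaging

end GradientGibbs

namespace GradientGibbs
open MeasureTheory ProbabilityTheory Filter Topology
open scoped ENNReal

variable {d : ℕ}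

/-! ### The conditional characteristic function -/

theorem pair_field_eq {f : Lattice d →₀ ℝ} {θ : Edge d →₀ ℝ}
    (hθ : ∀ h : Lattice d → ℝ, flowPair θ (grad h) = pair f h) {Λ : Finset (Lattice d)}
    (hf : f.support ⊆ Λ) (k : Edge d → ℝ) {η : Edge d → ℝ} (hη : LoopCondition η) :
    pair f (field η) =
      flowPair θ (harmonicPart Λ k η) + ∑ x : Λ, f x * dirichletPart Λ k η x := by
  rw [← hθ, grad_field hη, Finset.sum_coe_sort Λ (fun x => f x * dirichletPart Λ k η x),
    ← pair_eq_sum hf, ← hθ]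
  conv_lhs => rw [show η = fun b => harmonicPart Λ k η b + grad (dirichletPart Λ k η) b by
    ext b; simp [harmonicPart]]
  exact flowPair_add_right _ _ _

theorem measurable_flowPair_harmonicPart (θ : Edge d →₀ ℝ) (Λ : Finset (Lattice d)) :
    Measurable fun ω : (Edge d → ℝ) × (Edge d → ℝ) => flowPair θ (harmonicPart Λ ω.2 ω.1) := by
  have h := measurable_harmonicPart_pair (d := d) Λ
  unfold flowPair Finsupp.sum
  fun_prop

theorem measurable_pair_field (f : Lattice d →₀ ℝ) :
    Measurable fun ω : (Edge d → ℝ) × (Edge d → ℝ) => pair f (field ω.1) :=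
  (continuous_pair f).measurable.comp (measurable_field.comp measurable_fst)

theorem integrable_cexp_ofReal_mul_I {α : Type*} [MeasurableSpace α] {ν : Measure α}
    [IsFiniteMeasure ν] {X : α → ℝ} (hX : Measurable X) :
    Integrable (fun a => Complex.exp (X a * Complex.I)) ν :=
  Integrable.of_bound (C := 1) (by fun_prop) (Eventually.of_forall fun a => by
    rw [Complex.norm_exp_ofReal_mul_I])

theorem integral_cexp_gaussianReal (r : ℝ) :
    ∫ t, Complex.exp ((r * t : ℝ) * Complex.I) ∂(gaussianReal 0 1) =
      Complex.exp (-(r ^ 2 / 2 : ℝ)) := by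
  have h := charFun_gaussianReal (μ := 0) (v := 1) r
  rw [charFun_apply_real] at h
  push_cast at h ⊢
  rw [h]
  congr 1
  simp

theorem norm_cexp_ofReal_mul_I_sub_one_le (x : ℝ) :
    ‖Complex.exp (x * Complex.I) - 1‖ ≤ 2 * min 1 |x| := by
  have h1 : ‖Complex.exp (x * Complex.I) - 1‖ ≤ |x| := by
    rw [mul_comm]; exact Real.norm_exp_I_mul_ofReal_sub_one_le
  have h2 : ‖Complex.exp (x * Complex.I) - 1‖ ≤ 2 := by
    refine (norm_sub_le _ _).trans ?_
    rw [Complex.norm_exp_ofReal_mul_I, norm_one]; norm_num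
  rcases min_cases 1 |x| with h | h <;> rw [h.1] <;> linarith [abs_nonneg x]

/-- The infinite-volume limit of the Green function. -/
noncomputable def greenLimit (κ : Edge d → ℝ) (f f' : Lattice d →₀ ℝ) : ℝ :=
  limUnder atTop fun Λ => pair f' (dirichletSolve Λ κ f)

theorem greenLimit_eq (hd : 1 ≤ d) {κ : Edge d → ℝ} (hκ : ∀ b, 0 < κ b)
    {f : Lattice d →₀ ℝ} {g : Lattice d → ℝ} (hg : IsInverseImage κ f g)
    {f' : Lattice d →₀ ℝ} (hf' : (f'.sum fun _ a => a) = 0) : greenLimit κ f f' = pair f' g :=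
  (tendsto_pair_dirichletSolve hd hκ hg hf').limUnder_eq

theorem tendsto_greenLimit (hd : 1 ≤ d) {κ : Edge d → ℝ} (hκ : ∀ b, 0 < κ b)
    {f f' : Lattice d →₀ ℝ} (hf : (f.sum fun _ a => a) = 0) (hf' : (f'.sum fun _ a => a) = 0) :
    Tendsto (fun Λ => pair f' (dirichletSolve Λ κ f)) atTop (𝓝 (greenLimit κ f f')) := by
  obtain ⟨g, hg⟩ := exists_isInverseImage hκ hf
  rw [greenLimit_eq hd hκ hg hf']
  exact tendsto_pair_dirichletSolve hd hκ hg hf'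

theorem tendsto_greenForm (hd : 1 ≤ d) {κ : Edge d → ℝ} (hκ : ∀ b, 0 < κ b)
    {f : Lattice d →₀ ℝ} (hf : (f.sum fun _ a => a) = 0) {Λ : ℕ → Finset (Lattice d)}
    (hΛ : Tendsto Λ atTop atTop) :
    Tendsto (fun n => greenForm (Λ n) κ f) atTop (𝓝 (greenLimit κ f f)) := by
  refine ((tendsto_greenLimit hd hκ hf hf).comp hΛ).congr' ?_
  filter_upwards [hΛ.eventually (eventually_ge_atTop f.support)] with n hn
  exact pair_eq_sum hn _

theorem greenLimit_self_nonneg (hd : 1 ≤ d) {κ : Edge d → ℝ} (hκ : ∀ b, 0 < κ b)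
    {f : Lattice d →₀ ℝ} (hf : (f.sum fun _ a => a) = 0) : 0 ≤ greenLimit κ f f := by
  refine ge_of_tendsto (tendsto_greenLimit hd hκ hf hf) ?_
  filter_upwards [eventually_ge_atTop f.support] with Λ hΛ
  rw [pair_eq_sum hΛ]
  exact greenForm_nonneg hd (fun b _ => hκ b) f

theorem indicator_one_congr {α β : Type*} {s : Set α} {t : Set β} {x : α} {y : β}
    (h : x ∈ s ↔ y ∈ t) : s.indicator (1 : α → ℝ≥0∞) x = t.indicator (1 : β → ℝ≥0∞) y := by
  by_cases hx : x ∈ s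
  · rw [Set.indicator_of_mem hx, Set.indicator_of_mem (h.1 hx)]; rfl
  · rw [Set.indicator_of_notMem hx, Set.indicator_of_notMem (fun hy => hx (h.2 hy))]

instance isMarkovKernel_condLaw (μt : Measure ((Edge d → ℝ) × (Edge d → ℝ)))
    [IsFiniteMeasure μt] : IsMarkovKernel (condLaw μt) := by
  unfold condLaw
  infer_instance

/-- Dynkin's argument for vector-valued integrals; the whole space is included in the π-system in
order to treat complements. -/
theorem setIntegral_eq_zero_of_isPiSystem {α E : Type*} [mα : MeasurableSpace α]
    [NormedAddCommGroup E] [NormedSpace ℝ E] {ν : Measure α} {F : α → E} (hF : Integrable F ν)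
    {C : Set (Set α)} (hgen : mα = MeasurableSpace.generateFrom C) (hpi : IsPiSystem C)
    (huniv : Set.univ ∈ C) (h : ∀ s ∈ C, ∫ a in s, F a ∂ν = 0) {s : Set α}
    (hs : MeasurableSet s) : ∫ a in s, F a ∂ν = 0 := by
  induction s, hs using MeasurableSpace.induction_on_inter hgen hpi with
  | empty => simp
  | basic t ht => exact h t ht
  | compl t htm ht =>
    have h1 := integral_add_compl htm hF
    have h2 := h _ huniv
    rw [setIntegral_univ] at h2
    rwa [ht, h2, zero_add] at h1
  | iUnion t htd htm ht =>
    rw [integral_iUnion htm htd hF.integrableOn]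
    simp [ht]

section

variable {ϱ : Measure ℝ} [IsFiniteMeasure ϱ] {a c : ℝ} {μ : Measure (Edge d → ℝ)}
  [IsProbabilityMeasure μ] {μt : Measure ((Edge d → ℝ) × (Edge d → ℝ))} [IsProbabilityMeasure μt]

/-- On an event that depends on finitely many conductances, the law of a linear functional of the
field is that of its harmonic part plus an independent Gaussian. -/
theorem map_pair_field_eq (hd : 1 ≤ d) (ha : 0 < a) (hϱ : ϱ (Set.Icc a c)ᶜ = 0)
    (hG : IsGradientGibbs ϱ μ) (hext : IsExtension ϱ μ μt) {f : Lattice d →₀ ℝ} {θ : Edge d →₀ ℝ}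
    (hθ : ∀ h : Lattice d → ℝ, flowPair θ (grad h) = pair f h) {Λ : Finset (Lattice d)}
    (hf : f.support ⊆ Λ) {B : Set (Edge d → ℝ)} (hB : MeasurableSet B) (S : Finset (Edge d))
    (hBS : ∀ κ κ' : Edge d → ℝ, (∀ b ∈ S, κ b = κ' b) → (κ ∈ B ↔ κ' ∈ B)) :
    (μt.restrict (Prod.snd ⁻¹' B)).map (fun ω => pair f (field ω.1)) =
      ((μt.restrict (Prod.snd ⁻¹' B)).prod (gaussianReal 0 1)).map fun p =>
        flowPair θ (harmonicPart Λ p.1.2 p.1.1) + √(greenForm Λ p.1.2 f) * p.2 := by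
  classical
  have hw := measurable_flowPair_harmonicPart θ Λ
  have hg := measurable_greenForm Λ f (measurable_snd (α := Edge d → ℝ) (β := Edge d → ℝ))
  have hm : Measurable fun p : ((Edge d → ℝ) × (Edge d → ℝ)) × ℝ =>
      flowPair θ (harmonicPart Λ p.1.2 p.1.1) + √(greenForm Λ p.1.2 f) * p.2 := by
    have h1 : Measurable fun p : ((Edge d → ℝ) × (Edge d → ℝ)) × ℝ =>
      flowPair θ (harmonicPart Λ p.1.2 p.1.1) := hw.comp measurable_fst
    have h2 : Measurable fun p : ((Edge d → ℝ) × (Edge d → ℝ)) × ℝ =>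
      greenForm Λ p.1.2 f := hg.comp measurable_fst
    fun_prop
  have hB' : MeasurableSet (Prod.snd ⁻¹' B : Set ((Edge d → ℝ) × (Edge d → ℝ))) :=
    measurable_snd hB
  ext A hA
  set C : Set (((Edge d → ℝ) × (Edge d → ℝ)) × ℝ) :=
    {p | p.1.2 ∈ B ∧ flowPair θ (harmonicPart Λ p.1.2 p.1.1) + p.2 ∈ A} with hC
  have hCm : MeasurableSet C := by
    refine (hB'.preimage measurable_fst).inter (hA.preimage ?_)
    have h1 : Measurable fun p : ((Edge d → ℝ) × (Edge d → ℝ)) × ℝ =>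
      flowPair θ (harmonicPart Λ p.1.2 p.1.1) := hw.comp measurable_fst
    fun_prop
  -- The edge set must include `S`, so that the event `B` is a function of the retained
  -- conductances.
  have key := lintegral_resample hd (measure_compl_Ioi_eq_zero ha hϱ) hG hext Λ (touching Λ ∪ S)
    Finset.subset_union_left f (Φ := C.indicator 1) (measurable_one.indicator hCm)
    (fun η κ κ' s h => indicator_one_congr <| by
      simp only [hC, Set.mem_ofPred_eq]
      rw [hBS κ κ' fun b hb => h b (Finset.mem_union_right _ hb),
        harmonicPart_congr (fun b hb => h b (Finset.mem_union_left _ hb))])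
    (fun φ ψ κ s h => indicator_one_congr <| by
      simp only [hC, Set.mem_ofPred_eq]
      rw [harmonicPart_glue hd h])
  rw [Measure.map_apply (measurable_pair_field f) hA, Measure.map_apply hm hA,
    Measure.prod_apply (hm hA), Measure.restrict_apply (measurable_pair_field f hA),
    ← lintegral_indicator hB', ← lintegral_indicator_one ((measurable_pair_field f hA).inter hB')]
  refine Eq.trans ?_ (key.trans ?_)
  · refine lintegral_congr_ae ?_
    filter_upwards [ae_fst hext hG.1] with ω hω
    refine indicator_one_congr ?_
    simp only [hC, Set.mem_ofPred_eq, Set.mem_inter_iff, Set.mem_preimage]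
    rw [pair_field_eq hθ hf ω.2 hω, and_comm]
  · refine lintegral_congr fun ω => ?_
    by_cases hω : ω.2 ∈ B
    · rw [Set.indicator_of_mem (by exact hω), ← lintegral_indicator_one]
      · refine lintegral_congr fun t => ?_
        refine indicator_one_congr ?_
        simp only [hC, Set.mem_ofPred_eq, Set.mem_preimage, hω, true_and]
      · exact (hm.comp measurable_prodMk_left) hA
    · rw [Set.indicator_of_notMem (by exact hω)]
      simp [hC, hω]

theorem setIntegral_cexp_pair_field_eq (hd : 1 ≤ d) (ha : 0 < a) (hϱ : ϱ (Set.Icc a c)ᶜ = 0)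
    (hG : IsGradientGibbs ϱ μ) (hext : IsExtension ϱ μ μt) {f : Lattice d →₀ ℝ} {θ : Edge d →₀ ℝ}
    (hθ : ∀ h : Lattice d → ℝ, flowPair θ (grad h) = pair f h) {Λ : Finset (Lattice d)}
    (hf : f.support ⊆ Λ) {B : Set (Edge d → ℝ)} (hB : MeasurableSet B) (S : Finset (Edge d))
    (hBS : ∀ κ κ' : Edge d → ℝ, (∀ b ∈ S, κ b = κ' b) → (κ ∈ B ↔ κ' ∈ B)) :
    ∫ ω in Prod.snd ⁻¹' B, Complex.exp (pair f (field ω.1) * Complex.I) ∂μt =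
      ∫ ω in Prod.snd ⁻¹' B, Complex.exp (flowPair θ (harmonicPart Λ ω.2 ω.1) * Complex.I) *
        Complex.exp (-(greenForm Λ ω.2 f / 2 : ℝ)) ∂μt := by
  have hw := measurable_flowPair_harmonicPart θ Λ
  have hg := measurable_greenForm Λ f (measurable_snd (α := Edge d → ℝ) (β := Edge d → ℝ))
  have hm : Measurable fun p : ((Edge d → ℝ) × (Edge d → ℝ)) × ℝ =>
      flowPair θ (harmonicPart Λ p.1.2 p.1.1) + √(greenForm Λ p.1.2 f) * p.2 := by
    have h1 : Measurable fun p : ((Edge d → ℝ) × (Edge d → ℝ)) × ℝ =>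
      flowPair θ (harmonicPart Λ p.1.2 p.1.1) := hw.comp measurable_fst
    have h2 : Measurable fun p : ((Edge d → ℝ) × (Edge d → ℝ)) × ℝ =>
      greenForm Λ p.1.2 f := hg.comp measurable_fst
    fun_prop
  have hmc : Measurable fun x : ℝ => Complex.exp (x * Complex.I) := by fun_prop
  rw [← integral_map (f := fun x : ℝ => Complex.exp (x * Complex.I))
    (measurable_pair_field f).aemeasurable hmc.aestronglyMeasurable,
    map_pair_field_eq hd ha hϱ hG hext hθ hf hB S hBS,
    integral_map hm.aemeasurable hmc.aestronglyMeasurable,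
    integral_prod _ (integrable_cexp_ofReal_mul_I hm)]
  refine integral_congr_ae (ae_restrict_of_ae ?_)
  filter_upwards [ae_mem_of_extension hext measurableSet_Icc hϱ] with ω hω
  have h0 := greenForm_nonneg hd (Λ := Λ) (fun b _ => ha.trans_le (hω b).1) f
  conv_rhs => rw [← Real.sq_sqrt h0, ← integral_cexp_gaussianReal, ← integral_const_mul]
  refine integral_congr_ae (Eventually.of_forall fun t => ?_)
  simp only [← Complex.exp_add]
  push_cast
  ring_nf

/-- The left side does not depend on the volume. In the finite-volume formula the harmonic phase
tends to one in probability and the Green form converges, with all factors bounded by one. -/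
theorem setIntegral_cexp_pair_field (hd : 1 ≤ d) (ha : 0 < a) (hac : a ≤ c)
    (hϱ : ϱ (Set.Icc a c)ᶜ = 0) (hG : IsGradientGibbs ϱ μ) (hinv : IsTranslationInvariant μ)
    (herg : IsErgodic μ) (htilt : HasZeroTilt μ) (hext : IsExtension ϱ μ μt)
    {f : Lattice d →₀ ℝ} (hf : (f.sum fun _ a => a) = 0)
    {B : Set (Edge d → ℝ)} (hB : MeasurableSet B) (S : Finset (Edge d))
    (hBS : ∀ κ κ' : Edge d → ℝ, (∀ b ∈ S, κ b = κ' b) → (κ ∈ B ↔ κ' ∈ B)) :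
    ∫ ω in Prod.snd ⁻¹' B, Complex.exp (pair f (field ω.1) * Complex.I) ∂μt =
      ∫ ω in Prod.snd ⁻¹' B, Complex.exp (-(greenLimit ω.2 f f / 2 : ℝ)) ∂μt := by
  obtain ⟨θ, hθ⟩ := exists_flow_of_sum_eq_zero f hf
  obtain ⟨Λ, hΛ, hlim⟩ := exists_tendsto_integral_min_one_flowPair hd ha hac hϱ hG hinv herg htilt
    hext θ
  have hpos : ∀ᵐ ω ∂μt, ∀ b, 0 < ω.2 b := by
    filter_upwards [ae_mem_of_extension hext measurableSet_Icc hϱ] with ω hω b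
    exact ha.trans_le (hω b).1
  have hw := fun n => measurable_flowPair_harmonicPart θ (Λ n)
  have hg := fun n => measurable_greenForm (Λ n) f
    (measurable_snd (α := Edge d → ℝ) (β := Edge d → ℝ))
  have hge : ∀ n, Measurable fun ω : (Edge d → ℝ) × (Edge d → ℝ) =>
      Complex.exp (-(greenForm (Λ n) ω.2 f / 2 : ℝ)) := fun n => by
    have := hg n
    fun_prop
  have hle : ∀ n, ∀ᵐ ω ∂μt, ‖Complex.exp (-(greenForm (Λ n) ω.2 f / 2 : ℝ))‖ ≤ 1 := fun n => by
    filter_upwards [hpos] with ω hω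
    have h0 := greenForm_nonneg hd (Λ := Λ n) (fun b _ => hω b) f
    rw [← Complex.ofReal_neg, ← Complex.ofReal_exp, Complex.norm_real, Real.norm_eq_abs,
      Real.abs_exp, Real.exp_le_one_iff]
    linarith
  have hb : Tendsto (fun n => ∫ ω in Prod.snd ⁻¹' B,
      Complex.exp (-(greenForm (Λ n) ω.2 f / 2 : ℝ)) ∂μt) atTop
      (𝓝 (∫ ω in Prod.snd ⁻¹' B, Complex.exp (-(greenLimit ω.2 f f / 2 : ℝ)) ∂μt)) := by
    refine tendsto_integral_of_dominated_convergence (fun _ => 1)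
      (fun n => (hge n).aestronglyMeasurable) (integrable_const _)
      (fun n => ae_restrict_of_ae (hle n)) (ae_restrict_of_ae ?_)
    filter_upwards [hpos] with ω hω
    have h := (tendsto_greenForm hd hω hf hΛ).div_const 2
    exact ((Complex.continuous_exp.comp (continuous_neg.comp Complex.continuous_ofReal)).tendsto
      _).comp h
  refine tendsto_nhds_unique (tendsto_const_nhds (f := atTop (α := ℕ))) ?_
  have hdiff : Tendsto (fun n => ∫ ω in Prod.snd ⁻¹' B,
      (Complex.exp (flowPair θ (harmonicPart (Λ n) ω.2 ω.1) * Complex.I) - 1) *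
        Complex.exp (-(greenForm (Λ n) ω.2 f / 2 : ℝ)) ∂μt) atTop (𝓝 0) := by
    refine squeeze_zero_norm (fun n => ?_) (by simpa using hlim.const_mul 2)
    have hi : Integrable (fun ω => 2 * min 1 |flowPair θ (harmonicPart (Λ n) ω.2 ω.1)|) μt :=
      (integrable_min_one_abs (hw n)).const_mul 2
    rw [← integral_const_mul]
    refine (norm_integral_le_of_norm_le hi.integrableOn (ae_restrict_of_ae ?_)).trans
      (setIntegral_le_integral hi (Eventually.of_forall fun ω => ?_))
    · filter_upwards [hle n] with ω hω
      rw [norm_mul]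
      exact (mul_le_of_le_one_right (norm_nonneg _) hω).trans
        (norm_cexp_ofReal_mul_I_sub_one_le _)
    · exact mul_nonneg zero_le_two (le_min zero_le_one (abs_nonneg _))
  have hsum := hdiff.add hb
  rw [zero_add] at hsum
  refine hsum.congr' ?_
  filter_upwards [hΛ.eventually (eventually_ge_atTop f.support)] with n hn
  rw [setIntegral_cexp_pair_field_eq hd ha hϱ hG hext hθ hn hB S hBS, ← integral_add]
  · refine integral_congr_ae (Eventually.of_forall fun ω => ?_)
    simp only
    ring
  · have := hw n
    have := hge n
    refine Integrable.of_bound (C := 2) (by fun_prop) (ae_restrict_of_ae ?_)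
    filter_upwards [hle n] with ω hω
    rw [norm_mul]
    refine (mul_le_of_le_one_right (norm_nonneg _) hω).trans
      ((norm_cexp_ofReal_mul_I_sub_one_le _).trans ?_)
    linarith [min_le_left 1 |flowPair θ (harmonicPart (Λ n) ω.2 ω.1)|]
  · exact Integrable.of_bound (C := 1) (hge n).aestronglyMeasurable (ae_restrict_of_ae (hle n))

theorem ae_snd_pos (ha : 0 < a) (hϱ : ϱ (Set.Icc a c)ᶜ = 0) (hext : IsExtension ϱ μ μt) :
    ∀ᵐ κ ∂(μt.map Prod.snd), ∀ b, 0 < κ b := by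
  have hm : MeasurableSet {κ : Edge d → ℝ | ∀ b, 0 < κ b} := by
    rw [Set.ofPred_forall]
    exact MeasurableSet.iInter fun b => measurableSet_lt measurable_const (measurable_pi_apply b)
  rw [ae_map_iff measurable_snd.aemeasurable hm]
  filter_upwards [ae_mem_of_extension hext measurableSet_Icc hϱ] with ω hω b
  exact ha.trans_le (hω b).1

/-- Disintegration turns the identity on cylinder events into equality of integrals of two functions
of `κ`; cylinders generate, so these functions agree almost everywhere. -/
theorem ae_integral_cexp_condLaw (hd : 1 ≤ d) (ha : 0 < a) (hac : a ≤ c)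
    (hϱ : ϱ (Set.Icc a c)ᶜ = 0) (hG : IsGradientGibbs ϱ μ) (hinv : IsTranslationInvariant μ)
    (herg : IsErgodic μ) (htilt : HasZeroTilt μ) (hext : IsExtension ϱ μ μt)
    {f : Lattice d →₀ ℝ} (hf : (f.sum fun _ a => a) = 0) :
    ∀ᵐ κ ∂(μt.map Prod.snd), ∫ φ, Complex.exp (pair f φ * Complex.I) ∂(condLaw μt κ) =
      Complex.exp (-(greenLimit κ f f / 2 : ℝ)) := by
  have hpos := ae_snd_pos ha hϱ hext
  have : IsProbabilityMeasure (μt.map Prod.snd) :=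
    Measure.isProbabilityMeasure_map measurable_snd.aemeasurable
  have hfield : Measurable fun ω : (Edge d → ℝ) × (Edge d → ℝ) => field ω.1 :=
    measurable_field.comp measurable_fst
  have hpm : Measurable fun p : (Edge d → ℝ) × (Lattice d → ℝ) =>
      pair f p.2 := (continuous_pair f).measurable.comp measurable_snd
  have hcm : Measurable fun p : (Edge d → ℝ) × (Lattice d → ℝ) =>
      Complex.exp (pair f p.2 * Complex.I) := by fun_prop
  have hintegrable : Integrable (fun κ => ∫ φ, Complex.exp (pair f φ * Complex.I) ∂(condLaw μt κ))
      (μt.map Prod.snd) :=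
    Integrable.integral_condDistrib_map (f := fun p : (Edge d → ℝ) × (Lattice d → ℝ) =>
      Complex.exp (pair f p.2 * Complex.I)) hfield.aemeasurable (integrable_cexp_ofReal_mul_I hpm)
  obtain ⟨Λ, hΛ⟩ := exists_seq_tendsto (atTop : Filter (Finset (Lattice d)))
  have hQm : AEStronglyMeasurable (fun κ => Complex.exp (-(greenLimit κ f f / 2 : ℝ)))
      (μt.map Prod.snd) := by
    have h1 : AEStronglyMeasurable (fun κ => greenLimit κ f f) (μt.map Prod.snd) := by
      refine aestronglyMeasurable_of_tendsto_ae (f := fun n κ => greenForm (Λ n) κ f) atTop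
        (fun n => (measurable_greenForm (Λ n) f measurable_id).aestronglyMeasurable) ?_
      filter_upwards [hpos] with κ hκ
      exact tendsto_greenForm hd hκ hf hΛ
    have h2 : Continuous fun x : ℝ => Complex.exp (-(x / 2 : ℝ)) := by fun_prop
    exact h2.comp_aestronglyMeasurable h1
  have hQi : Integrable (fun κ => Complex.exp (-(greenLimit κ f f / 2 : ℝ)))
      (μt.map Prod.snd) := by
    refine Integrable.of_bound (C := 1) hQm ?_
    filter_upwards [hpos] with κ hκ
    have h0 := greenLimit_self_nonneg hd hκ hf
    rw [← Complex.ofReal_neg, ← Complex.ofReal_exp, Complex.norm_real, Real.norm_eq_abs,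
      Real.abs_exp, Real.exp_le_one_iff]
    linarith
  have hset : ∀ B ∈ measurableCylinders (fun _ : Edge d => ℝ),
      ∫ κ in B, ((∫ φ, Complex.exp (pair f φ * Complex.I) ∂(condLaw μt κ)) -
        Complex.exp (-(greenLimit κ f f / 2 : ℝ))) ∂(μt.map Prod.snd) = 0 := by
    intro B hBc
    have hB := MeasurableSet.of_mem_measurableCylinders hBc
    obtain ⟨S, A, hA, rfl⟩ := (mem_measurableCylinders _).1 hBc
    rw [integral_sub hintegrable.integrableOn hQi.integrableOn, sub_eq_zero,
      setIntegral_map hB hQm measurable_snd.aemeasurable,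
      ← setIntegral_cexp_pair_field hd ha hac hϱ hG hinv herg htilt hext hf hB S]
    · have h := Measure.setIntegral_compProd (μ := μt.map Prod.snd) (κ := condLaw μt) hB
        MeasurableSet.univ (f := fun p : (Edge d → ℝ) × (Lattice d → ℝ) =>
          Complex.exp (pair f p.2 * Complex.I)) (integrable_cexp_ofReal_mul_I hpm).integrableOn
      simp only [setIntegral_univ] at h
      rw [← h]
      unfold condLaw
      rw [compProd_map_condDistrib hfield.aemeasurable,
        setIntegral_map (hB.prod MeasurableSet.univ) hcm.aestronglyMeasurable
          (measurable_snd.prodMk hfield).aemeasurable]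
      congr 2
      ext ω
      simp
    · intro κ κ' h
      simp only [mem_cylinder]
      rw [show S.restrict κ = S.restrict κ' from funext fun b => h b b.2]
  refine hintegrable.ae_eq_of_forall_setIntegral_eq _ _ hQi fun B hB _ => ?_
  rw [← sub_eq_zero, ← integral_sub hintegrable.integrableOn hQi.integrableOn]
  exact setIntegral_eq_zero_of_isPiSystem (hintegrable.sub hQi) generateFrom_measurableCylinders.symm
    isPiSystem_measurableCylinders (univ_mem_measurableCylinders _) hset hB

end

end GradientGibbs

namespace GradientGibbs
open MeasureTheory ProbabilityTheory Filter Topology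
open scoped ENNReal

variable {d : ℕ}

/-! ### Gaussianity of the conditional law -/

section GreenLimit

variable {κ : Edge d → ℝ}

/-- In finite volume both sides are the energy inner product of the two Dirichlet solutions. -/
theorem greenLimit_comm (hd : 1 ≤ d) (hκ : ∀ b, 0 < κ b) {f f' : Lattice d →₀ ℝ}
    (hf : (f.sum fun _ a => a) = 0) (hf' : (f'.sum fun _ a => a) = 0) :
    greenLimit κ f f' = greenLimit κ f' f := by
  classical
  refine tendsto_nhds_unique ((tendsto_greenLimit hd hκ hf hf').congr' ?_)
    (tendsto_greenLimit hd hκ hf' hf)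
  filter_upwards [eventually_ge_atTop (f.support ∪ f'.support)] with Λ hΛ
  rw [pair_eq_sum (Finset.union_subset_right hΛ), pair_eq_sum (Finset.union_subset_left hΛ),
    ← sum_touching_dirichletSolve hd (fun b _ => hκ b) f' (dirichletSolve_of_notMem κ f),
    ← sum_touching_dirichletSolve hd (fun b _ => hκ b) f (dirichletSolve_of_notMem κ f')]
  exact Finset.sum_congr rfl fun b _ => by ring

theorem greenLimit_add_right (hd : 1 ≤ d) (hκ : ∀ b, 0 < κ b) {f f' f'' : Lattice d →₀ ℝ}
    (hf : (f.sum fun _ a => a) = 0) (hf' : (f'.sum fun _ a => a) = 0)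
    (hf'' : (f''.sum fun _ a => a) = 0) :
    greenLimit κ f (f' + f'') = greenLimit κ f f' + greenLimit κ f f'' := by
  obtain ⟨g, hg⟩ := exists_isInverseImage hκ hf
  rw [greenLimit_eq hd hκ hg hf', greenLimit_eq hd hκ hg hf'', ← pair_add]
  refine greenLimit_eq hd hκ hg ?_
  rw [Finsupp.sum_add_index' (by simp) (by simp), hf', hf'', add_zero]

theorem greenLimit_smul_right (hd : 1 ≤ d) (hκ : ∀ b, 0 < κ b) {f f' : Lattice d →₀ ℝ}
    (hf : (f.sum fun _ a => a) = 0) (hf' : (f'.sum fun _ a => a) = 0) (r : ℝ) :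
    greenLimit κ f (r • f') = r * greenLimit κ f f' := by
  obtain ⟨g, hg⟩ := exists_isInverseImage hκ hf
  rw [greenLimit_eq hd hκ hg hf', ← pair_smul]
  refine greenLimit_eq hd hκ hg ?_
  rw [Finsupp.sum_smul_index (by simp), ← Finsupp.mul_sum, hf', mul_zero]

/-- The projection of a finitely supported function to zero sum, by a point mass at the origin. -/
noncomputable def zeroSum (d : ℕ) : (Lattice d →₀ ℝ) →ₗ[ℝ] (Lattice d →₀ ℝ) :=
  LinearMap.id - (Finsupp.lsingle 0) ∘ₗ (Finsupp.linearCombination ℝ fun _ => (1 : ℝ))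

theorem zeroSum_apply (c : Lattice d →₀ ℝ) :
    zeroSum d c = c - Finsupp.single 0 (c.sum fun _ a => a) := by
  simp [zeroSum, Finsupp.linearCombination_apply]

theorem sum_zeroSum (c : Lattice d →₀ ℝ) : ((zeroSum d c).sum fun _ a => a) = 0 := by
  rw [zeroSum_apply, Finsupp.sum_sub_index (by simp), Finsupp.sum_single_index rfl, sub_self]

theorem zeroSum_of_sum_eq_zero {c : Lattice d →₀ ℝ} (hc : (c.sum fun _ a => a) = 0) :
    zeroSum d c = c := by
  rw [zeroSum_apply, hc]; simp

theorem pair_zeroSum (c : Lattice d →₀ ℝ) (φ : Lattice d → ℝ) :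
    pair (zeroSum d c) φ = pair c fun x => φ x - φ 0 := by
  rw [← pair_sub_const (sum_zeroSum c) φ (φ 0), zeroSum_apply]
  have h := pair_add (c - Finsupp.single 0 (c.sum fun _ a => a))
    (Finsupp.single 0 (c.sum fun _ a => a)) fun x => φ x - φ 0
  rw [sub_add_cancel, pair_single, sub_self, mul_zero, add_zero] at h
  exact h.symm

/-- The bilinear form of the infinite-volume Green function on the projections to zero sum. -/
noncomputable def greenBilin (hd : 1 ≤ d) (hκ : ∀ b, 0 < κ b) :
    (Lattice d →₀ ℝ) →ₗ[ℝ] (Lattice d →₀ ℝ) →ₗ[ℝ] ℝ :=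
  LinearMap.mk₂ ℝ (fun c c' => greenLimit κ (zeroSum d c) (zeroSum d c'))
    (fun c₁ c₂ c' => by
      have h := greenLimit_add_right hd hκ (sum_zeroSum c') (sum_zeroSum c₁) (sum_zeroSum c₂)
      rw [← map_add] at h
      rw [greenLimit_comm hd hκ (sum_zeroSum _) (sum_zeroSum _), h,
        greenLimit_comm hd hκ (sum_zeroSum c₁) (sum_zeroSum c'),
        greenLimit_comm hd hκ (sum_zeroSum c₂) (sum_zeroSum c')])
    (fun r c c' => by
      have h := greenLimit_smul_right hd hκ (sum_zeroSum c') (sum_zeroSum c) r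
      rw [← map_smul] at h
      rw [greenLimit_comm hd hκ (sum_zeroSum _) (sum_zeroSum _), h,
        greenLimit_comm hd hκ (sum_zeroSum c) (sum_zeroSum c'), smul_eq_mul])
    (fun c c₁ c₂ => by
      rw [map_add, greenLimit_add_right hd hκ (sum_zeroSum _) (sum_zeroSum _) (sum_zeroSum _)])
    (fun r c c' => by
      rw [map_smul, greenLimit_smul_right hd hκ (sum_zeroSum _) (sum_zeroSum _), smul_eq_mul])

theorem greenBilin_apply (hd : 1 ≤ d) (hκ : ∀ b, 0 < κ b) (c c' : Lattice d →₀ ℝ) :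
    greenBilin hd hκ c c' = greenLimit κ (zeroSum d c) (zeroSum d c') := rfl

theorem greenBilin_comm (hd : 1 ≤ d) (hκ : ∀ b, 0 < κ b) (c c' : Lattice d →₀ ℝ) :
    greenBilin hd hκ c c' = greenBilin hd hκ c' c :=
  greenLimit_comm hd hκ (sum_zeroSum c) (sum_zeroSum c')

theorem greenBilin_self_nonneg (hd : 1 ≤ d) (hκ : ∀ b, 0 < κ b) (c : Lattice d →₀ ℝ) :
    0 ≤ greenBilin hd hκ c c := greenLimit_self_nonneg hd hκ (sum_zeroSum c)

theorem greenBilin_self_eq_sum (hd : 1 ≤ d) (hκ : ∀ b, 0 < κ b) {c : Lattice d →₀ ℝ}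
    {S : Finset (Lattice d)} (hc : c.support ⊆ S) :
    greenBilin hd hκ c c = ∑ x ∈ S, ∑ y ∈ S, c x * (c y *
      greenBilin hd hκ (Finsupp.single x 1) (Finsupp.single y 1)) := by
  have h : c = ∑ x ∈ S, c x • Finsupp.single x (1 : ℝ) := by
    conv_lhs => rw [← Finsupp.sum_single c, Finsupp.sum_of_support_subset c hc _ (by simp)]
    simp
  conv_lhs => rw [h]
  simp only [map_sum, map_smul, LinearMap.sum_apply, LinearMap.smul_apply, smul_eq_mul,
    Finset.mul_sum]
  rw [Finset.sum_comm]
  refine Finset.sum_congr rfl fun x _ => Finset.sum_congr rfl fun y _ => ?_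
  ring

end GreenLimit

theorem exists_rat_tendsto (c : Lattice d →₀ ℝ) : ∃ q : ℕ → Lattice d →₀ ℚ,
    (∀ n, (q n).support ⊆ c.support) ∧
      ∀ x, Tendsto (fun n => ((q n x : ℚ) : ℝ)) atTop (𝓝 (c x)) := by
  have h : ∀ (n : ℕ) (r : ℝ), ∃ q : ℚ, |r - q| < 1 / ((n : ℝ) + 1) := fun n r =>
    exists_rat_near r Nat.one_div_pos_of_nat
  choose ρ hρ using h
  -- Zeros are kept exactly, so the approximations are supported in the support of `c` and all sums
  -- stay over one finite set.
  refine ⟨fun n => c.mapRange (fun r => if r = 0 then 0 else ρ n r) (by simp),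
    fun n => Finsupp.support_mapRange, fun x => ?_⟩
  simp only [Finsupp.mapRange_apply]
  by_cases hx : c x = 0
  · simp [hx]
  · simp only [hx, if_false]
    rw [tendsto_iff_norm_sub_tendsto_zero]
    refine squeeze_zero (fun n => norm_nonneg _) (fun n => ?_)
      tendsto_one_div_add_atTop_nhds_zero_nat
    rw [Real.norm_eq_abs, abs_sub_comm]
    exact (hρ n _).le

/-- A finitely supported rational function as a real one. -/
noncomputable def ratCast (q : Lattice d →₀ ℚ) : Lattice d →₀ ℝ :=
  q.mapRange (fun r : ℚ => (r : ℝ)) Rat.cast_zero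

section Law

variable {κ : Edge d → ℝ} {P : Measure (Lattice d → ℝ)}

/-- Both sides are continuous in the finitely many coefficients of `c`. Thus countably many test
functions, and so a single null set of `κ`, suffice. -/
theorem integral_cexp_of_rat [IsProbabilityMeasure P] (hd : 1 ≤ d) (hκ : ∀ b, 0 < κ b)
    (h : ∀ q : Lattice d →₀ ℚ,
      ∫ φ, Complex.exp (pair (zeroSum d (ratCast q)) φ * Complex.I) ∂P =
        Complex.exp (-(greenBilin hd hκ (ratCast q) (ratCast q) / 2 : ℝ)))
    (c : Lattice d →₀ ℝ) :
    ∫ φ, Complex.exp (pair (zeroSum d c) φ * Complex.I) ∂P =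
      Complex.exp (-(greenBilin hd hκ c c / 2 : ℝ)) := by
  obtain ⟨q, hq, hlim⟩ := exists_rat_tendsto c
  have hsupp : ∀ n, (ratCast (q n)).support ⊆ c.support := fun n =>
    Finsupp.support_mapRange.trans (hq n)
  have hlim' : ∀ x, Tendsto (fun n => ratCast (q n) x) atTop (𝓝 (c x)) := hlim
  have h1 : Tendsto (fun n => ∫ φ, Complex.exp (pair (zeroSum d (ratCast (q n))) φ * Complex.I) ∂P)
      atTop (𝓝 (∫ φ, Complex.exp (pair (zeroSum d c) φ * Complex.I) ∂P)) := by
    refine tendsto_integral_of_dominated_convergence (fun _ => 1) (fun n => ?_)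
      (integrable_const _) (fun n => Eventually.of_forall fun φ => ?_)
      (Eventually.of_forall fun φ => ?_)
    · have := (continuous_pair (zeroSum d (ratCast (q n)))).measurable
      exact Measurable.aestronglyMeasurable (by fun_prop)
    · rw [Complex.norm_exp_ofReal_mul_I]
    · have hp : Tendsto (fun n => pair (zeroSum d (ratCast (q n))) φ) atTop
          (𝓝 (pair (zeroSum d c) φ)) := by
        simp only [pair_zeroSum, pair_eq_sum (hsupp _), pair_eq_sum (subset_refl c.support)]
        exact tendsto_finsetSum _ fun x _ => (hlim' x).mul_const _
      have hc : Continuous fun x : ℝ => Complex.exp (x * Complex.I) := by fun_prop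
      exact (hc.tendsto _).comp hp
  have h2 : Tendsto (fun n => Complex.exp
      (-(greenBilin hd hκ (ratCast (q n)) (ratCast (q n)) / 2 : ℝ))) atTop
      (𝓝 (Complex.exp (-(greenBilin hd hκ c c / 2 : ℝ)))) := by
    have hp : Tendsto (fun n => greenBilin hd hκ (ratCast (q n)) (ratCast (q n))) atTop
        (𝓝 (greenBilin hd hκ c c)) := by
      simp only [greenBilin_self_eq_sum hd hκ (hsupp _),
        greenBilin_self_eq_sum hd hκ (subset_refl c.support)]
      exact tendsto_finsetSum _ fun x _ => tendsto_finsetSum _ fun y _ =>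
        (hlim' x).mul ((hlim' y).mul_const _)
    have hc : Continuous fun x : ℝ => Complex.exp (-(x / 2 : ℝ)) := by fun_prop
    exact (hc.tendsto _).comp hp
  simp only [h] at h1
  exact tendsto_nhds_unique h1 h2

/-- Since `φ_0 = 0` almost surely, `c` and its zero-sum projection pair equally with `φ`; applying
the formula to `t • c` yields the whole characteristic function. -/
theorem map_pair_eq_gaussianReal [IsProbabilityMeasure P] (hd : 1 ≤ d) (hκ : ∀ b, 0 < κ b)
    (h0 : ∀ᵐ φ ∂P, φ 0 = 0)
    (h : ∀ c : Lattice d →₀ ℝ, ∫ φ, Complex.exp (pair (zeroSum d c) φ * Complex.I) ∂P =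
      Complex.exp (-(greenBilin hd hκ c c / 2 : ℝ))) (c : Lattice d →₀ ℝ) :
    P.map (pair c) = gaussianReal 0 (greenBilin hd hκ c c).toNNReal := by
  have hm := (continuous_pair c).measurable
  have : IsProbabilityMeasure (P.map (pair c)) :=
    Measure.isProbabilityMeasure_map hm.aemeasurable
  refine Measure.ext_of_charFun (funext fun t => ?_)
  rw [charFun_gaussianReal, charFun_apply_real, integral_map hm.aemeasurable
    (Measurable.aestronglyMeasurable (by fun_prop))]
  have h1 := h (t • c)
  have h2 : ∫ φ, Complex.exp (pair (zeroSum d (t • c)) φ * Complex.I) ∂P =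
      ∫ φ, Complex.exp (t * pair c φ * Complex.I) ∂P := by
    refine integral_congr_ae ?_
    filter_upwards [h0] with φ hφ
    rw [map_smul, pair_smul, pair_zeroSum, hφ]
    simp
  rw [← h2, h1, map_smul, map_smul, LinearMap.smul_apply,
    Real.coe_toNNReal _ (greenBilin_self_nonneg hd hκ c)]
  congr 1
  simp only [smul_eq_mul]
  push_cast
  ring

/-- A functional continuous in the product topology lies in the span of the coordinate projections.
-/
theorem exists_pair_eq_of_strongDual (L : StrongDual ℝ (Lattice d → ℝ)) :
    ∃ c : Lattice d →₀ ℝ, ⇑L = pair c := by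
  have h : L.toLinearMap ∈ Submodule.span ℝ
      (Set.range fun x : Lattice d => (LinearMap.proj x : (Lattice d → ℝ) →ₗ[ℝ] ℝ)) := by
    rw [LinearMap.mem_span_iff_continuous]
    exact L.continuous
  obtain ⟨c, hc⟩ := Finsupp.mem_span_range_iff_exists_finsupp.1 h
  refine ⟨c, funext fun φ => ?_⟩
  have := LinearMap.congr_fun hc φ
  simp only [Finsupp.sum, LinearMap.sum_apply, LinearMap.smul_apply, LinearMap.proj_apply,
    smul_eq_mul] at this
  exact this.symm

theorem isGaussian_of_map_pair
    (h : ∀ c : Lattice d →₀ ℝ, ∃ v, P.map (pair c) = gaussianReal 0 v) : IsGaussian P := by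
  refine isGaussian_of_map_eq_gaussianReal fun L => ?_
  obtain ⟨c, hc⟩ := exists_pair_eq_of_strongDual L
  obtain ⟨v, hv⟩ := h c
  exact ⟨0, v, by rw [hc, hv]⟩

theorem integral_pair_eq_zero {c : Lattice d →₀ ℝ} {v : NNReal}
    (h : P.map (pair c) = gaussianReal 0 v) : ∫ φ, pair c φ ∂P = 0 := by
  have := integral_map (μ := P) (continuous_pair c).measurable.aemeasurable
    (f := fun x : ℝ => x) (Measurable.aestronglyMeasurable (by fun_prop))
  rw [← this, h, integral_id_gaussianReal]

theorem variance_pair {c : Lattice d →₀ ℝ} {v : NNReal}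
    (h : P.map (pair c) = gaussianReal 0 v) : variance (pair c) P = v := by
  have := variance_map (μ := P) (X := id) (Y := pair c) (by fun_prop)
    (continuous_pair c).measurable.aemeasurable
  rw [h, variance_id_gaussianReal] at this
  exact this.symm

theorem memLp_pair {c : Lattice d →₀ ℝ} {v : NNReal}
    (h : P.map (pair c) = gaussianReal 0 v) : MemLp (pair c) 2 P := by
  have h2 : MemLp id 2 (P.map (pair c)) := by rw [h]; exact memLp_id_gaussianReal 2
  exact (memLp_map_measure_iff (by fun_prop) (continuous_pair c).measurable.aemeasurable).1 h2

/-- Polarization of the variances. -/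
theorem covariance_pair [IsProbabilityMeasure P] (hd : 1 ≤ d) (hκ : ∀ b, 0 < κ b)
    (h : ∀ c : Lattice d →₀ ℝ, P.map (pair c) = gaussianReal 0 (greenBilin hd hκ c c).toNNReal)
    (c c' : Lattice d →₀ ℝ) :
    covariance (pair c') (pair c) P = greenBilin hd hκ c c' := by
  have hv : ∀ c, variance (pair c) P = greenBilin hd hκ c c := fun c => by
    rw [variance_pair (h c), Real.coe_toNNReal _ (greenBilin_self_nonneg hd hκ c)]
  have h1 := variance_add (memLp_pair (h c')) (memLp_pair (h c))
  have h2 : pair c' + pair c = pair (c' + c) := funext fun φ => (pair_add c' c φ).symm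
  rw [h2, hv, hv, hv] at h1
  simp only [map_add, LinearMap.add_apply] at h1
  have h3 := greenBilin_comm hd hκ c c'
  linarith

end Law

theorem ae_condLaw_zero (μt : Measure ((Edge d → ℝ) × (Edge d → ℝ))) [IsFiniteMeasure μt] :
    ∀ᵐ κ ∂(μt.map Prod.snd), ∀ᵐ φ ∂(condLaw μt κ), φ 0 = 0 := by
  have hfield : Measurable fun ω : (Edge d → ℝ) × (Edge d → ℝ) => field ω.1 :=
    measurable_field.comp measurable_fst
  have hm : MeasurableSet {p : (Edge d → ℝ) × (Lattice d → ℝ) | p.2 0 = 0} :=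
    measurableSet_eq_fun (by fun_prop) measurable_const
  refine (Measure.ae_compProd_iff hm).1 ?_
  unfold condLaw
  rw [compProd_map_condDistrib hfield.aemeasurable,
    ae_map_iff (measurable_snd.prodMk hfield).aemeasurable hm]
  exact Eventually.of_forall fun ω => field_zero _

theorem le_of_measure_compl_Icc {ϱ : Measure ℝ} (hϱ : ϱ ≠ 0) {a c : ℝ}
    (h : ϱ (Set.Icc a c)ᶜ = 0) : a ≤ c := by
  by_contra hac
  rw [Set.Icc_eq_empty hac, Set.compl_empty, Measure.measure_univ_eq_zero] at h
  exact hϱ h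

end GradientGibbs

open MeasureTheory ProbabilityTheory GradientGibbs in
theorem lemma3p4 {d : ℕ} (hd : 1 ≤ d)
    (ϱ : Measure ℝ) [IsFiniteMeasure ϱ] (hϱ : ϱ ≠ 0)
    (hsupp : ∃ a b : ℝ, 0 < a ∧ ϱ (Set.Icc a b)ᶜ = 0)
    (μ : Measure (Edge d → ℝ)) [IsProbabilityMeasure μ]
    (hGibbs : IsGradientGibbs ϱ μ) (hinv : IsTranslationInvariant μ)
    (herg : IsErgodic μ) (htilt : HasZeroTilt μ)
    (μt : Measure ((Edge d → ℝ) × (Edge d → ℝ))) [IsProbabilityMeasure μt]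
    (hext : IsExtension ϱ μ μt) :
    ∀ᵐ κ ∂(μt.map Prod.snd),
      condLaw μt κ {φ | φ 0 = 0}ᶜ = 0 ∧
      IsGaussian (condLaw μt κ) ∧
      (∀ x : Lattice d, ∫ φ, φ x ∂(condLaw μt κ) = 0) ∧
      ∀ f : Lattice d →₀ ℝ, (f.sum fun _ a => a) = 0 →
        (∃ g, IsInverseImage κ f g) ∧
        ∀ g, IsInverseImage κ f g →
          variance (pair f) (condLaw μt κ) = pair f g ∧
          ∀ f' : Lattice d →₀ ℝ, (f'.sum fun _ a => a) = 0 →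
            covariance (pair f') (pair f) (condLaw μt κ) = pair f' g := by
  obtain ⟨a, c, ha, hac⟩ := hsupp
  have hle := le_of_measure_compl_Icc hϱ hac
  -- The null set from the conditional characteristic function depends on the test function, so only
  -- the countable rational family is treated here, projected to zero sum.
  have hrat := MeasureTheory.ae_all_iff.2 fun q : Lattice d →₀ ℚ =>
    ae_integral_cexp_condLaw hd ha hle hac hGibbs hinv herg htilt hext
      (sum_zeroSum (ratCast q))
  filter_upwards [ae_snd_pos ha hac hext, ae_condLaw_zero μt, hrat] with κ hκ h0 hq
  have hlaw := map_pair_eq_gaussianReal hd hκ h0 (integral_cexp_of_rat hd hκ hq)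
  refine ⟨h0, isGaussian_of_map_pair fun c => ⟨_, hlaw c⟩, fun x => ?_, fun f hf =>
    ⟨exists_isInverseImage hκ hf, fun g hg => ?_⟩⟩
  · have h := integral_pair_eq_zero (hlaw (Finsupp.single x 1))
    simpa only [pair_single, one_mul] using h
  · have hcov : ∀ f' : Lattice d →₀ ℝ, (f'.sum fun _ a => a) = 0 →
        covariance (pair f') (pair f) (condLaw μt κ) = pair f' g := fun f' hf' => by
      rw [covariance_pair hd hκ hlaw, greenBilin_apply, zeroSum_of_sum_eq_zero hf,
        zeroSum_of_sum_eq_zero hf', greenLimit_eq hd hκ hg hf']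
    refine ⟨?_, hcov⟩
    rw [← covariance_self (continuous_pair f).measurable.aemeasurable, hcov f hf]
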